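/- **Setting.** Let $a_1,a_2,a_3\in\mathbb C$ be distinct, $\alpha_1,\alpha_2,\alpha_3\in\mathbb C\setminus\mathbb Z$, $\sum_j\alpha_j=0$, and $f(z)=\prod_{j=1}^3(z-a_j)^{\alpha_j}$ with $f(\infty)=1$. A compact $K\subset\mathbb C$ is *admissible* for $f$ if $\mathbb C\setminus K$ is connected and $f$ continues from a neighbourhood of $\infty$ to a holomorphic function on $\overline{\mathbb C}\setminus K$. Let $S$ be the Stahl compact of $f$, i.e. the admissible compact of minimal logarithmic capacity. The points $a_j$ are in general position, so that $S=S_1\cup S_2\cup S_3$, where $S_j$ is an arc joining $a_j$ with the Chebotarev point $v$ and the $S_j$ meet only at $v$. Let $g_S(\cdot,\infty)$ be the Green function of $\overline{\mathbb C}\setminus S$ with pole at $\infty$, equal to $0$ on $S$. For an arc $L$ let $L^0$ be the arc without its end points. The family $\mathcal G_f$ consists of the admissible compacts $\Gamma=\Gamma_1\cup\Gamma_2\cup\Gamma_3$, where $\Gamma_j$ is an analytic arc (a Jordan arc that is regular and real-analytic in its interior) joining $a_j$ with $v$ and homotopic to $S_j$ (with fixed end points, through paths in $\overline{\mathbb C}$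 whose interior avoids $a_1,a_2,a_3$), and the $\Gamma_j$ meet only at $v$. A compact $\Gamma^\perp\subset\mathbb C$ is *dual* to $\Gamma$ (and $S$) if it is a union of six Jordan arcs issuing from some point $c\in\mathbb C\setminus S$, three of them ending at $v$ and three at $a_1,a_2,a_3$ respectively, without other common points, such that $\mathbb C\setminus\Gamma^\perp$ is the union of three disjoint domains $D_1,D_2,D_3$ with $S_j^0\subset D_j$ and $D_j\cap\Gamma=\Gamma_j^0$. (In particular $\Gamma\cap\Gamma^\perp=\{a_1,a_2,a_3,v\}$.) For a compact $K$ let $M_1(K)$ be the set of Borel probability measures carried by $K$, and let $[\mu,\nu]=\iint\log\frac1{|z-\zeta|}\,d\mu(z)\,d\nu(\zeta)$. Put $A=(a_{ij})=\begin{pmatrix}1&-1\\-1&4\end{pmatrix}$ and $\psi=3g_S(\cdot,\infty)$. For $\mu_1\in M_1(\Gamma)$ and $\mu_2\in M_1(\Gamma^\perp)$ let $$J_{A,\psi}(\mu_1,\mu_2)=\sum_{i,j=1}^2a_{ij}[\mu_i,\mu_j]+2\int_{\Gamma^\perp}\psi\,d\mu_2$$ if $[\mu_1,\mu_1]$ and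 $[\mu_2,\mu_2]$ are finite, and $J_{A,\psi}(\mu_1,\mu_2)=+\infty$ otherwise. **Lemma 2.** Let $\Gamma\in\mathcal G_f$ and let $\Gamma^\perp$ be a compact dual to $\Gamma$. There is a unique pair $(\lambda_1,\lambda_2)\in M_1(\Gamma)\times M_1(\Gamma^\perp)$ such that $$J_{A,\psi}(\lambda_1,\lambda_2)=m(\Gamma,\Gamma^\perp):=\inf\{J_{A,\psi}(\mu_1,\mu_2):\mu_1\in M_1(\Gamma),\ \mu_2\in M_1(\Gamma^\perp)\}.$$ Moreover $\operatorname{supp}\lambda_1=\Gamma$ and $\operatorname{supp}\lambda_2=\Gamma^\perp$. -/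

import Mathlib

open MeasureTheory Filter Topology
open scoped ENNReal unitInterval

noncomputable section

/-! ### Logarithmic potential theory in the plane -/

/-- The logarithmic kernel `log (1 / |z - ζ|)`, with value `+∞` on the diagonal
(recall that `ENNReal.log 0 = ⊥`). -/
def logKernel (z ζ : ℂ) : EReal := -ENNReal.log ‖z - ζ‖ₑ

/-- The integral of an extended-real function: integral of the positive part minus integral of the
negative part. (For the logarithmic kernel and measures carried by a compact set, the negative
part has a finite integral, so the difference is meaningful.) -/
def extIntegral {X : Type*} [MeasurableSpace X] (μ : Measure X) (f : X → EReal) : EReal :=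
  ((∫⁻ x, (f x).toENNReal ∂μ : ℝ≥0∞) : EReal) - ((∫⁻ x, (-f x).toENNReal ∂μ : ℝ≥0∞) : EReal)

/-- The mutual energy `[μ, ν] = ∬ log (1 / |z - ζ|) dμ(z) dν(ζ)`. -/
def mutualEnergy (μ ν : Measure ℂ) : EReal :=
  extIntegral (μ.prod ν) fun p => logKernel p.1 p.2

/-- `M₁(K)`: unit (positive Borel) measures carried by `K`. -/
def unitMeasures (K : Set ℂ) : Set (Measure ℂ) :=
  {μ | IsProbabilityMeasure μ ∧ μ Kᶜ = 0}

/-- The Robin constant of `K`: the infimum of the energies of the unit measures on `K`. -/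
def robinConstant (K : Set ℂ) : EReal := ⨅ μ ∈ unitMeasures K, mutualEnergy μ μ

/-- The logarithmic capacity `cap K = exp (-γ_K)`. -/
def logCapacity (K : Set ℂ) : ℝ≥0∞ := EReal.exp (-robinConstant K)

/-- `g` is the Green function `g_K(·, ∞)` of the complement of `K` with pole at infinity,
extended by zero to `K`: it is continuous, vanishes on `K`, is harmonic off `K`, and
`g(z) - log |z|` is bounded near infinity. These properties determine `g`. -/
structure IsGreenAtInfty (K : Set ℂ) (g : ℂ → ℝ) : Prop where
  continuous : Continuous g
  zero_on : ∀ z ∈ K, g z = 0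
  harmonic : InnerProductSpace.HarmonicOnNhd g Kᶜ
  log_pole : ∃ C : ℝ, ∀ᶠ z in Bornology.cobounded ℂ, |g z - Real.log ‖z‖| ≤ C

/-- The vector energy of a pair of measures with interaction matrix `A`, in an external field `ψ`
that acts on the second measure only, on the plate `F`:
`J(μ₁, μ₂) = ∑ i j, a_ij [μ_i, μ_j] + 2 ∫_F ψ dμ₂`.
If one of the measures has infinite energy, the value is `+∞` (the mutual energy of
two measures of finite energy on compact sets is finite, so the sum makes sense otherwise). -/
def vectorEnergy (A : Matrix (Fin 2) (Fin 2) ℝ) (ψ : ℂ → ℝ) (F : Set ℂ)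
    (μ : Fin 2 → Measure ℂ) : EReal :=
  open scoped Classical in
  if ∀ i, mutualEnergy (μ i) (μ i) ≠ ⊤ then
    ∑ i, ∑ j, (A i j : EReal) * mutualEnergy (μ i) (μ j)
      + 2 * ((∫ z in F, ψ z ∂(μ 1) : ℝ) : EReal)
  else ⊤

/-- `m = inf J(μ₁, μ₂)` over unit measures `μ₁` on `E` and `μ₂` on `F`. -/
def infVectorEnergy (A : Matrix (Fin 2) (Fin 2) ℝ) (ψ : ℂ → ℝ) (E F : Set ℂ) : EReal :=
  ⨅ μ₁ ∈ unitMeasures E, ⨅ μ₂ ∈ unitMeasures F, vectorEnergy A ψ F ![μ₁, μ₂]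

/-- The interaction matrix `((1, -1), (-1, 4))`. -/
def interactionMatrix : Matrix (Fin 2) (Fin 2) ℝ := !![1, -1; -1, 4]

/-! ### The function `f` and its Stahl compact -/

/-- The branch at infinity of `f(z) = ∏ (z - a_j) ^ α_j` with `∑ α_j = 0` and `f(∞) = 1`. As
`∑ α_j = 0`, this is `∏ (1 - a_j / z) ^ α_j` with principal powers, for large `|z|`. -/
def branchAtInfty (a α : Fin 3 → ℂ) (z : ℂ) : ℂ := ∏ j, (1 - a j / z) ^ α j

/-- `K` is admissible for `f`: a compact subset of `ℂ` which does not separate the plane and such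
that `f` continues from a neighbourhood of infinity to a holomorphic function off `K`. -/
structure IsAdmissibleCompact (a α : Fin 3 → ℂ) (K : Set ℂ) : Prop where
  isCompact : IsCompact K
  isConnected_compl : IsConnected Kᶜ
  continuation : ∃ F : ℂ → ℂ, DifferentiableOn ℂ F Kᶜ ∧
    ∀ᶠ z in Bornology.cobounded ℂ, F z = branchAtInfty a α z

/-- `S` is a Stahl compact for `f`: an admissible compact of minimal capacity. -/
def IsStahlCompact (a α : Fin 3 → ℂ) (S : Set ℂ) : Prop :=
  IsAdmissibleCompact a α S ∧ ∀ K, IsAdmissibleCompact a α K → logCapacity S ≤ logCapacity K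

/-! ### Arcs and admissible pairs of compacts -/

/-- The path `γ` is a parametrization of the (Jordan) arc `A` from `x` to `y`. -/
def ParametrizesArc {x y : ℂ} (γ : Path x y) (A : Set ℂ) : Prop :=
  Function.Injective γ ∧ Set.range γ = A

/-- `A` is a Jordan arc joining `x` and `y`. -/
def IsArc (A : Set ℂ) (x y : ℂ) : Prop := ∃ γ : Path x y, ParametrizesArc γ A

/-- `A` is an analytic arc joining `x` and `y`: a Jordan arc with a parametrization that is regular
and real-analytic in the interior. -/
def IsAnalyticArc (A : Set ℂ) (x y : ℂ) : Prop :=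
  ∃ γ : Path x y, ParametrizesArc γ A ∧
    ∀ t ∈ Set.Ioo (0 : ℝ) 1, AnalyticAt ℝ γ.extend t ∧ deriv γ.extend t ≠ 0

/-- The arcs `A` and `B` from `x` to `y` are homotopic with fixed end points, through paths in the
Riemann sphere whose interior avoids the finite set of punctures `P`. -/
def HomotopicArcs (P : Set ℂ) (A B : Set ℂ) (x y : ℂ) : Prop :=
  ∃ γ δ : Path x y, ParametrizesArc γ A ∧ ParametrizesArc δ B ∧
    ∃ H : C(I × I, OnePoint ℂ),
      (∀ t, H (0, t) = (γ t : ℂ)) ∧ (∀ t, H (1, t) = (δ t : ℂ)) ∧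
      (∀ s, H (s, 0) = (x : OnePoint ℂ)) ∧ (∀ s, H (s, 1) = (y : OnePoint ℂ)) ∧
      ∀ s, ∀ t : I, t ≠ 0 → t ≠ 1 → ∀ p ∈ P, H (s, t) ≠ (p : OnePoint ℂ)

/-- `K` is the union of three arcs `L j` joining `a j` and `v` which meet only at `v`. -/
structure IsStar (a : Fin 3 → ℂ) (v : ℂ) (K : Set ℂ) (L : Fin 3 → Set ℂ) : Prop where
  eq_iUnion : K = ⋃ j, L j
  isArc : ∀ j, IsArc (L j) (a j) v
  inter : ∀ i j, i ≠ j → L i ∩ L j = {v}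

/-- The Stahl compact `S` of `f`, its arcs `S_j` and the Chebotarev point `v` at which they
meet. -/
structure IsStahlStar (a α : Fin 3 → ℂ) (v : ℂ) (S : Set ℂ) (SArc : Fin 3 → Set ℂ) : Prop where
  isStahl : IsStahlCompact a α S
  isStar : IsStar a v S SArc

/-- The family `𝒢_f`: an admissible compact `Γ` that is the union of three analytic arcs `Γ_j`,
where `Γ_j` joins `a_j` and `v` and is homotopic to the arc `S_j` of the Stahl compact, and the
`Γ_j` meet only at `v`. -/
structure IsInFamilyG (a α : Fin 3 → ℂ) (v : ℂ) (SArc : Fin 3 → Set ℂ)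
    (Γ : Set ℂ) (ΓArc : Fin 3 → Set ℂ) : Prop where
  admissible : IsAdmissibleCompact a α Γ
  isStar : IsStar a v Γ ΓArc
  analytic : ∀ j, IsAnalyticArc (ΓArc j) (a j) v
  homotopic : ∀ j, HomotopicArcs (Set.range a) (SArc j) (ΓArc j) (a j) v

/-- The compacts `F = Γ^⊥` dual to `Γ`: unions of six arcs issuing from a point `c ∉ S`, three of
them ending at `v` and the other three at `a_1, a_2, a_3`, without further common points, such
that the complement of `F` consists of three disjoint domains `D_j` with `S_j⁰ ⊆ D_j` and
`D_j ∩ Γ = Γ_j⁰`. In particular `F` meets `Γ` only at `a_1, a_2, a_3, v`. -/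
def IsDualCompact (a : Fin 3 → ℂ) (v : ℂ) (S : Set ℂ) (SArc : Fin 3 → Set ℂ)
    (ΓArc : Fin 3 → Set ℂ) (F : Set ℂ) : Prop :=
  ∃ (c : ℂ) (toV toA D : Fin 3 → Set ℂ),
    c ∉ S ∧
    (∀ j, IsArc (toV j) c v) ∧ (∀ j, IsArc (toA j) c (a j)) ∧
    (∀ i j, i ≠ j → toV i ∩ toV j = {c, v}) ∧
    (∀ i j, i ≠ j → toA i ∩ toA j = {c}) ∧
    (∀ i j, toV i ∩ toA j = {c}) ∧
    F = (⋃ j, toV j) ∪ (⋃ j, toA j) ∧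
    (∀ j, IsOpen (D j)) ∧ (∀ j, IsConnected (D j)) ∧
    (∀ i j, i ≠ j → Disjoint (D i) (D j)) ∧
    Fᶜ = ⋃ j, D j ∧
    (∀ j, SArc j \ {a j, v} ⊆ D j) ∧
    (∀ j, D j ∩ ⋃ i, ΓArc i = ΓArc j \ {a j, v})

end

/-! The quadratic part of `J` is `[μ₁ - μ₂, μ₁ - μ₂] + 3 [μ₂, μ₂]`. Existence and uniqueness rest on
the positivity of the logarithmic energy on differences of unit measures, obtained from the Frullani
integral `2 log (R / r) = ∫₀^∞ (exp (-t r² / 2) - exp (-t R² / 2)) dt / t`. Gaussians being Fourier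
transforms of Gaussians, twice the energy of `μ - ν` becomes an integral over `t` of weighted `L²`
norms of the difference of the characteristic functions (`energyDist`). This quantity makes sense
for all pairs of probability measures, is weakly lower semicontinuous by Fatou, and vanishes only if
the measures coincide. So `2 J + 6 log R` extends to a nonnegative lower semicontinuous function on
a compact space and attains its minimum (`exists_realVectorEnergy_minimizer`), and `J` is strictly
convex (`realVectorEnergy_minimizer_unique`).

For the supports, let `lam` be one component of the minimizer, `ν` the other, and consider the field
`u = -c * logPot lam + logPot ν + ψ`, with `c = 1`, `ψ = 0` for the first component and `c = 4`, `ψ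
= 3 g` for the second. The first variation gives `u = w` almost everywhere for `lam` (`ae_field_eq`)
and `∫ u dτ ≥ w` for every competing unit measure `τ` of finite energy. Off `lam.support` the field
is subharmonic, and its logarithmic growth at infinity cancels, so `u ≤ w` there by a principle of
domination (`exists_truncPot_le`). If `lam.support` is too small, some `τ` lives off it, so `u`
reaches `w` somewhere off the support; by the strong maximum principle the set where it does is
open, relatively closed, and free of mass of `ν` (`exists_isOpen_contact`).

For `lam₁` the complement of the support is connected, so `λ₂` would live on the finite set where
`Γ` meets its dual, which finite energy forbids. For `lam₂` the contact set would swallow one of the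
domains `D_j`, and `D_j` meets `Γ`, which is already known to be the support of `λ₁`.

Since `logPot` is a Bochner integral, it is not `-∞` but `0` where the logarithm fails to be
integrable. The continuous truncations `truncPot n` decrease to the true subharmonic function and
replace it wherever such points can occur. -/

open scoped NNReal

noncomputable section

/-! ### Submean functions and the maximum principle -/

/-- `h` is bounded at `z` by its averages over all small circles around `z`. -/
def IsSubmeanAt (h : ℂ → ℝ) (z : ℂ) : Prop :=
  ∃ r₀ > 0, ∀ r, 0 < r → r < r₀ → h z ≤ Real.circleAverage h z r

theorem IsSubmeanAt.add {f h : ℂ → ℝ} {z : ℂ} (hf : Continuous f) (hh : Continuous h)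
    (h₁ : IsSubmeanAt f z) (h₂ : IsSubmeanAt h z) : IsSubmeanAt (fun x => f x + h x) z := by
  obtain ⟨r₁, hr₁, H₁⟩ := h₁
  obtain ⟨r₂, hr₂, H₂⟩ := h₂
  refine ⟨min r₁ r₂, lt_min hr₁ hr₂, fun r h0 hr => ?_⟩
  have := Real.circleAverage_add (c := z) (R := r) hf.continuousOn.circleIntegrable'
    hh.continuousOn.circleIntegrable'
  simp only [Pi.add_def] at this
  rw [this]
  exact add_le_add (H₁ r h0 (hr.trans_le (min_le_left _ _)))
    (H₂ r h0 (hr.trans_le (min_le_right _ _)))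

theorem IsSubmeanAt.const_mul {f : ℂ → ℝ} {z : ℂ} {c : ℝ} (hc : 0 ≤ c) (h : IsSubmeanAt f z) :
    IsSubmeanAt (fun x => c * f x) z := by
  obtain ⟨r₁, hr₁, H₁⟩ := h
  refine ⟨r₁, hr₁, fun r h0 hr => ?_⟩
  have := Real.circleAverage_smul (a := c) (f := f) (c := z) (R := r)
  simp only [Pi.smul_def, smul_eq_mul] at this
  rw [this]
  exact mul_le_mul_of_nonneg_left (H₁ r h0 hr) hc

theorem circleAverage_lt_of_exists_lt {f : ℂ → ℝ} {z y : ℂ} {r m : ℝ}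
    (hf : ContinuousOn f (Metric.sphere z r)) (hle : ∀ x ∈ Metric.sphere z r, f x ≤ m)
    (hy : y ∈ Metric.sphere z r) (hlt : f y < m) :
    Real.circleAverage f z r < m := by
  have hr : 0 ≤ r := Metric.nonneg_of_mem_sphere hy
  have hmem : ∀ θ, circleMap z r θ ∈ Metric.sphere z r := fun θ => circleMap_mem_sphere z hr θ
  obtain ⟨θ, hθ, rfl⟩ : y ∈ circleMap z r '' Set.Ioc 0 (2 * Real.pi) := by
    rw [image_circleMap_Ioc, abs_of_nonneg hr]; exact hy
  have hcont : Continuous fun θ => f (circleMap z r θ) := hf.comp_continuous (continuous_circleMap z r) hmem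
  have key : ∫ θ in (0 : ℝ)..2 * Real.pi, f (circleMap z r θ)
      < ∫ θ in (0 : ℝ)..2 * Real.pi, m :=
    intervalIntegral.integral_lt_integral_of_continuousOn_of_le_of_exists_lt Real.two_pi_pos
      hcont.continuousOn continuousOn_const (fun θ _ => hle _ (hmem θ))
      ⟨θ, ⟨hθ.1.le, hθ.2⟩, hlt⟩
  rw [Real.circleAverage_def, smul_eq_mul, inv_mul_lt_iff₀ Real.two_pi_pos]
  simpa using key

theorem eq_on_sphere_of_le_circleAverage {f : ℂ → ℝ} (hf : Continuous f) {z : ℂ} {r m : ℝ}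
    (hle : ∀ x ∈ Metric.sphere z r, f x ≤ m) (h : m ≤ Real.circleAverage f z r) :
    ∀ x ∈ Metric.sphere z r, f x = m := by
  intro x hx
  by_contra hne
  exact absurd h (not_le.2
    (circleAverage_lt_of_exists_lt hf.continuousOn hle hx (lt_of_le_of_ne (hle x hx) hne)))

/-- The maximum principle on the complement of a compact set. -/
theorem le_of_isSubmeanAt_compl {H : ℂ → ℝ} (hH : Continuous H) {K : Set ℂ} (hK : IsCompact K)
    (hne : K.Nonempty) {M : ℝ} (hM : ∀ z ∈ K, H z ≤ M) (hsub : ∀ z ∉ K, IsSubmeanAt H z)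
    (hinf : Tendsto H (Bornology.cobounded ℂ) atBot) (z : ℂ) : H z ≤ M := by
  by_contra! hz
  rw [Metric.cobounded_eq_cocompact] at hinf
  obtain ⟨x₀, hx₀⟩ := hH.exists_forall_ge hinf
  have hgt : M < H x₀ := hz.trans_le (hx₀ z)
  have hcl : IsClosed {x | H x = H x₀} := isClosed_eq hH continuous_const
  have hcpt : IsCompact {x | H x = H x₀} := by
    obtain ⟨t, ht, hsub⟩ := mem_cocompact.1 (hinf (Iio_mem_atBot (H x₀)))
    refine ht.of_isClosed_subset hcl fun x hx => ?_
    by_contra hxt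
    have := hsub hxt
    simp only [Set.mem_preimage, Set.mem_Iio] at this
    exact this.ne hx
  -- Choose a maximum point nearest to `K`. Small circles around it consist of maximum points as
  -- well, and the point of such a circle in the direction of `K` is strictly nearer: a
  -- contradiction.
  obtain ⟨x, hx, hmin⟩ := hcpt.exists_isMinOn ⟨x₀, rfl⟩
    (Metric.continuous_infDist_pt K).continuousOn
  have hxK : x ∉ K := fun h => by
    have := hM x h
    rw [hx] at this
    exact this.not_gt hgt
  obtain ⟨k, hk, hdist⟩ := hK.exists_infDist_eq_dist hne x
  have hd : 0 < dist x k := dist_pos.2 fun h => hxK (h ▸ hk)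
  obtain ⟨r₀, hr₀, hr⟩ := hsub x hxK
  obtain ⟨r, h0, hlt⟩ := exists_between (lt_min hr₀ hd)
  have hle := hr r h0 (hlt.trans_le (min_le_left _ _))
  have hrd : r < dist x k := hlt.trans_le (min_le_right _ _)
  have heq := eq_on_sphere_of_le_circleAverage hH (fun y _ => hx₀ y) (hx ▸ hle)
  set y : ℂ := AffineMap.lineMap x k (r / dist x k) with hy
  have hyx : y ∈ Metric.sphere x r := by
    rw [Metric.mem_sphere, hy, dist_lineMap_left, Real.norm_of_nonneg (by positivity)]
    field_simp
  have hyk : dist y k = dist x k - r := by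
    rw [hy, dist_lineMap_right, Real.norm_of_nonneg]
    · field_simp
    · rw [sub_nonneg, div_le_one hd]; exact hrd.le
  have h1 : Metric.infDist x K ≤ Metric.infDist y K := hmin (heq y hyx)
  have h2 : Metric.infDist y K ≤ dist y k := Metric.infDist_le_dist_of_mem hk
  rw [hdist] at h1
  linarith

theorem isSubmeanAt_of_harmonicOnNhd {g : ℂ → ℝ} {U : Set ℂ} (hU : IsOpen U)
    (hg : InnerProductSpace.HarmonicOnNhd g U) {z : ℂ} (hz : z ∈ U) :
    IsSubmeanAt g z ∧ IsSubmeanAt (fun x => -g x) z := by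
  obtain ⟨r₀, hr₀, hsub⟩ := Metric.isOpen_iff.1 hU z hz
  have key : ∀ r, 0 < r → r < r₀ → Real.circleAverage g z r = g z := fun r h0 hr =>
    InnerProductSpace.HarmonicOnNhd.circleAverage_eq fun x hx => hg x (hsub (by
      rw [abs_of_pos h0] at hx
      exact Metric.closedBall_subset_ball hr hx))
  refine ⟨⟨r₀, hr₀, fun r h0 hr => (key r h0 hr).ge⟩, ⟨r₀, hr₀, fun r h0 hr => ?_⟩⟩
  have : Real.circleAverage (fun x => -g x) z r = - Real.circleAverage g z r := by
    have := Real.circleAverage_smul (a := (-1 : ℝ)) (f := g) (c := z) (R := r)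
    have h2 : (-1 : ℝ) • g = fun x => -g x := by ext; simp
    rw [h2] at this
    simpa using this
  rw [this, key r h0 hr]

/-- The maximum principle applies to `-g`, which the logarithmic pole sends to `-∞` at infinity. -/
theorem IsGreenAtInfty.nonneg {K : Set ℂ} (hK : IsCompact K) (hne : K.Nonempty) {g : ℂ → ℝ}
    (hg : IsGreenAtInfty K g) (z : ℂ) : 0 ≤ g z := by
  have := le_of_isSubmeanAt_compl (H := fun x => -g x) hg.continuous.neg hK hne (M := 0)
    (fun z hz => by simp [hg.zero_on z hz])
    (fun z hz => (isSubmeanAt_of_harmonicOnNhd hK.isClosed.isOpen_compl hg.harmonic hz).2) ?_ z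
  · linarith
  · obtain ⟨C, hC⟩ := hg.log_pole
    have h1 : Tendsto (fun z : ℂ => C - Real.log ‖z‖) (Bornology.cobounded ℂ) atBot :=
      tendsto_const_nhds.add_atBot (tendsto_neg_atTop_atBot.comp
        (Real.tendsto_log_atTop.comp tendsto_norm_cobounded_atTop))
    refine tendsto_atBot_mono' _ ?_ h1
    filter_upwards [hC] with z hz
    have := abs_le.1 hz
    linarith [this.1]

/-- Extension by zero keeps `g` subharmonic across `K`: the value there is the minimum of `g`, and
elsewhere `g` is harmonic. -/
theorem IsGreenAtInfty.isSubmeanAt {K : Set ℂ} (hK : IsCompact K) (hne : K.Nonempty) {g : ℂ → ℝ}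
    (hg : IsGreenAtInfty K g) (z : ℂ) : IsSubmeanAt g z := by
  by_cases hz : z ∈ K
  · refine ⟨1, one_pos, fun r _ _ => ?_⟩
    rw [hg.zero_on z hz]
    exact Real.circleAverage_nonneg_of_nonneg fun x _ => hg.nonneg hK hne x
  · exact (isSubmeanAt_of_harmonicOnNhd hK.isClosed.isOpen_compl hg.harmonic hz).1

/-! ### Truncated logarithmic potentials -/

/-- The logarithm of the distance, truncated from below at `-n`. -/
def truncLog (n : ℕ) (z ζ : ℂ) : ℝ := Real.log (max ‖z - ζ‖ (Real.exp (-n)))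

/-- The integral of the truncated logarithm of the distance. -/
def truncPot (n : ℕ) (μ : Measure ℂ) (z : ℂ) : ℝ := ∫ ζ, truncLog n z ζ ∂μ

/-- The integral of the logarithm of the distance (minus the logarithmic potential). -/
def logPot (μ : Measure ℂ) (z : ℂ) : ℝ := ∫ ζ, Real.log ‖z - ζ‖ ∂μ

theorem max_exp_pos (n : ℕ) (x : ℝ) : 0 < max x (Real.exp (-n)) :=
  lt_max_of_lt_right (Real.exp_pos _)

theorem continuous_truncLog (n : ℕ) : Continuous fun p : ℂ × ℂ => truncLog n p.1 p.2 := by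
  unfold truncLog
  exact Continuous.log (by fun_prop) fun p => (max_exp_pos n _).ne'

theorem neg_le_truncLog (n : ℕ) (z ζ : ℂ) : -(n : ℝ) ≤ truncLog n z ζ := by
  rw [truncLog, Real.le_log_iff_exp_le (max_exp_pos n _)]
  exact le_max_right _ _

theorem truncLog_anti {n m : ℕ} (h : n ≤ m) (z ζ : ℂ) : truncLog m z ζ ≤ truncLog n z ζ := by
  refine Real.log_le_log (max_exp_pos m _) (max_le_max_left _ ?_)
  exact Real.exp_le_exp.2 (neg_le_neg (by exact_mod_cast h))

theorem log_le_truncLog (n : ℕ) {z ζ : ℂ} (h : z ≠ ζ) : Real.log ‖z - ζ‖ ≤ truncLog n z ζ :=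
  Real.log_le_log (norm_pos_iff.2 (sub_ne_zero.2 h)) (le_max_left _ _)

theorem truncLog_eq (n : ℕ) {z ζ : ℂ} (h : z ≠ ζ) :
    truncLog n z ζ = max (Real.log ‖z - ζ‖) (-n) := by
  have h0 : 0 < ‖z - ζ‖ := norm_pos_iff.2 (sub_ne_zero.2 h)
  rw [truncLog]
  rcases le_total ‖z - ζ‖ (Real.exp (-n)) with h1 | h1
  · rw [max_eq_right h1, Real.log_exp, max_eq_right]
    rwa [Real.log_le_iff_le_exp h0]
  · rw [max_eq_left h1, max_eq_left]
    rwa [Real.le_log_iff_exp_le h0]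

theorem abs_truncLog_le (n : ℕ) {z ζ : ℂ} (h : z ≠ ζ) :
    |truncLog n z ζ| ≤ |Real.log ‖z - ζ‖| := by
  rw [truncLog_eq n h]
  rcases le_total (Real.log ‖z - ζ‖) (-n) with h1 | h1
  · rw [max_eq_right h1, abs_of_nonpos (by simp), abs_of_nonpos (h1.trans (by simp))]
    linarith
  · rw [max_eq_left h1]

theorem tendsto_truncLog {z ζ : ℂ} (h : z ≠ ζ) :
    Tendsto (fun n => truncLog n z ζ) atTop (𝓝 (Real.log ‖z - ζ‖)) := by
  refine tendsto_const_nhds.congr' ?_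
  obtain ⟨N, hN⟩ := exists_nat_ge (-Real.log ‖z - ζ‖)
  filter_upwards [eventually_ge_atTop N] with n hn
  rw [truncLog_eq n h, max_eq_left]
  have : (N : ℝ) ≤ n := by exact_mod_cast hn
  linarith

theorem continuous_truncLog_left (n : ℕ) (ζ : ℂ) : Continuous fun z => truncLog n z ζ :=
  (continuous_truncLog n).comp (by fun_prop : Continuous fun z : ℂ => (z, ζ))

theorem continuous_truncLog_right (n : ℕ) (z : ℂ) : Continuous fun ζ => truncLog n z ζ :=
  (continuous_truncLog n).comp (by fun_prop : Continuous fun ζ : ℂ => (z, ζ))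

theorem circleAverage_log_norm_sub {z ζ : ℂ} {r : ℝ} (hr : 0 < r) :
    Real.circleAverage (fun x => Real.log ‖x - ζ‖) z r = Real.log (max r ‖z - ζ‖) := by
  rw [circleAverage_log_norm_sub_const_eq_log_radius_add_posLog hr.ne', Real.posLog_eq_log_max_one
    (by positivity), ← Real.log_mul hr.ne' (by positivity), mul_max_of_nonneg _ _ hr.le]
  field_simp

theorem circleIntegrable_log_norm_sub (z ζ : ℂ) (r : ℝ) :
    CircleIntegrable (fun x => Real.log ‖x - ζ‖) z r :=
  MeromorphicOn.circleIntegrable_log_norm (fun _ _ => by fun_prop)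

theorem log_max_le_circleAverage_truncLog (n : ℕ) {z ζ : ℂ} {r : ℝ} (hr : 0 < r) :
    Real.log (max r ‖z - ζ‖) ≤ Real.circleAverage (fun x => truncLog n x ζ) z r := by
  have hfin : {x : ℂ | x ≠ ζ} ∈ codiscreteWithin (Metric.sphere z |r|) := by
    apply codiscreteWithin_iff_locallyFiniteComplementWithin.2
    intro y hy
    refine ⟨Set.univ, univ_mem, ?_⟩
    refine Set.Finite.subset (Set.finite_singleton ζ) fun x hx => ?_
    simpa using hx.2.2
  -- Because `Real.log 0 = 0`, the bound of the logarithm by its truncation can fail at `x = ζ`.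
  -- Taking the minimum repairs this single point without changing the circle average.
  have h1 : Real.circleAverage (fun x => min (Real.log ‖x - ζ‖) (truncLog n x ζ)) z r
      = Real.log (max r ‖z - ζ‖) := by
    rw [← circleAverage_log_norm_sub hr]
    refine Real.circleAverage_congr_codiscreteWithin ?_ hr.ne'
    filter_upwards [hfin] with x hx
    exact min_eq_left (log_le_truncLog n hx)
  rw [← h1]
  have hc := (continuous_truncLog_left n ζ).continuousOn (s := Metric.sphere z |r|)
    |>.circleIntegrable'
  refine Real.circleAverage_mono ?_ hc fun x _ => min_le_right _ _
  refine CircleIntegrable.congr_codiscreteWithin ?_ (circleIntegrable_log_norm_sub z ζ r)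
  filter_upwards [hfin] with x hx
  exact (min_eq_left (log_le_truncLog n hx)).symm

/-- The truncation is the maximum of a subharmonic function and a constant, and each of the two
branches is below the average. -/
theorem truncLog_le_circleAverage (n : ℕ) (z ζ : ℂ) {r : ℝ} (hr : 0 < r) :
    truncLog n z ζ ≤ Real.circleAverage (fun x => truncLog n x ζ) z r := by
  have hc := (continuous_truncLog_left n ζ).continuousOn (s := Metric.sphere z |r|)
    |>.circleIntegrable'
  rw [truncLog]
  rcases max_cases ‖z - ζ‖ (Real.exp (-n)) with ⟨h, _⟩ | ⟨h, _⟩ <;> rw [h]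
  · rcases eq_or_ne z ζ with rfl | hne
    · have : Real.exp (-n) ≤ 0 := by simpa using h
      exact absurd this (not_le.2 (Real.exp_pos _))
    · refine le_trans ?_ (log_max_le_circleAverage_truncLog n hr)
      exact Real.log_le_log (norm_pos_iff.2 (sub_ne_zero.2 hne)) (le_max_right _ _)
  · rw [Real.log_exp]
    have := Real.circleAverage_mono (c := z) (R := r) (circleIntegrable_const (-(n : ℝ)) z r) hc
      fun x _ => neg_le_truncLog n x ζ
    rwa [Real.circleAverage_const] at this

/-- The truncation is inactive at the centre and on the whole circle, where the kernel is harmonic.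
-/
theorem circleAverage_truncLog_of_lt (n : ℕ) {z ζ : ℂ} {r : ℝ} (hr : 0 < r)
    (h : r + Real.exp (-n) ≤ ‖z - ζ‖) :
    Real.circleAverage (fun x => truncLog n x ζ) z r = truncLog n z ζ := by
  have hpos := Real.exp_pos (-(n : ℝ))
  have h1 : Set.EqOn (fun x => truncLog n x ζ) (fun x => Real.log ‖x - ζ‖)
      (Metric.sphere z |r|) := by
    intro x hx
    rw [abs_of_pos hr, Metric.mem_sphere, dist_eq_norm] at hx
    have : ‖z - ζ‖ ≤ ‖z - x‖ + ‖x - ζ‖ := norm_sub_le_norm_sub_add_norm_sub _ _ _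
    rw [norm_sub_rev z x] at this
    simp only [truncLog]
    rw [max_eq_left]
    linarith
  rw [Real.circleAverage_congr_sphere h1, circleAverage_log_norm_sub hr, truncLog,
    max_eq_right (by linarith), max_eq_left (by linarith)]

/-! ### Potentials of finite measures carried by a compact set -/

section
variable {μ : Measure ℂ} [IsFiniteMeasure μ] {K : Set ℂ}

theorem restrict_eq_self_of_compl {μ : Measure ℂ} {K : Set ℂ} (h : μ Kᶜ = 0) : μ.restrict K = μ :=
  Measure.restrict_eq_self_of_ae_mem (by rwa [ae_iff])

theorem integrable_of_continuous_of_isCompact (hK : IsCompact K) (h : μ Kᶜ = 0) {E : Type*}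
    [NormedAddCommGroup E] [SecondCountableTopology E] {f : ℂ → E} (hf : Continuous f) :
    Integrable f μ := by
  have := hf.continuousOn.integrableOn_compact (μ := μ) hK
  rwa [IntegrableOn, restrict_eq_self_of_compl h] at this

theorem continuous_truncPot (hK : IsCompact K) (h : μ Kᶜ = 0) (n : ℕ) :
    Continuous (truncPot n μ) := by
  have := continuous_parametric_integral_of_continuous (μ := μ) (f := truncLog n)
    (continuous_truncLog n) hK
  rwa [restrict_eq_self_of_compl h] at this

theorem integrable_truncLog (hK : IsCompact K) (h : μ Kᶜ = 0) (n : ℕ) (z : ℂ) :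
    Integrable (truncLog n z) μ :=
  integrable_of_continuous_of_isCompact hK h (continuous_truncLog_right n z)

theorem truncPot_anti (hK : IsCompact K) (h : μ Kᶜ = 0) {n m : ℕ} (hnm : n ≤ m) (z : ℂ) :
    truncPot m μ z ≤ truncPot n μ z :=
  integral_mono (integrable_truncLog hK h m z) (integrable_truncLog hK h n z)
    fun ζ => truncLog_anti hnm z ζ

theorem circleAverage_truncPot (hK : IsCompact K) (h : μ Kᶜ = 0) (n : ℕ) (z : ℂ) (r : ℝ) :
    Real.circleAverage (truncPot n μ) z r
      = ∫ ζ, Real.circleAverage (fun x => truncLog n x ζ) z r ∂μ := by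
  simp only [Real.circleAverage_def, truncPot, intervalIntegral.integral_of_le Real.two_pi_pos.le]
  rw [integral_smul, integral_integral_swap]
  have hc : Continuous (Function.uncurry fun (θ : ℝ) (ζ : ℂ) => truncLog n (circleMap z r θ) ζ) :=
    (continuous_truncLog n).comp (((continuous_circleMap z r).comp continuous_fst).prodMk
      continuous_snd)
  have h1 := hc.continuousOn.integrableOn_compact
    (μ := (volume : Measure ℝ).prod μ) ((isCompact_Icc (a := (0 : ℝ)) (b := 2 * Real.pi)).prod hK)
  rw [IntegrableOn, ← Measure.prod_restrict, restrict_eq_self_of_compl h,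
    ← Measure.restrict_congr_set Ioc_ae_eq_Icc] at h1
  exact h1

theorem integrable_circleAverage_truncLog (hK : IsCompact K) (h : μ Kᶜ = 0) (n : ℕ) (z : ℂ)
    (r : ℝ) : Integrable (fun ζ => Real.circleAverage (fun x => truncLog n x ζ) z r) μ := by
  refine integrable_of_continuous_of_isCompact hK h ?_
  simp only [Real.circleAverage_def]
  have hc : Continuous (Function.uncurry fun (ζ : ℂ) (θ : ℝ) => truncLog n (circleMap z r θ) ζ) :=
    (continuous_truncLog n).comp (((continuous_circleMap z r).comp continuous_snd).prodMk
      continuous_fst)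
  exact (intervalIntegral.continuous_parametric_intervalIntegral_of_continuous'
    (μ := volume) hc 0 (2 * Real.pi)).const_smul (2 * Real.pi)⁻¹

theorem truncPot_le_circleAverage (hK : IsCompact K) (h : μ Kᶜ = 0) (n : ℕ) (z : ℂ) {r : ℝ}
    (hr : 0 < r) : truncPot n μ z ≤ Real.circleAverage (truncPot n μ) z r := by
  rw [circleAverage_truncPot hK h]
  exact integral_mono (integrable_truncLog hK h n z) (integrable_circleAverage_truncLog hK h n z r)
    fun ζ => truncLog_le_circleAverage n z ζ hr

/-- Mass inside a disc makes the mean value inequality strict, uniformly in the truncation. -/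
theorem truncPot_add_le_circleAverage (hK : IsCompact K) (h : μ Kᶜ = 0) {n : ℕ} (z : ℂ) {r : ℝ}
    (hr : 0 < r) (hn : Real.exp (-n) ≤ r / 2) :
    truncPot n μ z + Real.log 2 * μ.real (Metric.ball z (r / 2))
      ≤ Real.circleAverage (truncPot n μ) z r := by
  rw [circleAverage_truncPot hK h]
  have hi : Integrable ((Metric.ball z (r / 2)).indicator fun _ => Real.log 2) μ :=
    (integrable_const _).indicator measurableSet_ball
  have h1 : Real.log 2 * μ.real (Metric.ball z (r / 2))
      = ∫ ζ, (Metric.ball z (r / 2)).indicator (fun _ => Real.log 2) ζ ∂μ := by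
    rw [integral_indicator measurableSet_ball, setIntegral_const, smul_eq_mul, mul_comm]
  rw [h1, truncPot, ← integral_add (integrable_truncLog hK h n z) hi]
  refine integral_mono ((integrable_truncLog hK h n z).add hi)
    (integrable_circleAverage_truncLog hK h n z r) fun ζ => ?_
  by_cases hζ : ζ ∈ Metric.ball z (r / 2)
  · simp only [Set.indicator_of_mem hζ]
    rw [Metric.mem_ball, dist_comm, dist_eq_norm] at hζ
    refine le_trans ?_ (log_max_le_circleAverage_truncLog n hr)
    have h2 : truncLog n z ζ ≤ Real.log (r / 2) :=
      Real.log_le_log (max_exp_pos n _) (max_le hζ.le hn)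
    have h3 : Real.log r ≤ Real.log (max r ‖z - ζ‖) := Real.log_le_log hr (le_max_left _ _)
    rw [Real.log_div hr.ne' two_ne_zero] at h2
    linarith
  · simp only [Set.indicator_of_notMem hζ, add_zero]
    exact truncLog_le_circleAverage n z ζ hr

theorem exists_exp_neg_lt {ε : ℝ} (hε : 0 < ε) : ∃ N : ℕ, ∀ n ≥ N, Real.exp (-(n : ℝ)) ≤ ε := by
  have := (Real.tendsto_exp_neg_atTop_nhds_zero.comp tendsto_natCast_atTop_atTop).eventually
    (Iic_mem_nhds hε)
  obtain ⟨N, hN⟩ := eventually_atTop.1 this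
  exact ⟨N, fun n hn => hN n hn⟩

/-- Away from the carrier, the truncated potential is the potential. -/
theorem truncPot_eq_logPot {μ : Measure ℂ} (h : μ Kᶜ = 0) {n : ℕ} {z : ℂ}
    (hn : ∀ ζ ∈ K, Real.exp (-n) ≤ ‖z - ζ‖) : truncPot n μ z = logPot μ z := by
  refine integral_congr_ae ?_
  have : ∀ᵐ ζ ∂μ, ζ ∈ K := by rwa [ae_iff]
  filter_upwards [this] with ζ hζ
  rw [truncLog, max_eq_left (hn ζ hζ)]

theorem continuousAt_logPot (hK : IsCompact K) (h : μ Kᶜ = 0) {z : ℂ} (hz : z ∉ K) :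
    ContinuousAt (logPot μ) z := by
  obtain ⟨ε, hε, hsub⟩ := Metric.isOpen_iff.1 hK.isClosed.isOpen_compl z hz
  obtain ⟨N, hN⟩ := exists_exp_neg_lt (half_pos hε)
  refine ((continuous_truncPot hK h N).continuousAt (x := z)).congr ?_
  filter_upwards [Metric.ball_mem_nhds z (half_pos hε)] with y hy
  refine truncPot_eq_logPot h fun ζ hζ => (hN N le_rfl).trans ?_
  have h1 : ε ≤ dist ζ z := by
    by_contra! hlt
    exact hsub (Metric.mem_ball.2 hlt) hζ
  rw [Metric.mem_ball] at hy
  have := dist_triangle ζ y z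
  rw [← dist_eq_norm, dist_comm]
  linarith

/-- The disc has positive distance from `K`, so one truncation level serves on all of it; this
reduces the claim to the mean value identity of the kernel. -/
theorem circleAverage_logPot (hK : IsCompact K) (h : μ Kᶜ = 0) {z : ℂ} {r : ℝ} (hr : 0 < r)
    (hd : Disjoint (Metric.closedBall z r) K) :
    Real.circleAverage (logPot μ) z r = logPot μ z := by
  obtain ⟨δ, hδ, hdis⟩ := hd.exists_thickenings (isCompact_closedBall z r) hK.isClosed
  obtain ⟨N, hN⟩ := exists_exp_neg_lt hδ
  have key : ∀ ζ ∈ K, ∀ x ∈ Metric.closedBall z r, Real.exp (-(N : ℝ)) ≤ ‖x - ζ‖ := by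
    intro ζ hζ x hx
    refine (hN N le_rfl).trans ?_
    by_contra! hlt
    exact Set.disjoint_left.1 hdis (Metric.self_subset_thickening hδ _ hx)
      (Metric.mem_thickening_iff.2 ⟨ζ, hζ, by rwa [dist_eq_norm]⟩)
  have key2 : ∀ ζ ∈ K, r + Real.exp (-(N : ℝ)) ≤ ‖z - ζ‖ := by
    intro ζ hζ
    have hz : r < ‖z - ζ‖ := by
      by_contra! hle
      exact Set.disjoint_left.1 hd (Metric.mem_closedBall'.2 (by rwa [dist_eq_norm])) hζ
    have hd0 : 0 < dist z ζ := by rw [dist_eq_norm]; linarith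
    -- The point of the closed disc nearest to `ζ` is tested; its distance to `ζ` is `‖z - ζ‖ - r`.
    have h1 := key ζ hζ (AffineMap.lineMap z ζ (r / dist z ζ)) (by
      rw [Metric.mem_closedBall, dist_lineMap_left, Real.norm_of_nonneg (by positivity)]
      field_simp
      rfl)
    rw [← dist_eq_norm, dist_lineMap_right, Real.norm_of_nonneg, sub_mul, one_mul,
      div_mul_cancel₀ _ hd0.ne', dist_eq_norm] at h1
    · linarith
    · rw [sub_nonneg, div_le_one hd0, dist_eq_norm]; exact hz.le
  have h1 : Set.EqOn (logPot μ) (truncPot N μ) (Metric.sphere z |r|) := by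
    intro x hx
    rw [abs_of_pos hr] at hx
    exact (truncPot_eq_logPot h fun ζ hζ => key ζ hζ x (Metric.sphere_subset_closedBall hx)).symm
  rw [Real.circleAverage_congr_sphere h1, circleAverage_truncPot hK h,
    ← truncPot_eq_logPot h fun ζ hζ => key ζ hζ z (Metric.mem_closedBall_self hr.le)]
  refine integral_congr_ae ?_
  have : ∀ᵐ ζ ∂μ, ζ ∈ K := by rwa [ae_iff]
  filter_upwards [this] with ζ hζ
  exact circleAverage_truncLog_of_lt N hr (key2 ζ hζ)

/-- If the logarithm is integrable, the truncated potentials converge to the potential. -/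
theorem tendsto_truncPot {μ : Measure ℂ} {z : ℂ} (hi : Integrable (fun ζ => Real.log ‖z - ζ‖) μ)
    (hz : μ {z} = 0) : Tendsto (fun n => truncPot n μ z) atTop (𝓝 (logPot μ z)) := by
  have hne : ∀ᵐ ζ ∂μ, z ≠ ζ := by
    rw [ae_iff]
    refine measure_mono_null (fun ζ hζ => ?_) hz
    simpa [eq_comm] using hζ
  refine tendsto_integral_of_dominated_convergence (fun ζ => |Real.log ‖z - ζ‖|)
    (fun n => (continuous_truncLog_right n z).aestronglyMeasurable) hi.abs (fun n => ?_) ?_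
  · filter_upwards [hne] with ζ hζ using abs_truncLog_le n hζ
  · filter_upwards [hne] with ζ hζ using tendsto_truncLog hζ

end

/-! ### Finite energy and the Gaussian representation of the energy -/

/-- The mutual energy of `μ` and `ν` is finite. -/
structure FiniteEnergy (μ ν : Measure ℂ) : Prop where
  diag : ∀ᵐ p ∂(μ.prod ν), p.1 ≠ p.2
  integrable : Integrable (fun p : ℂ × ℂ => Real.log ‖p.1 - p.2‖) (μ.prod ν)

/-- The mutual energy of two measures as a real number. -/
def realEnergy (μ ν : Measure ℂ) : ℝ := -∫ p, Real.log ‖p.1 - p.2‖ ∂(μ.prod ν)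

/-- The centered Gaussian measure on the plane with unit covariance. -/
def gaussC : Measure ℂ :=
  volume.withDensity fun η => ENNReal.ofReal ((2 * Real.pi)⁻¹ * Real.exp (-(1 / 2) * ‖η‖ ^ 2))

theorem gaussC_integral {E : Type*} [NormedAddCommGroup E] [NormedSpace ℝ E] (f : ℂ → E) :
    ∫ η, f η ∂gaussC = ∫ η, ((2 * Real.pi)⁻¹ * Real.exp (-(1 / 2) * ‖η‖ ^ 2)) • f η := by
  rw [gaussC, integral_withDensity_eq_integral_toReal_smul (by fun_prop)
    (Eventually.of_forall fun _ => ENNReal.ofReal_lt_top)]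
  refine integral_congr_ae (Eventually.of_forall fun η => ?_)
  simp only
  rw [ENNReal.toReal_ofReal (by positivity)]

theorem charFun_gaussC (x : ℂ) : charFun gaussC x = (Real.exp (-(‖x‖ ^ 2) / 2) : ℝ) := by
  rw [charFun_apply, gaussC_integral]
  have h := GaussianFourier.integral_cexp_neg_mul_sq_norm_add (V := ℂ) (b := 1 / 2) (by norm_num)
    Complex.I x
  have h2 : ∀ η : ℂ, ((2 * Real.pi)⁻¹ * Real.exp (-(1 / 2) * ‖η‖ ^ 2)) •
      Complex.exp (inner ℝ η x * Complex.I)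
      = (2 * Real.pi : ℂ)⁻¹ * Complex.exp (-(1 / 2) * ‖η‖ ^ 2 + Complex.I * inner ℝ x η) := by
    intro η
    rw [Complex.real_smul, Complex.exp_add, real_inner_comm]
    push_cast
    ring_nf
  simp_rw [h2]
  rw [integral_const_mul, h, Complex.finrank_real_complex]
  -- The plane has real dimension two, so the Gaussian integral is `2π`, which the normalisation of
  -- `gaussC` cancels.
  have h3 : ((Real.pi : ℂ) / (1 / 2)) ^ (((2 : ℕ) : ℂ) / 2) = 2 * Real.pi := by
    norm_num
    ring
  rw [h3, ← mul_assoc, inv_mul_cancel₀ (by simp [Real.pi_ne_zero]), one_mul, Complex.I_sq]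
  push_cast
  congr 1
  ring

instance : IsFiniteMeasure gaussC := by
  have hi := GaussianFourier.integrable_cexp_neg_mul_sq_norm_add (V := ℂ) (b := 1 / 2)
    (by norm_num) 0 0
  have h2 : Integrable fun η : ℂ => (2 * Real.pi)⁻¹ * Real.exp (-(1 / 2) * ‖η‖ ^ 2) := by
    refine Integrable.const_mul ?_ _
    refine hi.norm.congr (Eventually.of_forall fun η => ?_)
    show ‖Complex.exp _‖ = _
    rw [Complex.norm_exp]
    congr 1
    simp [← Complex.ofReal_pow]
  exact isFiniteMeasure_withDensity_ofReal h2.2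

/-- Because of it, a continuous function that vanishes almost everywhere for the Gaussian vanishes
identically. -/
theorem volume_ac_gaussC : (volume : Measure ℂ) ≪ gaussC := by
  refine withDensity_absolutelyContinuous' (by fun_prop) (Eventually.of_forall fun η => ?_)
  have : 0 < (2 * Real.pi)⁻¹ * Real.exp (-(1 / 2) * ‖η‖ ^ 2) := by positivity
  simpa [ENNReal.ofReal_eq_zero] using this

/-- The mutual energy of two measures for a Gaussian kernel. -/
def gaussEnergy (t : ℝ) (μ ν : Measure ℂ) : ℝ :=
  ∫ p, Real.exp (-(t * ‖p.1 - p.2‖ ^ 2) / 2) ∂(μ.prod ν)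

/-- The squared distance of two measures for a Gaussian kernel. -/
def gaussDist (t : ℝ) (μ ν : Measure ℂ) : ℝ :=
  ∫ η, ‖charFun μ (√t • η) - charFun ν (√t • η)‖ ^ 2 ∂gaussC

/-- The squared energy distance of two measures. -/
def energyDist (μ ν : Measure ℂ) : ℝ≥0∞ :=
  ∫⁻ t in Set.Ioi (0 : ℝ), ENNReal.ofReal (gaussDist t μ ν / t)

section
variable {μ ν : Measure ℂ} [IsProbabilityMeasure μ] [IsProbabilityMeasure ν]

/-- The Gaussian kernel at `z - ζ` is the characteristic function of `gaussC` at `√t • (z - ζ)`;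
Fubini then separates the two measures. -/
theorem gaussEnergy_eq {t : ℝ} (ht : 0 ≤ t) : (gaussEnergy t μ ν : ℂ)
    = ∫ η, charFun μ (√t • η) * (starRingEnd ℂ) (charFun ν (√t • η)) ∂gaussC := by
  have h1 : ∀ η : ℂ, charFun μ (√t • η) * (starRingEnd ℂ) (charFun ν (√t • η))
      = ∫ p, Complex.exp (inner ℝ η (√t • (p.1 - p.2)) * Complex.I) ∂(μ.prod ν) := by
    intro η
    rw [← charFun_neg, charFun_apply, charFun_apply, ← integral_prod_mul]
    refine integral_congr_ae (Eventually.of_forall fun p => ?_)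
    simp only
    rw [← Complex.exp_add, ← add_mul, ← Complex.ofReal_add]
    congr 3
    rw [inner_neg_right, real_inner_smul_right, real_inner_smul_right, real_inner_smul_right,
      inner_sub_right, real_inner_comm, real_inner_comm p.2]
    ring
  simp_rw [h1]
  rw [integral_integral_swap]
  · rw [gaussEnergy, ← integral_complex_ofReal]
    refine integral_congr_ae (Eventually.of_forall fun p => ?_)
    simp only
    rw [← charFun_apply, charFun_gaussC, norm_smul, mul_pow, Real.norm_of_nonneg (Real.sqrt_nonneg _),
      Real.sq_sqrt ht]
  · refine Integrable.mono' (integrable_const (1 : ℝ)) ?_ (Eventually.of_forall fun p => ?_)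
    · exact Continuous.aestronglyMeasurable (by unfold Function.uncurry; fun_prop)
    · exact (Complex.norm_exp_ofReal_mul_I _).le

theorem integrable_charFun_mul (t : ℝ) : Integrable
    (fun η => charFun μ (√t • η) * (starRingEnd ℂ) (charFun ν (√t • η))) gaussC := by
  refine Integrable.mono' (integrable_const (1 : ℝ)) ?_ (Eventually.of_forall fun η => ?_)
  · refine Measurable.aestronglyMeasurable ?_
    have h1 : Measurable fun η : ℂ => charFun μ (√t • η) := measurable_charFun.comp (by fun_prop)
    have h2 : Measurable fun η : ℂ => charFun ν (√t • η) := measurable_charFun.comp (by fun_prop)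
    exact h1.mul (Complex.continuous_conj.measurable.comp h2)
  · rw [norm_mul, RCLike.norm_conj]
    exact mul_le_one₀ (norm_charFun_le_one _) (norm_nonneg _) (norm_charFun_le_one _)

theorem gaussEnergy_comm {t : ℝ} (ht : 0 ≤ t) : gaussEnergy t μ ν = gaussEnergy t ν μ := by
  have h : (gaussEnergy t μ ν : ℂ) = gaussEnergy t ν μ := by
    rw [← Complex.conj_ofReal, gaussEnergy_eq ht, gaussEnergy_eq ht, ← integral_conj]
    refine integral_congr_ae (Eventually.of_forall fun η => ?_)
    simp [mul_comm]
  exact_mod_cast h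

/-- Expanding the square of the difference of characteristic functions gives the four energies; this
is the positive definiteness of the Gaussian kernel. -/
theorem gaussDist_eq {t : ℝ} (ht : 0 ≤ t) :
    gaussDist t μ ν = gaussEnergy t μ μ + gaussEnergy t ν ν - 2 * gaussEnergy t μ ν := by
  have h : (gaussDist t μ ν : ℂ) = gaussEnergy t μ μ + gaussEnergy t ν ν
      - (gaussEnergy t μ ν + gaussEnergy t ν μ) := by
    rw [gaussEnergy_eq ht, gaussEnergy_eq ht, gaussEnergy_eq ht, gaussEnergy_eq ht, gaussDist,
      ← integral_complex_ofReal, ← integral_add (integrable_charFun_mul t) (integrable_charFun_mul t),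
      ← integral_add (integrable_charFun_mul t) (integrable_charFun_mul t)]
    have h2 := integral_sub
      ((integrable_charFun_mul (μ := μ) (ν := μ) t).add (integrable_charFun_mul (μ := ν) (ν := ν) t))
      ((integrable_charFun_mul (μ := μ) (ν := ν) t).add (integrable_charFun_mul (μ := ν) (ν := μ) t))
    simp only [Pi.add_apply] at h2
    rw [← h2]
    refine integral_congr_ae (Eventually.of_forall fun η => ?_)
    simp only
    rw [Complex.ofReal_pow, ← Complex.mul_conj', map_sub]
    ring
  rw [gaussEnergy_comm (μ := ν) (ν := μ) ht] at h
  have h2 : gaussDist t μ ν = gaussEnergy t μ μ + gaussEnergy t ν ν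
      - (gaussEnergy t μ ν + gaussEnergy t μ ν) := by exact_mod_cast h
  linarith

theorem gaussDist_nonneg (t : ℝ) (μ ν : Measure ℂ) : 0 ≤ gaussDist t μ ν :=
  integral_nonneg fun _ => by positivity

theorem measurable_gaussEnergy : Measurable fun t => gaussEnergy t μ ν := by
  refine (StronglyMeasurable.integral_prod_right (f := fun (t : ℝ) (p : ℂ × ℂ) =>
    Real.exp (-(t * ‖p.1 - p.2‖ ^ 2) / 2)) ?_).measurable
  exact Continuous.stronglyMeasurable (by unfold Function.uncurry; fun_prop)

theorem integrable_exp_neg_mul_norm_sq {t : ℝ} (ht : 0 ≤ t) :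
    Integrable (fun p : ℂ × ℂ => Real.exp (-(t * ‖p.1 - p.2‖ ^ 2) / 2)) (μ.prod ν) := by
  refine Integrable.mono' (integrable_const (1 : ℝ)) ?_ (Eventually.of_forall fun p => ?_)
  · exact Continuous.aestronglyMeasurable (by fun_prop)
  · rw [Real.norm_of_nonneg (Real.exp_pos _).le, Real.exp_le_one_iff]
    have : 0 ≤ t * ‖p.1 - p.2‖ ^ 2 := by positivity
    linarith

theorem exp_le_gaussEnergy {R t : ℝ} (ht : 0 ≤ t)
    (hR : ∀ᵐ p ∂(μ.prod ν), ‖p.1 - p.2‖ ≤ R) :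
    Real.exp (-(t * R ^ 2) / 2) ≤ gaussEnergy t μ ν := by
  have h1 : Real.exp (-(t * R ^ 2) / 2) = ∫ p, Real.exp (-(t * R ^ 2) / 2) ∂(μ.prod ν) := by simp
  rw [h1, gaussEnergy]
  refine integral_mono_ae (integrable_const _) (integrable_exp_neg_mul_norm_sq ht) ?_
  filter_upwards [hR] with p hp
  gcongr

theorem gaussEnergy_le_one {t : ℝ} (ht : 0 ≤ t) : gaussEnergy t μ ν ≤ 1 := by
  have h1 : (1 : ℝ) = ∫ p, (1 : ℝ) ∂(μ.prod ν) := by simp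
  rw [h1, gaussEnergy]
  refine integral_mono (integrable_exp_neg_mul_norm_sq ht) (integrable_const _) fun p => ?_
  simp only [Real.exp_le_one_iff]
  have : 0 ≤ t * ‖p.1 - p.2‖ ^ 2 := by positivity
  linarith

end

/-! ### The logarithm as a superposition of Gaussians -/

/-- Twice `log (R / r)`, as an integral of differences of Gaussians. -/
def gaussKernel (R r : ℝ) : ℝ≥0∞ :=
  ∫⁻ t in Set.Ioi (0 : ℝ),
    ENNReal.ofReal ((Real.exp (-(t * r ^ 2) / 2) - Real.exp (-(t * R ^ 2) / 2)) / t)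

/-- Frullani's computation: the difference of exponentials divided by `t` is the integral of `exp
(-t s)` in `s`, and after Tonelli the integral over `t` equals `1 / s`. -/
theorem gaussKernel_eq_lintegral_inv {R r : ℝ} (hr : 0 ≤ r) (h : r ≤ R) : gaussKernel R r
    = ∫⁻ s in Set.Ioc (r ^ 2 / 2) (R ^ 2 / 2), ENNReal.ofReal s⁻¹ := by
  have hab : r ^ 2 / 2 ≤ R ^ 2 / 2 := by gcongr
  have h1 : ∀ t ∈ Set.Ioi (0 : ℝ),
      ENNReal.ofReal ((Real.exp (-(t * r ^ 2) / 2) - Real.exp (-(t * R ^ 2) / 2)) / t)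
      = ∫⁻ s in Set.Ioc (r ^ 2 / 2) (R ^ 2 / 2), ENNReal.ofReal (Real.exp (-(t * s))) := by
    intro t ht
    have ht0 : t ≠ 0 := (Set.mem_Ioi.1 ht).ne'
    have hd : ∀ s : ℝ, HasDerivAt (fun s => -(Real.exp (-(t * s)) / t)) (Real.exp (-(t * s))) s := by
      intro s
      have h0 : HasDerivAt (fun s => -(t * s)) (-t) s := by
        simpa using ((hasDerivAt_id s).const_mul t).fun_neg
      exact (h0.exp.div_const t).fun_neg.congr_deriv (by field_simp)
    have hc : Continuous fun s => Real.exp (-(t * s)) := by fun_prop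
    rw [← ofReal_integral_eq_lintegral_ofReal
      ((hc.intervalIntegrable (μ := volume) _ _).1) (Eventually.of_forall fun _ => (Real.exp_pos _).le),
      ← intervalIntegral.integral_of_le hab,
      intervalIntegral.integral_eq_sub_of_hasDerivAt (fun s _ => hd s) (hc.intervalIntegrable _ _)]
    congr 1
    have e1 : -(t * (r ^ 2 / 2)) = -(t * r ^ 2) / 2 := by ring
    have e2 : -(t * (R ^ 2 / 2)) = -(t * R ^ 2) / 2 := by ring
    rw [e1, e2]
    ring
  rw [gaussKernel, setLIntegral_congr_fun measurableSet_Ioi h1, lintegral_lintegral_swap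
    (by exact Measurable.aemeasurable (by unfold Function.uncurry; fun_prop))]
  refine setLIntegral_congr_fun measurableSet_Ioc fun s hs => ?_
  have hs0 : 0 < s := lt_of_le_of_lt (by positivity) hs.1
  have hint : IntegrableOn (fun t : ℝ => Real.exp (-(t * s))) (Set.Ioi 0) := by
    have := exp_neg_integrableOn_Ioi 0 hs0
    refine this.congr (Eventually.of_forall fun t => ?_)
    simp [mul_comm]
  rw [← ofReal_integral_eq_lintegral_ofReal hint (Eventually.of_forall fun _ => (Real.exp_pos _).le)]
  congr 1
  have := integral_exp_neg_mul_rpow (p := 1) (b := s) one_pos hs0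
  simp only [Real.rpow_one, div_one, one_add_one_eq_two] at this
  have h3 : ∀ t : ℝ, Real.exp (-(t * s)) = Real.exp (-s * t) := fun t => by congr 1; ring
  simp_rw [h3, this]
  norm_num [Real.Gamma_two, Real.rpow_neg_one]

theorem gaussKernel_eq {R r : ℝ} (hr : 0 < r) (h : r ≤ R) :
    gaussKernel R r = ENNReal.ofReal (2 * (Real.log R - Real.log r)) := by
  have hab : r ^ 2 / 2 ≤ R ^ 2 / 2 := by gcongr
  have ha : 0 < r ^ 2 / 2 := by positivity
  have hR : 0 < R := hr.trans_le h
  have hi : IntervalIntegrable (fun s : ℝ => s⁻¹) volume (r ^ 2 / 2) (R ^ 2 / 2) := by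
    refine intervalIntegral.intervalIntegrable_inv (fun s hs => ?_) continuousOn_id
    rw [Set.uIcc_of_le hab] at hs
    exact (ha.trans_le hs.1).ne'
  rw [gaussKernel_eq_lintegral_inv hr.le h, ← ofReal_integral_eq_lintegral_ofReal hi.1,
    ← intervalIntegral.integral_of_le hab, integral_inv_of_pos ha (ha.trans_le hab)]
  · congr 1
    rw [div_div_div_cancel_right₀ two_ne_zero, ← div_pow, Real.log_pow, Real.log_div hR.ne' hr.ne']
    norm_num
  · filter_upwards [ae_restrict_mem measurableSet_Ioc] with s hs
    exact inv_nonneg.2 (ha.le.trans hs.1.le)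

theorem gaussKernel_zero {R : ℝ} (hR : 0 < R) : gaussKernel R 0 = ⊤ := by
  refine ENNReal.eq_top_of_forall_nnreal_le fun x => ?_
  obtain ⟨r, hr, hrR, hx⟩ : ∃ r, 0 < r ∧ r ≤ R ∧ (x : ℝ) ≤ 2 * (Real.log R - Real.log r) := by
    -- This radius gives `2 log (R / r) = x` exactly, so the kernel is unbounded as `r` decreases to
    -- zero.
    refine ⟨R * Real.exp (-x / 2), by positivity, ?_, ?_⟩
    · refine mul_le_of_le_one_right hR.le (Real.exp_le_one_iff.2 ?_)
      have := x.2
      simp only [NNReal.val_eq_coe] at this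
      linarith
    · rw [Real.log_mul hR.ne' (Real.exp_pos _).ne', Real.log_exp]
      linarith
  calc (x : ℝ≥0∞) = ENNReal.ofReal x := by simp
    _ ≤ gaussKernel R r := by rw [gaussKernel_eq hr hrR]; exact ENNReal.ofReal_le_ofReal hx
    _ ≤ gaussKernel R 0 := by
      refine lintegral_mono_ae ?_
      filter_upwards [ae_restrict_mem measurableSet_Ioi] with t ht
      have ht0 : 0 < t := ht
      refine ENNReal.ofReal_le_ofReal ?_
      gcongr

/-- The energy of `μ` and `ν` for the kernel `2 log (R / |z - ζ|)`. -/
def posEnergy (R : ℝ) (μ ν : Measure ℂ) : ℝ≥0∞ :=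
  ∫⁻ p, gaussKernel R ‖p.1 - p.2‖ ∂(μ.prod ν)

theorem measurable_gaussKernel (R : ℝ) : Measurable (gaussKernel R) := by
  refine Measurable.lintegral_prod_right' (f := fun q : ℝ × ℝ => ENNReal.ofReal
    ((Real.exp (-(q.2 * q.1 ^ 2) / 2) - Real.exp (-(q.2 * R ^ 2) / 2)) / q.2)) ?_
  fun_prop

section
variable {μ ν : Measure ℂ} [IsProbabilityMeasure μ] [IsProbabilityMeasure ν] {R : ℝ}

/-- Tonelli. The bound `‖p.1 - p.2‖ ≤ R` makes the integrand nonnegative, so that `ENNReal.ofReal`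
truncates nothing. -/
theorem posEnergy_eq (hR : ∀ᵐ p ∂(μ.prod ν), ‖p.1 - p.2‖ ≤ R) : posEnergy R μ ν
    = ∫⁻ t in Set.Ioi (0 : ℝ),
      ENNReal.ofReal ((gaussEnergy t μ ν - Real.exp (-(t * R ^ 2) / 2)) / t) := by
  unfold posEnergy gaussKernel
  rw [lintegral_lintegral_swap (by exact Measurable.aemeasurable (by unfold Function.uncurry; fun_prop))]
  refine setLIntegral_congr_fun measurableSet_Ioi fun t ht => ?_
  have ht0 : 0 < t := ht
  have hi : Integrable (fun p : ℂ × ℂ => (Real.exp (-(t * ‖p.1 - p.2‖ ^ 2) / 2)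
      - Real.exp (-(t * R ^ 2) / 2)) / t) (μ.prod ν) :=
    ((integrable_exp_neg_mul_norm_sq ht0.le).sub (integrable_const _)).div_const t
  rw [← ofReal_integral_eq_lintegral_ofReal hi]
  · rw [integral_div, integral_sub (integrable_exp_neg_mul_norm_sq ht0.le) (integrable_const _)]
    simp [gaussEnergy]
  · filter_upwards [hR] with p hp
    simp only [Pi.zero_apply]
    refine div_nonneg (sub_nonneg.2 ?_) ht0.le
    gcongr

theorem ae_gaussKernel_eq {μ ν : Measure ℂ} (hR : ∀ᵐ p ∂(μ.prod ν), ‖p.1 - p.2‖ ≤ R)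
    (hd : ∀ᵐ p ∂(μ.prod ν), p.1 ≠ p.2) : ∀ᵐ p ∂(μ.prod ν), gaussKernel R ‖p.1 - p.2‖
      = ENNReal.ofReal (2 * (Real.log R - Real.log ‖p.1 - p.2‖))
      ∧ 0 ≤ 2 * (Real.log R - Real.log ‖p.1 - p.2‖) := by
  filter_upwards [hR, hd] with p h1 h2
  have h0 : 0 < ‖p.1 - p.2‖ := norm_pos_iff.2 (sub_ne_zero.2 h2)
  exact ⟨gaussKernel_eq h0 h1, by linarith [Real.log_le_log h0 h1]⟩

theorem FiniteEnergy.posEnergy_eq (hR : ∀ᵐ p ∂(μ.prod ν), ‖p.1 - p.2‖ ≤ R)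
    (h : FiniteEnergy μ ν) :
    posEnergy R μ ν = ENNReal.ofReal (2 * (Real.log R + realEnergy μ ν))
      ∧ 0 ≤ 2 * (Real.log R + realEnergy μ ν) := by
  have hk := ae_gaussKernel_eq hR h.diag
  have hi : Integrable (fun p : ℂ × ℂ => 2 * (Real.log R - Real.log ‖p.1 - p.2‖)) (μ.prod ν) :=
    ((integrable_const _).sub h.integrable).const_mul 2
  have he : 2 * (Real.log R + realEnergy μ ν)
      = ∫ p, 2 * (Real.log R - Real.log ‖p.1 - p.2‖) ∂(μ.prod ν) := by
    rw [integral_const_mul, integral_sub (integrable_const _) h.integrable]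
    simp [realEnergy, sub_eq_add_neg]
  rw [he]
  refine ⟨?_, integral_nonneg_of_ae (hk.mono fun p hp => hp.2)⟩
  rw [ofReal_integral_eq_lintegral_ofReal hi (hk.mono fun p hp => hp.2)]
  exact lintegral_congr_ae (hk.mono fun p hp => hp.1)

/-- The kernel is infinite on the diagonal, so a finite integral leaves no mass there; off the
diagonal it is an affine function of the logarithm. -/
theorem finiteEnergy_of_posEnergy (hR0 : 0 < R) (hR : ∀ᵐ p ∂(μ.prod ν), ‖p.1 - p.2‖ ≤ R)
    (h : posEnergy R μ ν ≠ ⊤) : FiniteEnergy μ ν := by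
  have hm : Measurable fun p : ℂ × ℂ => gaussKernel R ‖p.1 - p.2‖ :=
    (measurable_gaussKernel R).comp (by fun_prop)
  have hd : ∀ᵐ p ∂(μ.prod ν), p.1 ≠ p.2 := by
    filter_upwards [ae_lt_top hm h] with p hp heq
    rw [heq, sub_self, norm_zero, gaussKernel_zero hR0] at hp
    exact hp.ne rfl
  refine ⟨hd, ?_⟩
  have hk := ae_gaussKernel_eq hR hd
  have hi : Integrable (fun p : ℂ × ℂ => 2 * (Real.log R - Real.log ‖p.1 - p.2‖)) (μ.prod ν) := by
    refine ⟨Measurable.aestronglyMeasurable (by fun_prop), ?_⟩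
    rw [hasFiniteIntegral_iff_ofReal (hk.mono fun p hp => hp.2),
      ← lintegral_congr_ae (hk.mono fun p hp => hp.1)]
    exact h.lt_top
  have := (integrable_const (Real.log R)).sub (hi.const_mul (1 / 2))
  refine this.congr (Eventually.of_forall fun p => ?_)
  simp only [Pi.sub_apply]
  ring

/-- A polarization identity, valid with infinite values: the terms with `R` cancel for every `t`. If
the left side is finite, so are the mutual energy and the energy distance. -/
theorem posEnergy_add (hμ : ∀ᵐ p ∂(μ.prod μ), ‖p.1 - p.2‖ ≤ R)
    (hν : ∀ᵐ p ∂(ν.prod ν), ‖p.1 - p.2‖ ≤ R) (hR : ∀ᵐ p ∂(μ.prod ν), ‖p.1 - p.2‖ ≤ R) :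
    posEnergy R μ μ + posEnergy R ν ν = 2 * posEnergy R μ ν + energyDist μ ν := by
  have hm : ∀ (α β : Measure ℂ) [IsProbabilityMeasure α] [IsProbabilityMeasure β],
      Measurable fun t => ENNReal.ofReal ((gaussEnergy t α β - Real.exp (-(t * R ^ 2) / 2)) / t) := by
    intro α β _ _
    have := measurable_gaussEnergy (μ := α) (ν := β)
    fun_prop
  rw [posEnergy_eq hμ, posEnergy_eq hν, posEnergy_eq hR, energyDist, ← lintegral_add_left (hm μ μ),
    ← lintegral_const_mul _ (hm μ ν), ← lintegral_add_left ((hm μ ν).const_mul 2)]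
  refine setLIntegral_congr_fun measurableSet_Ioi fun t ht => ?_
  have ht0 : 0 < t := ht
  have h1 := exp_le_gaussEnergy ht0.le hμ
  have h2 := exp_le_gaussEnergy ht0.le hν
  have h3 := exp_le_gaussEnergy ht0.le hR
  have h4 := gaussDist_nonneg t μ ν
  have e2 : (2 : ℝ≥0∞) = ENNReal.ofReal 2 := by simp
  rw [e2, ← ENNReal.ofReal_mul zero_le_two, ← ENNReal.ofReal_add, ← ENNReal.ofReal_add,
    gaussDist_eq ht0.le]
  · congr 1
    ring
  · exact mul_nonneg zero_le_two (div_nonneg (sub_nonneg.2 h3) ht0.le)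
  · positivity
  · exact div_nonneg (sub_nonneg.2 h1) ht0.le
  · exact div_nonneg (sub_nonneg.2 h2) ht0.le

theorem FiniteEnergy.mutual (hR0 : 0 < R) (hμ : ∀ᵐ p ∂(μ.prod μ), ‖p.1 - p.2‖ ≤ R)
    (hν : ∀ᵐ p ∂(ν.prod ν), ‖p.1 - p.2‖ ≤ R) (hR : ∀ᵐ p ∂(μ.prod ν), ‖p.1 - p.2‖ ≤ R)
    (h1 : FiniteEnergy μ μ) (h2 : FiniteEnergy ν ν) : FiniteEnergy μ ν := by
  refine finiteEnergy_of_posEnergy hR0 hR fun htop => ?_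
  have := posEnergy_add hμ hν hR
  rw [htop, (h1.posEnergy_eq hμ).1, (h2.posEnergy_eq hν).1] at this
  refine absurd (this.trans (by simp)) (?_ : _ ≠ ⊤)
  finiteness

theorem FiniteEnergy.energyDist_eq (hμ : ∀ᵐ p ∂(μ.prod μ), ‖p.1 - p.2‖ ≤ R)
    (hν : ∀ᵐ p ∂(ν.prod ν), ‖p.1 - p.2‖ ≤ R) (hR : ∀ᵐ p ∂(μ.prod ν), ‖p.1 - p.2‖ ≤ R)
    (h1 : FiniteEnergy μ μ) (h2 : FiniteEnergy ν ν) (h3 : FiniteEnergy μ ν) :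
    energyDist μ ν ≠ ⊤ ∧ (energyDist μ ν).toReal
      = 2 * (realEnergy μ μ + realEnergy ν ν - 2 * realEnergy μ ν) := by
  have h := posEnergy_add hμ hν hR
  obtain ⟨e1, p1⟩ := h1.posEnergy_eq hμ
  obtain ⟨e2, p2⟩ := h2.posEnergy_eq hν
  obtain ⟨e3, p3⟩ := h3.posEnergy_eq hR
  rw [e1, e2, e3, ← ENNReal.ofReal_add p1 p2] at h
  have hne : energyDist μ ν ≠ ⊤ := fun htop => by rw [htop] at h; simp at h
  refine ⟨hne, ?_⟩
  have := congrArg ENNReal.toReal h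
  rw [ENNReal.toReal_ofReal (add_nonneg p1 p2), ENNReal.toReal_add (by finiteness) hne,
    ENNReal.toReal_mul, ENNReal.toReal_ofReal p3] at this
  simp at this
  linarith

theorem measurable_gaussDist (μ ν : Measure ℂ) [IsProbabilityMeasure μ] [IsProbabilityMeasure ν] :
    Measurable fun t => gaussDist t μ ν := by
  refine (StronglyMeasurable.integral_prod_right (f := fun (t : ℝ) (η : ℂ) =>
    ‖charFun μ (√t • η) - charFun ν (√t • η)‖ ^ 2) ?_).measurable
  refine Measurable.stronglyMeasurable ?_
  have h1 : Measurable fun p : ℝ × ℂ => charFun μ (√p.1 • p.2) :=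
    measurable_charFun.comp (by fun_prop)
  have h2 : Measurable fun p : ℝ × ℂ => charFun ν (√p.1 • p.2) :=
    measurable_charFun.comp (by fun_prop)
  exact (h1.sub h2).norm.pow_const 2

/-- The Gaussian distance vanishes for some `t > 0`. The continuous characteristic functions then
agree at all points `√t • η`, which exhaust the plane. -/
theorem eq_of_energyDist_eq_zero (h : energyDist μ ν = 0) : μ = ν := by
  have hm : Measurable fun t => ENNReal.ofReal (gaussDist t μ ν / t) := by
    have := measurable_gaussDist μ ν
    fun_prop
  rw [energyDist, lintegral_eq_zero_iff hm] at h
  obtain ⟨t, ht, ht0⟩ : ∃ t : ℝ, gaussDist t μ ν = 0 ∧ 0 < t := by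
    have hne : NeBot (ae (volume.restrict (Set.Ioi (0 : ℝ)))) := by
      rw [ae_neBot, Ne, Measure.restrict_eq_zero]
      simp
    obtain ⟨t, h1, h2⟩ := (h.and (ae_restrict_mem measurableSet_Ioi)).exists
    have ht0 : 0 < t := h2
    refine ⟨t, le_antisymm ?_ (gaussDist_nonneg t μ ν), ht0⟩
    have h3 : gaussDist t μ ν / t ≤ 0 := by simpa using h1
    by_contra! hlt
    exact absurd h3 (not_le.2 (div_pos hlt ht0))
  have hc : ∀ (α : Measure ℂ) [IsProbabilityMeasure α], Continuous fun η : ℂ => charFun α (√t • η) :=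
    fun α _ => (continuous_charFun (μ := α)).comp (by fun_prop : Continuous fun η : ℂ => √t • η)
  have hcont : Continuous fun η : ℂ => ‖charFun μ (√t • η) - charFun ν (√t • η)‖ ^ 2 :=
    ((hc μ).sub (hc ν)).norm.pow 2
  rw [gaussDist, integral_eq_zero_iff_of_nonneg (fun _ => by positivity)] at ht
  · have h3 : (fun η : ℂ => ‖charFun μ (√t • η) - charFun ν (√t • η)‖ ^ 2) = 0 :=
      Continuous.ae_eq_iff_eq volume hcont continuous_const |>.1 (volume_ac_gaussC.ae_le ht)
    refine Measure.ext_of_charFun (funext fun ξ => ?_)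
    have h4 := congrFun h3 ((√t)⁻¹ • ξ)
    have hs : √t ≠ 0 := (Real.sqrt_pos.2 ht0).ne'
    simp only [smul_inv_smul₀ hs] at h4
    simpa [sub_eq_zero] using h4
  · refine Integrable.mono' (integrable_const (4 : ℝ)) hcont.aestronglyMeasurable
      (Eventually.of_forall fun η => ?_)
    rw [Real.norm_of_nonneg (by positivity)]
    have h1 := norm_sub_le (charFun μ (√t • η)) (charFun ν (√t • η))
    have h2 := norm_charFun_le_one (μ := μ) (√t • η)
    have h3 := norm_charFun_le_one (μ := ν) (√t • η)
    nlinarith [norm_nonneg (charFun μ (√t • η) - charFun ν (√t • η))]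

theorem gaussEnergy_self {t : ℝ} (ht : 0 ≤ t) :
    gaussEnergy t μ μ = ∫ η, ‖charFun μ (√t • η)‖ ^ 2 ∂gaussC := by
  have h : (gaussEnergy t μ μ : ℂ) = ((∫ η, ‖charFun μ (√t • η)‖ ^ 2 ∂gaussC : ℝ) : ℂ) := by
    rw [gaussEnergy_eq ht, ← integral_complex_ofReal]
    refine integral_congr_ae (Eventually.of_forall fun η => ?_)
    simp [Complex.mul_conj']
  exact_mod_cast h

theorem continuous_charFun_smul (μ : Measure ℂ) [IsProbabilityMeasure μ] (s : ℝ) :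
    Continuous fun η : ℂ => charFun μ (s • η) :=
  (continuous_charFun (μ := μ)).comp (by fun_prop : Continuous fun η : ℂ => s • η)

theorem integrable_of_continuous_of_bound {f : ℂ → ℝ} (hf : Continuous f) {C : ℝ}
    (h : ∀ η, |f η| ≤ C) : Integrable f gaussC :=
  Integrable.mono' (integrable_const C) hf.aestronglyMeasurable (Eventually.of_forall h)

theorem gaussEnergy_self_le {t : ℝ} (ht : 0 ≤ t) :
    gaussEnergy t μ μ ≤ 2 * gaussDist t μ ν + 2 * gaussEnergy t ν ν := by
  have hμ := continuous_charFun_smul μ √t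
  have hν := continuous_charFun_smul ν √t
  have b1 : ∀ η, ‖charFun μ (√t • η)‖ ≤ 1 := fun η => norm_charFun_le_one _
  have b2 : ∀ η, ‖charFun ν (√t • η)‖ ≤ 1 := fun η => norm_charFun_le_one _
  have b3 : ∀ η, ‖charFun μ (√t • η) - charFun ν (√t • η)‖ ≤ 2 := fun η =>
    (norm_sub_le _ _).trans (by linarith [b1 η, b2 η])
  have i1 : Integrable (fun η => ‖charFun μ (√t • η)‖ ^ 2) gaussC :=
    integrable_of_continuous_of_bound (hμ.norm.pow 2) (C := 1) fun η => by
      rw [abs_of_nonneg (by positivity)]; exact pow_le_one₀ (norm_nonneg _) (b1 η)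
  have i2 : Integrable (fun η => ‖charFun ν (√t • η)‖ ^ 2) gaussC :=
    integrable_of_continuous_of_bound (hν.norm.pow 2) (C := 1) fun η => by
      rw [abs_of_nonneg (by positivity)]; exact pow_le_one₀ (norm_nonneg _) (b2 η)
  have i3 : Integrable (fun η => ‖charFun μ (√t • η) - charFun ν (√t • η)‖ ^ 2) gaussC :=
    integrable_of_continuous_of_bound ((hμ.sub hν).norm.pow 2) (C := 4) fun η => by
      rw [abs_of_nonneg (by positivity)]
      nlinarith [b3 η, norm_nonneg (charFun μ (√t • η) - charFun ν (√t • η))]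
  rw [gaussEnergy_self ht, gaussEnergy_self ht, gaussDist, ← integral_const_mul,
    ← integral_const_mul, ← integral_add (i3.const_mul 2) (i2.const_mul 2)]
  refine integral_mono i1 ((i3.const_mul 2).add (i2.const_mul 2)) fun η => ?_
  have h1 : ‖charFun μ (√t • η)‖ ≤ ‖charFun μ (√t • η) - charFun ν (√t • η)‖
      + ‖charFun ν (√t • η)‖ := by
    simpa using norm_add_le (charFun μ (√t • η) - charFun ν (√t • η)) (charFun ν (√t • η))
  have h0 := norm_nonneg (charFun μ (√t • η))
  simp only
  nlinarith [sq_nonneg (‖charFun μ (√t • η) - charFun ν (√t • η)‖ - ‖charFun ν (√t • η)‖)]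

/-- Integrates `|x|² ≤ 2 |x - y|² + 2 |y|²` for the characteristic functions. The subtracted
exponentials no longer balance, and the extra integrable exponential in `hle` pays for the excess.
The lemma returns finite energy of the first measure from a finite value of the functional. -/
theorem FiniteEnergy.of_energyDist (hR0 : 0 < R) (hμ : ∀ᵐ p ∂(μ.prod μ), ‖p.1 - p.2‖ ≤ R)
    (hν : ∀ᵐ p ∂(ν.prod ν), ‖p.1 - p.2‖ ≤ R) (h : energyDist μ ν ≠ ⊤) (hνν : FiniteEnergy ν ν) :
    FiniteEnergy μ μ := by
  refine finiteEnergy_of_posEnergy hR0 hμ ?_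
  have hi : IntegrableOn (fun t : ℝ => R ^ 2 * Real.exp (-(R ^ 2 / 4) * t)) (Set.Ioi 0) := by
    have := exp_neg_integrableOn_Ioi 0 (by positivity : 0 < R ^ 2 / 4)
    exact this.const_mul _
  have hle : posEnergy R μ μ ≤ (2 * energyDist μ ν + 2 * posEnergy R ν ν)
      + ∫⁻ t in Set.Ioi (0 : ℝ), ENNReal.ofReal (R ^ 2 * Real.exp (-(R ^ 2 / 4) * t)) := by
    have hm : Measurable fun t =>
        ENNReal.ofReal ((gaussEnergy t ν ν - Real.exp (-(t * R ^ 2) / 2)) / t) := by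
      have := measurable_gaussEnergy (μ := ν) (ν := ν)
      fun_prop
    have hm2 : Measurable fun t : ℝ => ENNReal.ofReal (R ^ 2 * Real.exp (-(R ^ 2 / 4) * t)) := by
      fun_prop
    rw [_root_.posEnergy_eq hμ, _root_.posEnergy_eq hν, energyDist,
      ← lintegral_const_mul' _ _ ENNReal.ofNat_ne_top, ← lintegral_const_mul _ hm,
      ← lintegral_add_right _ (hm.const_mul 2), ← lintegral_add_right _ hm2]
    refine lintegral_mono_ae ?_
    filter_upwards [ae_restrict_mem measurableSet_Ioi] with t ht
    have ht0 : 0 < t := ht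
    have h1 := exp_le_gaussEnergy ht0.le hν
    have h2 := gaussDist_nonneg t μ ν
    have h3 := gaussEnergy_self_le (μ := μ) (ν := ν) ht0.le
    have h4 := gaussEnergy_le_one (μ := μ) (ν := μ) ht0.le
    have e2 : (2 : ℝ≥0∞) = ENNReal.ofReal 2 := by simp
    have q1 : 0 ≤ (gaussEnergy t ν ν - Real.exp (-(t * R ^ 2) / 2)) / t :=
      div_nonneg (sub_nonneg.2 h1) ht0.le
    rw [e2, ← ENNReal.ofReal_mul zero_le_two, ← ENNReal.ofReal_mul zero_le_two,
      ← ENNReal.ofReal_add (by positivity) (by positivity),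
      ← ENNReal.ofReal_add (by positivity) (by positivity)]
    refine ENNReal.ofReal_le_ofReal ?_
    set x := t * R ^ 2 / 2 with hx
    have hx0 : 0 < x := by positivity
    have ex : Real.exp (-(t * R ^ 2) / 2) = Real.exp (-x) := by rw [hx]; congr 1; ring
    have ex2 : Real.exp (-(R ^ 2 / 4) * t) = Real.exp (-x / 2) := by rw [hx]; congr 1; ring
    rw [ex] at h1 q1 ⊢
    rw [ex2]
    have eR : R ^ 2 = 2 * x / t := by rw [hx]; field_simp
    rw [eR, ← mul_div_assoc, ← mul_div_assoc, div_mul_eq_mul_div, ← add_div, ← add_div]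
    gcongr
    -- The excess has to be at most `2 x exp (-x / 2)`. For `x ≥ 1` it is bounded by `exp (-x)`; for
    -- `x ≤ 1` the bound `gaussEnergy ≤ 1` and `1 - exp (-x) ≤ x` suffice.
    rcases le_total 1 x with h5 | h5
    · have h6 : Real.exp (-x) ≤ Real.exp (-x / 2) := Real.exp_le_exp.2 (by linarith)
      have h7 := Real.exp_pos (-x / 2)
      nlinarith
    · have h6 : 1 - x ≤ Real.exp (-x) := by linarith [Real.add_one_le_exp (-x)]
      have h7 : 1 - x / 2 ≤ Real.exp (-x / 2) := by linarith [Real.add_one_le_exp (-x / 2)]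
      nlinarith
  have hne : ∫⁻ t in Set.Ioi (0 : ℝ), ENNReal.ofReal (R ^ 2 * Real.exp (-(R ^ 2 / 4) * t)) ≠ ⊤ := by
    have := hi.2
    rw [hasFiniteIntegral_iff_ofReal (Eventually.of_forall fun t => by positivity)] at this
    exact this.ne
  refine ne_top_of_le_ne_top ?_ hle
  rw [(hνν.posEnergy_eq hν).1]
  finiteness

end

/-! ### From extended-real energies to real energies -/

theorem logKernel_eq {z ζ : ℂ} (h : z ≠ ζ) :
    logKernel z ζ = ((-Real.log ‖z - ζ‖ : ℝ) : EReal) := by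
  have h0 : 0 < ‖z - ζ‖ := norm_pos_iff.2 (sub_ne_zero.2 h)
  rw [logKernel, ← ofReal_norm, ENNReal.log_ofReal_of_pos h0]
  simp

theorem logKernel_self (z : ℂ) : logKernel z z = ⊤ := by
  simp [logKernel]

theorem measurable_logKernel : Measurable fun p : ℂ × ℂ => logKernel p.1 p.2 := by
  unfold logKernel
  exact (ENNReal.measurable_log.comp (by fun_prop)).neg

theorem ae_toENNReal_logKernel {μ ν : Measure ℂ} (h : ∀ᵐ p ∂(μ.prod ν), p.1 ≠ p.2) :
    (∫⁻ p, (logKernel p.1 p.2).toENNReal ∂(μ.prod ν)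
      = ∫⁻ p, ENNReal.ofReal (-Real.log ‖p.1 - p.2‖) ∂(μ.prod ν)) ∧
    (∫⁻ p, (-logKernel p.1 p.2).toENNReal ∂(μ.prod ν)
      = ∫⁻ p, ENNReal.ofReal (Real.log ‖p.1 - p.2‖) ∂(μ.prod ν)) := by
  constructor
  · refine lintegral_congr_ae (h.mono fun p hp => ?_)
    simp only
    rw [logKernel_eq hp, EReal.real_coe_toENNReal]
  · refine lintegral_congr_ae (h.mono fun p hp => ?_)
    simp only
    rw [logKernel_eq hp, ← EReal.coe_neg, neg_neg, EReal.real_coe_toENNReal]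

theorem FiniteEnergy.mutualEnergy_eq {μ ν : Measure ℂ} (h : FiniteEnergy μ ν) :
    mutualEnergy μ ν = (realEnergy μ ν : EReal) := by
  obtain ⟨h1, h2⟩ := ae_toENNReal_logKernel h.diag
  have p1 : ∫⁻ p : ℂ × ℂ, ENNReal.ofReal (-Real.log ‖p.1 - p.2‖) ∂(μ.prod ν) < ⊤ :=
    h.integrable.neg.lintegral_lt_top
  have p2 := h.integrable.lintegral_lt_top
  have h3 := integral_eq_lintegral_pos_part_sub_lintegral_neg_part h.integrable
  rw [mutualEnergy, extIntegral, h1, h2, realEnergy, h3, neg_sub, EReal.coe_sub,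
    EReal.coe_ennreal_toReal p1.ne, EReal.coe_ennreal_toReal p2.ne]

/-- The negative part of the kernel is at most `log R`, hence has finite integral; this must come
first, as `⊤ - ⊤` is not `⊤` in `EReal`. An infinite positive part would then make the energy `⊤`.
The diagonal, invisible to `Real.log`, is null because the extended kernel is `⊤` on it. -/
theorem finiteEnergy_of_mutualEnergy {μ ν : Measure ℂ} [IsFiniteMeasure μ] [IsFiniteMeasure ν]
    {R : ℝ} (hR : ∀ᵐ p ∂(μ.prod ν), ‖p.1 - p.2‖ ≤ R) (h : mutualEnergy μ ν ≠ ⊤) :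
    FiniteEnergy μ ν := by
  have hb : ∫⁻ p, (-logKernel p.1 p.2).toENNReal ∂(μ.prod ν) ≠ ⊤ := by
    have hle : ∫⁻ p, (-logKernel p.1 p.2).toENNReal ∂(μ.prod ν)
        ≤ ∫⁻ _, ENNReal.ofReal (Real.log R) ∂(μ.prod ν) := by
      refine lintegral_mono_ae (hR.mono fun p hp => ?_)
      rcases eq_or_ne p.1 p.2 with he | he
      · rw [he, logKernel_self]
        simp
      · rw [logKernel_eq he, ← EReal.coe_neg, neg_neg, EReal.real_coe_toENNReal]
        exact ENNReal.ofReal_le_ofReal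
          (Real.log_le_log (norm_pos_iff.2 (sub_ne_zero.2 he)) hp)
    refine ne_top_of_le_ne_top ?_ hle
    rw [lintegral_const]
    finiteness
  have ha : ∫⁻ p, (logKernel p.1 p.2).toENNReal ∂(μ.prod ν) ≠ ⊤ := by
    intro htop
    apply h
    rw [mutualEnergy, extIntegral, htop, ← EReal.coe_ennreal_toReal hb]
    exact EReal.top_sub_coe _
  have hd : ∀ᵐ p ∂(μ.prod ν), p.1 ≠ p.2 := by
    filter_upwards [ae_lt_top (by exact measurable_logKernel.ereal_toENNReal) ha] with p hp heq
    rw [heq, logKernel_self] at hp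
    simp at hp
  obtain ⟨h1, h2⟩ := ae_toENNReal_logKernel hd
  refine ⟨hd, Measurable.aestronglyMeasurable (by fun_prop), ?_⟩
  rw [HasFiniteIntegral]
  have hle : ∀ x : ℝ, ‖x‖ₑ ≤ ENNReal.ofReal (-x) + ENNReal.ofReal x := by
    intro x
    rw [← ofReal_norm, Real.norm_eq_abs]
    rcases abs_cases x with ⟨h, _⟩ | ⟨h, _⟩ <;> rw [h]
    · exact le_add_self
    · exact le_self_add
  refine (lintegral_mono fun p => hle _).trans_lt ?_
  rw [lintegral_add_left (by fun_prop), ← h1, ← h2]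
  exact (ENNReal.add_ne_top.2 ⟨ha, hb⟩).lt_top

/-! ### Bilinearity of the energy -/

set_option linter.unusedSectionVars false

section
variable {μ ν τ : Measure ℂ} [IsFiniteMeasure μ] [IsFiniteMeasure ν] [IsFiniteMeasure τ]

theorem FiniteEnergy.symm (h : FiniteEnergy μ ν) : FiniteEnergy ν μ := by
  have hs : (ν.prod μ) = (μ.prod ν).map Prod.swap := Measure.prod_swap.symm
  constructor
  · have hset : MeasurableSet {p : ℂ × ℂ | p.1 ≠ p.2} :=
      (measurableSet_eq_fun measurable_fst measurable_snd).compl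
    rw [hs, ae_map_iff measurable_swap.aemeasurable hset]
    exact h.diag.mono fun p hp => hp.symm
  · rw [hs, integrable_map_measure (Measurable.aestronglyMeasurable (by fun_prop))
      measurable_swap.aemeasurable]
    refine h.integrable.congr (Eventually.of_forall fun p => ?_)
    simp [norm_sub_rev]

theorem realEnergy_comm : realEnergy μ ν = realEnergy ν μ := by
  rw [realEnergy, realEnergy, ← integral_prod_swap]
  simp [norm_sub_rev]

theorem FiniteEnergy.add_left (h₁ : FiniteEnergy μ τ) (h₂ : FiniteEnergy ν τ) :
    FiniteEnergy (μ + ν) τ := by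
  constructor <;> rw [Measure.add_prod]
  · exact ae_add_measure_iff.2 ⟨h₁.diag, h₂.diag⟩
  · exact h₁.integrable.add_measure h₂.integrable

theorem FiniteEnergy.smul_left (h : FiniteEnergy μ τ) (c : ℝ≥0) : FiniteEnergy (c • μ) τ := by
  constructor <;> rw [Measure.prod_smul_left]
  · exact Measure.ae_smul_measure h.diag c
  · exact h.integrable.smul_measure_nnreal

theorem realEnergy_add_left (h₁ : FiniteEnergy μ τ) (h₂ : FiniteEnergy ν τ) :
    realEnergy (μ + ν) τ = realEnergy μ τ + realEnergy ν τ := by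
  rw [realEnergy, Measure.add_prod, integral_add_measure h₁.integrable h₂.integrable, realEnergy,
    realEnergy]
  ring

theorem realEnergy_smul_left (c : ℝ≥0) : realEnergy (c • μ) τ = c * realEnergy μ τ := by
  rw [realEnergy, Measure.prod_smul_left, integral_smul_nnreal_measure, realEnergy,
    NNReal.smul_def, smul_eq_mul]
  ring

theorem FiniteEnergy.mix_left (h₁ : FiniteEnergy μ τ) (h₂ : FiniteEnergy ν τ) (a b : ℝ≥0) :
    FiniteEnergy (a • μ + b • ν) τ :=
  (h₁.smul_left a).add_left (h₂.smul_left b)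

theorem realEnergy_mix_left (h₁ : FiniteEnergy μ τ) (h₂ : FiniteEnergy ν τ) (a b : ℝ≥0) :
    realEnergy (a • μ + b • ν) τ = a * realEnergy μ τ + b * realEnergy ν τ := by
  rw [realEnergy_add_left (h₁.smul_left a) (h₂.smul_left b), realEnergy_smul_left,
    realEnergy_smul_left]

theorem FiniteEnergy.mix_right (h₁ : FiniteEnergy τ μ) (h₂ : FiniteEnergy τ ν) (a b : ℝ≥0) :
    FiniteEnergy τ (a • μ + b • ν) :=
  (h₁.symm.mix_left h₂.symm a b).symm

theorem realEnergy_mix_right (h₁ : FiniteEnergy τ μ) (h₂ : FiniteEnergy τ ν) (a b : ℝ≥0) :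
    realEnergy τ (a • μ + b • ν) = a * realEnergy τ μ + b * realEnergy τ ν := by
  rw [realEnergy_comm, realEnergy_mix_left h₁.symm h₂.symm, realEnergy_comm (μ := μ),
    realEnergy_comm (μ := ν)]

theorem realEnergy_mix_self (h₁ : FiniteEnergy μ μ) (h₂ : FiniteEnergy ν ν)
    (h₃ : FiniteEnergy μ ν) (a b : ℝ≥0) :
    FiniteEnergy (a • μ + b • ν) (a • μ + b • ν) ∧
    realEnergy (a • μ + b • ν) (a • μ + b • ν)
      = a ^ 2 * realEnergy μ μ + 2 * a * b * realEnergy μ ν + b ^ 2 * realEnergy ν ν := by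
  refine ⟨(h₁.mix_right h₃ a b).mix_left (h₃.symm.mix_right h₂ a b) a b, ?_⟩
  rw [realEnergy_mix_left (h₁.mix_right h₃ a b) (h₃.symm.mix_right h₂ a b),
    realEnergy_mix_right h₁ h₃, realEnergy_mix_right h₃.symm h₂, realEnergy_comm (μ := ν) (ν := μ)]
  ring

/-- The product measure gives the diagonal point `(z, z)` the mass `μ {z} ^ 2`. -/
theorem FiniteEnergy.measure_singleton (h : FiniteEnergy μ μ) (z : ℂ) : μ {z} = 0 := by
  have h1 : (μ.prod μ) ({z} ×ˢ {z}) = 0 := by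
    refine measure_mono_null (fun p hp => ?_) (ae_iff.1 h.diag)
    rw [Set.mem_prod, Set.mem_singleton_iff, Set.mem_singleton_iff] at hp
    simp [hp.1, hp.2]
  rw [Measure.prod_prod] at h1
  exact mul_self_eq_zero.1 h1

theorem FiniteEnergy.mono {μ' ν' : Measure ℂ} [IsFiniteMeasure μ'] [IsFiniteMeasure ν']
    (h : FiniteEnergy μ ν) (hμ : μ' ≤ μ) (hν : ν' ≤ ν) : FiniteEnergy μ' ν' :=
  have hle : μ'.prod ν' ≤ μ.prod ν := Measure.prod_mono hμ hν
  ⟨ae_mono hle h.diag, h.integrable.mono_measure hle⟩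

theorem FiniteEnergy.ae_integrable (h : FiniteEnergy τ μ) :
    ∀ᵐ z ∂τ, Integrable (fun ζ => Real.log ‖z - ζ‖) μ :=
  h.integrable.prod_right_ae

theorem FiniteEnergy.integrable_logPot (h : FiniteEnergy τ μ) : Integrable (logPot μ) τ :=
  h.integrable.integral_prod_left

theorem FiniteEnergy.integral_logPot (h : FiniteEnergy τ μ) :
    ∫ z, logPot μ z ∂τ = -realEnergy τ μ := by
  rw [realEnergy, neg_neg, integral_prod _ h.integrable]
  rfl

end

/-! ### Unit measures on a compact set -/

theorem unitMeasures_mono {K L : Set ℂ} (h : K ⊆ L) : unitMeasures K ⊆ unitMeasures L :=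
  fun _ hμ => ⟨hμ.1, measure_mono_null (Set.compl_subset_compl.2 h) hμ.2⟩

theorem mix_mem_unitMeasures {K : Set ℂ} {μ ν : Measure ℂ} (hμ : μ ∈ unitMeasures K)
    (hν : ν ∈ unitMeasures K) {a b : ℝ≥0} (hab : a + b = 1) : a • μ + b • ν ∈ unitMeasures K := by
  obtain ⟨hμ1, hμ2⟩ := hμ
  obtain ⟨hν1, hν2⟩ := hν
  refine ⟨⟨?_⟩, ?_⟩
  · simp only [Measure.coe_add, Measure.coe_nnreal_smul_apply, Pi.add_apply, measure_univ, mul_one]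
    exact_mod_cast hab
  · simp [hμ2, hν2]

section
variable {K : Set ℂ} {μ ν : Measure ℂ}

theorem exists_radius (hK : IsCompact K) : ∃ R > 0, ∀ μ ∈ unitMeasures K, ∀ ν ∈ unitMeasures K,
    ∀ᵐ p ∂(μ.prod ν), ‖p.1 - p.2‖ ≤ R := by
  obtain ⟨ρ, hρ⟩ := hK.isBounded.exists_norm_le
  refine ⟨max (2 * ρ) 1, by positivity, fun μ hμ ν hν => ?_⟩
  obtain ⟨hμ1, hμ2⟩ := hμ
  obtain ⟨hν1, hν2⟩ := hν
  have h1 : ∀ᵐ p ∂(μ.prod ν), p.1 ∈ K :=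
    Measure.quasiMeasurePreserving_fst.ae (ae_iff.2 hμ2)
  have h2 : ∀ᵐ p ∂(μ.prod ν), p.2 ∈ K :=
    Measure.quasiMeasurePreserving_snd.ae (ae_iff.2 hν2)
  filter_upwards [h1, h2] with p hp1 hp2
  refine le_max_of_le_left ((norm_sub_le _ _).trans ?_)
  linarith [hρ _ hp1, hρ _ hp2]

theorem finiteEnergy_of_mem (hK : IsCompact K) (hμ : μ ∈ unitMeasures K) (hν : ν ∈ unitMeasures K)
    (h : mutualEnergy μ ν ≠ ⊤) : FiniteEnergy μ ν := by
  obtain ⟨R, hR0, hR⟩ := exists_radius hK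
  have := hμ.1
  have := hν.1
  exact finiteEnergy_of_mutualEnergy (hR _ hμ _ hν) h

theorem finiteEnergy_mutual (hK : IsCompact K) (hμ : μ ∈ unitMeasures K) (hν : ν ∈ unitMeasures K)
    (h1 : FiniteEnergy μ μ) (h2 : FiniteEnergy ν ν) : FiniteEnergy μ ν := by
  obtain ⟨R, hR0, hR⟩ := exists_radius hK
  have := hμ.1
  have := hν.1
  exact h1.mutual hR0 (hR _ hμ _ hμ) (hR _ hν _ hν) (hR _ hμ _ hν) h2

theorem energyDist_eq_of_mem (hK : IsCompact K) (hμ : μ ∈ unitMeasures K) (hν : ν ∈ unitMeasures K)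
    (h1 : FiniteEnergy μ μ) (h2 : FiniteEnergy ν ν) :
    energyDist μ ν ≠ ⊤ ∧ (energyDist μ ν).toReal
      = 2 * (realEnergy μ μ + realEnergy ν ν - 2 * realEnergy μ ν) := by
  obtain ⟨R, hR0, hR⟩ := exists_radius hK
  have := hμ.1
  have := hν.1
  exact h1.energyDist_eq (hR _ hμ _ hμ) (hR _ hν _ hν) (hR _ hμ _ hν) h2
    (finiteEnergy_mutual hK hμ hν h1 h2)

/-- Positivity of the energy on differences of unit measures. -/
theorem realEnergy_sub_nonneg (hK : IsCompact K) (hμ : μ ∈ unitMeasures K)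
    (hν : ν ∈ unitMeasures K) (h1 : FiniteEnergy μ μ) (h2 : FiniteEnergy ν ν) :
    0 ≤ realEnergy μ μ + realEnergy ν ν - 2 * realEnergy μ ν := by
  have := (energyDist_eq_of_mem hK hμ hν h1 h2).2
  linarith [(ENNReal.toReal_nonneg : 0 ≤ (energyDist μ ν).toReal)]

theorem eq_of_realEnergy_sub (hK : IsCompact K) (hμ : μ ∈ unitMeasures K)
    (hν : ν ∈ unitMeasures K) (h1 : FiniteEnergy μ μ) (h2 : FiniteEnergy ν ν)
    (h : realEnergy μ μ + realEnergy ν ν - 2 * realEnergy μ ν = 0) : μ = ν := by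
  obtain ⟨h3, h4⟩ := energyDist_eq_of_mem hK hμ hν h1 h2
  rw [h, mul_zero, ENNReal.toReal_eq_zero_iff] at h4
  have := hμ.1
  have := hν.1
  exact eq_of_energyDist_eq_zero (h4.resolve_right h3)

end

/-! ### Lower semicontinuity and existence of minimizers -/

/-- Fatou's lemma along sequences; sequential spaces are those where this settles the closedness of
the sublevel sets. -/
theorem lowerSemicontinuous_lintegral_ofReal {X : Type*} [TopologicalSpace X] [SequentialSpace X]
    {m : Measure ℝ} {f : X → ℝ → ℝ} (hm : ∀ x, Measurable (f x))
    (hc : ∀ᵐ t ∂m, Continuous fun x => f x t) :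
    LowerSemicontinuous fun x => ∫⁻ t, ENNReal.ofReal (f x t) ∂m := by
  rw [lowerSemicontinuous_iff_isClosed_preimage]
  intro c
  refine IsSeqClosed.isClosed fun u x hu hx => ?_
  simp only [Set.mem_preimage, Set.mem_Iic] at hu ⊢
  have h1 : ∫⁻ t, ENNReal.ofReal (f x t) ∂m
      = ∫⁻ t, liminf (fun n => ENNReal.ofReal (f (u n) t)) atTop ∂m := by
    refine lintegral_congr_ae (hc.mono fun t ht => ?_)
    exact (((ENNReal.continuous_ofReal.comp ht).tendsto x).comp hx).liminf_eq.symm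
  rw [h1]
  refine (lintegral_liminf_le fun n => (hm (u n)).ennreal_ofReal).trans ?_
  exact (liminf_le_liminf (Eventually.of_forall hu)).trans (by simp)

theorem continuous_charFun_probabilityMeasure (ξ : ℂ) :
    Continuous fun μ : ProbabilityMeasure ℂ => charFun (μ : Measure ℂ) ξ :=
  continuous_iff_seqContinuous.2 fun _ _ h =>
    ProbabilityMeasure.tendsto_iff_tendsto_charFun.1 h ξ

theorem continuous_gaussDist (t : ℝ) :
    Continuous fun x : ProbabilityMeasure ℂ × ProbabilityMeasure ℂ =>
      gaussDist t (x.1 : Measure ℂ) (x.2 : Measure ℂ) := by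
  refine continuous_of_dominated (bound := fun _ => 4) (fun x => ?_) (fun x => ?_)
    (integrable_const _) (Eventually.of_forall fun η => ?_)
  · exact (((continuous_charFun_smul _ _).sub
      (continuous_charFun_smul _ _)).norm.pow 2).aestronglyMeasurable
  · refine Eventually.of_forall fun η => ?_
    rw [Real.norm_of_nonneg (by positivity)]
    have h1 := norm_sub_le (charFun (x.1 : Measure ℂ) (√t • η)) (charFun (x.2 : Measure ℂ) (√t • η))
    have h2 := norm_charFun_le_one (μ := (x.1 : Measure ℂ)) (√t • η)
    have h3 := norm_charFun_le_one (μ := (x.2 : Measure ℂ)) (√t • η)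
    nlinarith [norm_nonneg (charFun (x.1 : Measure ℂ) (√t • η)
      - charFun (x.2 : Measure ℂ) (√t • η))]
  · exact ((((continuous_charFun_probabilityMeasure _).comp continuous_fst).sub
      ((continuous_charFun_probabilityMeasure _).comp continuous_snd)).norm.pow 2)

theorem continuous_gaussEnergy_self {t : ℝ} (ht : 0 ≤ t) :
    Continuous fun μ : ProbabilityMeasure ℂ => gaussEnergy t (μ : Measure ℂ) (μ : Measure ℂ) := by
  simp_rw [gaussEnergy_self ht]
  refine continuous_of_dominated (bound := fun _ => 1) (fun x => ?_) (fun x => ?_)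
    (integrable_const _) (Eventually.of_forall fun η => ?_)
  · exact ((continuous_charFun_smul _ _).norm.pow 2).aestronglyMeasurable
  · refine Eventually.of_forall fun η => ?_
    rw [Real.norm_of_nonneg (by positivity)]
    exact pow_le_one₀ (norm_nonneg _) (norm_charFun_le_one _)
  · exact ((continuous_charFun_probabilityMeasure _).norm.pow 2)

theorem lowerSemicontinuous_energyDist :
    LowerSemicontinuous fun x : ProbabilityMeasure ℂ × ProbabilityMeasure ℂ =>
      energyDist (x.1 : Measure ℂ) (x.2 : Measure ℂ) :=
  lowerSemicontinuous_lintegral_ofReal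
    (fun _ => (measurable_gaussDist _ _).div measurable_id)
    (Eventually.of_forall fun t => (continuous_gaussDist t).div_const t)

/-- The Gaussian form of the energy for the kernel `2 log (R / |z - ζ|)`. -/
def gaussPosEnergy (R : ℝ) (μ : Measure ℂ) : ℝ≥0∞ :=
  ∫⁻ t in Set.Ioi (0 : ℝ), ENNReal.ofReal ((gaussEnergy t μ μ - Real.exp (-(t * R ^ 2) / 2)) / t)

theorem lowerSemicontinuous_gaussPosEnergy (R : ℝ) :
    LowerSemicontinuous fun μ : ProbabilityMeasure ℂ => gaussPosEnergy R (μ : Measure ℂ) := by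
  refine lowerSemicontinuous_lintegral_ofReal (fun μ => ?_) ?_
  · have := measurable_gaussEnergy (μ := (μ : Measure ℂ)) (ν := (μ : Measure ℂ))
    fun_prop
  · filter_upwards [ae_restrict_mem measurableSet_Ioi] with t ht
    have ht0 : 0 < t := ht
    exact ((continuous_gaussEnergy_self ht0.le).sub continuous_const).div_const t

/-- The set of unit measures on a compact set, as a set of probability measures, is compact. -/
theorem isCompact_unitMeasures {K : Set ℂ} (hK : IsCompact K) :
    IsCompact {μ : ProbabilityMeasure ℂ | (μ : Measure ℂ) ∈ unitMeasures K} := by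
  have : CompactSpace K := isCompact_iff_compactSpace.1 hK
  have hmeas : Measurable ((↑) : K → ℂ) := measurable_subtype_coe
  -- The unit measures on `K` are the image of the compact space of probability measures on the
  -- subtype `K` under push-forward by the inclusion.
  have hr := isCompact_range (ProbabilityMeasure.continuous_map (continuous_subtype_val (p := (· ∈ K))))
  convert hr using 1
  ext μ
  simp only [Set.mem_ofPred_eq, Set.mem_range]
  constructor
  · intro hμ
    have h1 := hμ.2
    have hae : ∀ᵐ z ∂(μ : Measure ℂ), z ∈ Set.range ((↑) : K → ℂ) := by
      rw [Subtype.range_coe]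
      exact ae_iff.2 h1
    have hmap : ((μ : Measure ℂ).comap ((↑) : K → ℂ)).map ((↑) : K → ℂ) = (μ : Measure ℂ) := by
      rw [(MeasurableEmbedding.subtype_coe hK.measurableSet).map_comap,
        Measure.restrict_eq_self_of_ae_mem hae]
    have hp : IsProbabilityMeasure ((μ : Measure ℂ).comap ((↑) : K → ℂ)) := by
      refine ⟨?_⟩
      have := congrArg (fun m : Measure ℂ => m Set.univ) hmap
      simp only [Measure.map_apply hmeas MeasurableSet.univ, Set.preimage_univ, measure_univ] at this
      exact this
    exact ⟨⟨_, hp⟩, Subtype.ext hmap⟩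
  · rintro ⟨ν, rfl⟩
    refine ⟨inferInstance, ?_⟩
    rw [ProbabilityMeasure.toMeasure_map, Measure.map_apply hmeas hK.measurableSet.compl]
    simp

/-! ### Minimization of the vector energy -/

/-- The vector energy of a pair of measures of finite energy, as a real number. -/
def realVectorEnergy (ψ : ℂ → ℝ) (μ ν : Measure ℂ) : ℝ :=
  realEnergy μ μ - 2 * realEnergy μ ν + 4 * realEnergy ν ν + 2 * ∫ z, ψ z ∂ν

/-- As `ψ` may be unbounded, weak convergence need not carry the integral to the limit; for `ψ ≥ 0`
the portmanteau inequality for open sets still gives one side. -/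
theorem lowerSemicontinuous_lintegral_of_continuous {ψ : ℂ → ℝ} (hψ : Continuous ψ)
    (hψ0 : ∀ z, 0 ≤ ψ z) : LowerSemicontinuous fun μ : ProbabilityMeasure ℂ =>
      ∫⁻ z, ENNReal.ofReal (ψ z) ∂(μ : Measure ℂ) := by
  rw [lowerSemicontinuous_iff_isClosed_preimage]
  intro c
  refine IsSeqClosed.isClosed fun u x hu hx => ?_
  simp only [Set.mem_preimage, Set.mem_Iic] at hu ⊢
  refine (lintegral_le_liminf_lintegral_of_forall_isOpen_measure_le_liminf_measure
    (μs := fun n => (u n : Measure ℂ)) hψ hψ0 fun G hG =>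
      ProbabilityMeasure.le_liminf_measure_open_of_tendsto hx hG).trans ?_
  exact (liminf_le_liminf (Eventually.of_forall hu)).trans (by simp)

theorem eq_of_half_smul_add_eq {μ ν τ : Measure ℂ} [IsFiniteMeasure τ]
    (h : (1 / 2 : ℝ≥0) • μ + (1 / 2 : ℝ≥0) • τ = (1 / 2 : ℝ≥0) • ν + (1 / 2 : ℝ≥0) • τ) :
    μ = ν := by
  ext s hs
  have h1 := congrArg (fun m : Measure ℂ => m s) h
  simp only [Measure.coe_add, Pi.add_apply, Measure.coe_nnreal_smul_apply] at h1
  rw [ENNReal.add_left_inj (ENNReal.mul_ne_top (by simp) (measure_ne_top τ s)),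
    ENNReal.mul_right_inj (by simp) (by simp)] at h1
  exact h1

section
variable {E F : Set ℂ} {ψ : ℂ → ℝ}

theorem vectorEnergy_eq_of_finiteEnergy (hE : IsCompact E) (hF : IsCompact F) {μ ν : Measure ℂ}
    (hμ : μ ∈ unitMeasures E) (hν : ν ∈ unitMeasures F) (h1 : FiniteEnergy μ μ)
    (h2 : FiniteEnergy ν ν) :
    vectorEnergy interactionMatrix ψ F ![μ, ν] = (realVectorEnergy ψ μ ν : EReal) := by
  have := hμ.1
  have := hν.1
  have h3 : FiniteEnergy μ ν := finiteEnergy_mutual (hE.union hF)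
    (unitMeasures_mono Set.subset_union_left hμ) (unitMeasures_mono Set.subset_union_right hν) h1 h2
  have hfin : ∀ i, mutualEnergy (![μ, ν] i) (![μ, ν] i) ≠ ⊤ := by
    intro i
    fin_cases i
    · simp [h1.mutualEnergy_eq]
    · simp [h2.mutualEnergy_eq]
  rw [vectorEnergy, if_pos hfin]
  simp only [Fin.sum_univ_two, interactionMatrix, Matrix.cons_val_zero, Matrix.cons_val_one,
    Matrix.of_apply, h1.mutualEnergy_eq, h2.mutualEnergy_eq, h3.mutualEnergy_eq,
    h3.symm.mutualEnergy_eq, restrict_eq_self_of_compl hν.2]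
  rw [realEnergy_comm (μ := ν) (ν := μ)]
  have e2 : (2 : EReal) = ((2 : ℝ) : EReal) := rfl
  rw [e2]
  rw [realVectorEnergy]
  simp only [← EReal.coe_mul, ← EReal.coe_add, EReal.coe_eq_coe_iff]
  ring

theorem finiteEnergy_of_vectorEnergy (hE : IsCompact E) (hF : IsCompact F) {μ ν : Measure ℂ}
    (hμ : μ ∈ unitMeasures E) (hν : ν ∈ unitMeasures F)
    (h : vectorEnergy interactionMatrix ψ F ![μ, ν] ≠ ⊤) :
    FiniteEnergy μ μ ∧ FiniteEnergy ν ν := by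
  unfold vectorEnergy at h
  split_ifs at h with hfin
  · exact ⟨finiteEnergy_of_mem hE hμ hμ (hfin 0), finiteEnergy_of_mem hF hν hν (hfin 1)⟩
  · exact absurd rfl h

/-- The functional `Φ` equals `2 J + 6 log R` on pairs of finite energy, and each of its three terms
is nonnegative and lower semicontinuous on all pairs of probability measures. The pair `τ₁, τ₂`
makes the minimum finite. -/
theorem exists_realVectorEnergy_minimizer (hE : IsCompact E) (hF : IsCompact F) (hψ : Continuous ψ)
    (hψ0 : ∀ z, 0 ≤ ψ z) {τ₁ τ₂ : Measure ℂ} (hτ₁ : τ₁ ∈ unitMeasures E) (hτ₂ : τ₂ ∈ unitMeasures F)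
    (h₁ : FiniteEnergy τ₁ τ₁) (h₂ : FiniteEnergy τ₂ τ₂) :
    ∃ lam₁ ∈ unitMeasures E, ∃ lam₂ ∈ unitMeasures F, FiniteEnergy lam₁ lam₁ ∧
      FiniteEnergy lam₂ lam₂ ∧ ∀ μ ∈ unitMeasures E, ∀ ν ∈ unitMeasures F, FiniteEnergy μ μ →
        FiniteEnergy ν ν → realVectorEnergy ψ lam₁ lam₂ ≤ realVectorEnergy ψ μ ν := by
  obtain ⟨R, hR0, hR⟩ := exists_radius (hE.union hF)
  have hEm : ∀ μ ∈ unitMeasures E, μ ∈ unitMeasures (E ∪ F) :=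
    unitMeasures_mono Set.subset_union_left
  have hFm : ∀ μ ∈ unitMeasures F, μ ∈ unitMeasures (E ∪ F) :=
    unitMeasures_mono Set.subset_union_right
  have hψi : ∀ ν ∈ unitMeasures F, Integrable ψ ν := fun ν hν => by
    have := hν.1
    exact integrable_of_continuous_of_isCompact hF hν.2 hψ
  set Φ : ProbabilityMeasure ℂ × ProbabilityMeasure ℂ → ℝ≥0∞ := fun x =>
    energyDist (x.1 : Measure ℂ) (x.2 : Measure ℂ)
      + (3 * gaussPosEnergy R (x.2 : Measure ℂ) + 4 * ∫⁻ z, ENNReal.ofReal (ψ z) ∂(x.2 : Measure ℂ))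
    with hΦ
  have key : ∀ μ ∈ unitMeasures E, ∀ ν ∈ unitMeasures F, FiniteEnergy μ μ → FiniteEnergy ν ν →
      energyDist μ ν + (3 * gaussPosEnergy R ν + 4 * ∫⁻ z, ENNReal.ofReal (ψ z) ∂ν)
        = ENNReal.ofReal (2 * realVectorEnergy ψ μ ν + 6 * Real.log R) := by
    intro μ hμ ν hν f1 f2
    have := hμ.1
    have := hν.1
    obtain ⟨d1, d2⟩ := energyDist_eq_of_mem (hE.union hF) (hEm _ hμ) (hFm _ hν) f1 f2
    obtain ⟨p1, p2⟩ := f2.posEnergy_eq (hR _ (hFm _ hν) _ (hFm _ hν))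
    have p3 : gaussPosEnergy R ν = ENNReal.ofReal (2 * (Real.log R + realEnergy ν ν)) := by
      rw [gaussPosEnergy, ← posEnergy_eq (hR _ (hFm _ hν) _ (hFm _ hν)), p1]
    have p4 := realEnergy_sub_nonneg (hE.union hF) (hEm _ hμ) (hFm _ hν) f1 f2
    have p5 : 0 ≤ ∫ z, ψ z ∂ν := integral_nonneg hψ0
    rw [← ENNReal.ofReal_toReal d1, d2, p3, ← ofReal_integral_eq_lintegral_ofReal (hψi ν hν)
      (Eventually.of_forall hψ0)]
    have e3 : (3 : ℝ≥0∞) = ENNReal.ofReal 3 := by simp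
    have e4 : (4 : ℝ≥0∞) = ENNReal.ofReal 4 := by simp
    rw [e3, e4, ← ENNReal.ofReal_mul (by norm_num), ← ENNReal.ofReal_mul (by norm_num),
      ← ENNReal.ofReal_add (by linarith) (by linarith),
      ← ENNReal.ofReal_add (by linarith) (by linarith), realVectorEnergy]
    congr 1
    ring
  have key2 : ∀ μ ∈ unitMeasures E, ∀ ν ∈ unitMeasures F, FiniteEnergy μ μ → FiniteEnergy ν ν →
      0 ≤ 2 * realVectorEnergy ψ μ ν + 6 * Real.log R := by
    intro μ hμ ν hν f1 f2
    have := hμ.1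
    have := hν.1
    have p2 := (f2.posEnergy_eq (hR _ (hFm _ hν) _ (hFm _ hν))).2
    have p4 := realEnergy_sub_nonneg (hE.union hF) (hEm _ hμ) (hFm _ hν) f1 f2
    have p5 : 0 ≤ ∫ z, ψ z ∂ν := integral_nonneg hψ0
    rw [realVectorEnergy]
    linarith
  have hlsc : LowerSemicontinuousOn Φ
      ({μ : ProbabilityMeasure ℂ | (μ : Measure ℂ) ∈ unitMeasures E} ×ˢ
        {ν : ProbabilityMeasure ℂ | (ν : Measure ℂ) ∈ unitMeasures F}) := by
    refine LowerSemicontinuous.lowerSemicontinuousOn ?_ _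
    refine lowerSemicontinuous_energyDist.add (LowerSemicontinuous.add ?_ ?_)
    · exact (ENNReal.continuous_const_mul (a := 3) (by simp)).comp_lowerSemicontinuous
        ((lowerSemicontinuous_gaussPosEnergy R).comp continuous_snd) mul_right_mono
    · exact (ENNReal.continuous_const_mul (a := 4) (by simp)).comp_lowerSemicontinuous
        ((lowerSemicontinuous_lintegral_of_continuous hψ hψ0).comp continuous_snd) mul_right_mono
  have hne : ({μ : ProbabilityMeasure ℂ | (μ : Measure ℂ) ∈ unitMeasures E} ×ˢ
        {ν : ProbabilityMeasure ℂ | (ν : Measure ℂ) ∈ unitMeasures F}).Nonempty :=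
    ⟨((⟨τ₁, hτ₁.1⟩, ⟨τ₂, hτ₂.1⟩) : ProbabilityMeasure ℂ × ProbabilityMeasure ℂ), hτ₁, hτ₂⟩
  obtain ⟨⟨l₁, l₂⟩, ⟨hl₁, hl₂⟩, hmin⟩ := hlsc.exists_isMinOn hne
    ((isCompact_unitMeasures hE).prod (isCompact_unitMeasures hF))
  simp only [Set.mem_ofPred_eq] at hl₁ hl₂
  have hΦl : Φ (l₁, l₂) ≠ ⊤ := by
    have h3 : Φ (l₁, l₂) ≤ energyDist τ₁ τ₂ + (3 * gaussPosEnergy R τ₂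
        + 4 * ∫⁻ z, ENNReal.ofReal (ψ z) ∂τ₂) :=
      isMinOn_iff.1 hmin ((⟨τ₁, hτ₁.1⟩, ⟨τ₂, hτ₂.1⟩) :
        ProbabilityMeasure ℂ × ProbabilityMeasure ℂ) ⟨hτ₁, hτ₂⟩
    refine ne_top_of_le_ne_top ?_ h3
    rw [key τ₁ hτ₁ τ₂ hτ₂ h₁ h₂]
    exact ENNReal.ofReal_ne_top
  simp only [hΦ, ENNReal.add_ne_top] at hΦl
  have f2 : FiniteEnergy (l₂ : Measure ℂ) l₂ := by
    have hR2 := hR _ (hFm _ hl₂) _ (hFm _ hl₂)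
    refine finiteEnergy_of_posEnergy hR0 hR2 fun htop => hΦl.2.1 ?_
    rw [gaussPosEnergy, ← posEnergy_eq hR2, htop]
    simp
  -- The functional contains no energy of the first measure alone; it is controlled through its
  -- distance from the second, whose energy is already finite.
  have f1 : FiniteEnergy (l₁ : Measure ℂ) l₁ :=
    FiniteEnergy.of_energyDist hR0 (hR _ (hEm _ hl₁) _ (hEm _ hl₁)) (hR _ (hFm _ hl₂) _ (hFm _ hl₂))
      hΦl.1 f2
  refine ⟨l₁, hl₁, l₂, hl₂, f1, f2, fun μ hμ ν hν g1 g2 => ?_⟩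
  have h3 : energyDist l₁ l₂ + (3 * gaussPosEnergy R l₂
      + 4 * ∫⁻ z, ENNReal.ofReal (ψ z) ∂(l₂ : Measure ℂ)) ≤ energyDist μ ν + (3 * gaussPosEnergy R ν
        + 4 * ∫⁻ z, ENNReal.ofReal (ψ z) ∂ν) :=
    isMinOn_iff.1 hmin ((⟨μ, hμ.1⟩, ⟨ν, hν.1⟩) :
      ProbabilityMeasure ℂ × ProbabilityMeasure ℂ) ⟨hμ, hν⟩
  rw [key _ hl₁ _ hl₂ f1 f2, key μ hμ ν hν g1 g2,
    ENNReal.ofReal_le_ofReal_iff (key2 μ hμ ν hν g1 g2)] at h3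
  linarith

/-- Strict convexity: a minimizer among pairs of finite energy is unique. -/
theorem realVectorEnergy_minimizer_unique (hE : IsCompact E) (hF : IsCompact F) (hψ : Continuous ψ)
    {μ₁ μ₂ ν₁ ν₂ : Measure ℂ} (hμ₁ : μ₁ ∈ unitMeasures E) (hμ₂ : μ₂ ∈ unitMeasures F)
    (hν₁ : ν₁ ∈ unitMeasures E) (hν₂ : ν₂ ∈ unitMeasures F) (f₁ : FiniteEnergy μ₁ μ₁)
    (f₂ : FiniteEnergy μ₂ μ₂) (g₁ : FiniteEnergy ν₁ ν₁) (g₂ : FiniteEnergy ν₂ ν₂)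
    (heq : realVectorEnergy ψ μ₁ μ₂ = realVectorEnergy ψ ν₁ ν₂)
    (hmin : ∀ μ ∈ unitMeasures E, ∀ ν ∈ unitMeasures F, FiniteEnergy μ μ →
        FiniteEnergy ν ν → realVectorEnergy ψ ν₁ ν₂ ≤ realVectorEnergy ψ μ ν) :
    μ₁ = ν₁ ∧ μ₂ = ν₂ := by
  have hK := hE.union hF
  have hEm : ∀ μ ∈ unitMeasures E, μ ∈ unitMeasures (E ∪ F) :=
    unitMeasures_mono Set.subset_union_left
  have hFm : ∀ μ ∈ unitMeasures F, μ ∈ unitMeasures (E ∪ F) :=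
    unitMeasures_mono Set.subset_union_right
  have := hμ₁.1
  have := hμ₂.1
  have := hν₁.1
  have := hν₂.1
  have hab : (1 / 2 : ℝ≥0) + 1 / 2 = 1 := by norm_num
  have m12 := finiteEnergy_mutual hK (hEm _ hμ₁) (hFm _ hμ₂) f₁ f₂
  have n12 := finiteEnergy_mutual hK (hEm _ hν₁) (hFm _ hν₂) g₁ g₂
  have mn11 := finiteEnergy_mutual hK (hEm _ hμ₁) (hEm _ hν₁) f₁ g₁
  have mn22 := finiteEnergy_mutual hK (hFm _ hμ₂) (hFm _ hν₂) f₂ g₂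
  have mn12 := finiteEnergy_mutual hK (hEm _ hμ₁) (hFm _ hν₂) f₁ g₂
  have nm12 := finiteEnergy_mutual hK (hEm _ hν₁) (hFm _ hμ₂) g₁ f₂
  obtain ⟨a1, a2⟩ := realEnergy_mix_self f₁ g₁ mn11 (1 / 2) (1 / 2)
  obtain ⟨b1, b2⟩ := realEnergy_mix_self f₂ g₂ mn22 (1 / 2) (1 / 2)
  have hA := mix_mem_unitMeasures hμ₁ hν₁ hab
  have hB := mix_mem_unitMeasures hμ₂ hν₂ hab
  have hle := hmin _ hA _ hB a1 b1
  have ab : realEnergy ((1 / 2 : ℝ≥0) • μ₁ + (1 / 2 : ℝ≥0) • ν₁)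
      ((1 / 2 : ℝ≥0) • μ₂ + (1 / 2 : ℝ≥0) • ν₂) = 1 / 4 * (realEnergy μ₁ μ₂ + realEnergy μ₁ ν₂
        + realEnergy ν₁ μ₂ + realEnergy ν₁ ν₂) := by
    rw [realEnergy_mix_left (m12.mix_right mn12 _ _) (nm12.mix_right n12 _ _),
      realEnergy_mix_right m12 mn12, realEnergy_mix_right nm12 n12]
    push_cast
    ring
  have iψ : ∫ z, ψ z ∂((1 / 2 : ℝ≥0) • μ₂ + (1 / 2 : ℝ≥0) • ν₂)
      = 1 / 2 * ∫ z, ψ z ∂μ₂ + 1 / 2 * ∫ z, ψ z ∂ν₂ := by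
    have i1 : Integrable ψ μ₂ := integrable_of_continuous_of_isCompact hF hμ₂.2 hψ
    have i2 : Integrable ψ ν₂ := integrable_of_continuous_of_isCompact hF hν₂.2 hψ
    rw [integral_add_measure i1.smul_measure_nnreal i2.smul_measure_nnreal,
      integral_smul_nnreal_measure, integral_smul_nnreal_measure]
    simp [NNReal.smul_def]
  obtain ⟨c1, c2⟩ := realEnergy_mix_self f₁ g₂ mn12 (1 / 2) (1 / 2)
  obtain ⟨d1, d2⟩ := realEnergy_mix_self g₁ f₂ nm12 (1 / 2) (1 / 2)
  -- The quadratic form at the difference of the two pairs contains the energy of `(μ₁ - ν₁) - (μ₂ -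
  -- ν₂)`, which is twice the difference of the unit measures `(μ₁ + ν₂) / 2` and `(ν₁ + μ₂) / 2`.
  -- Positivity on differences of unit measures therefore suffices.
  have hP := mix_mem_unitMeasures (hEm _ hμ₁) (hFm _ hν₂) hab
  have hQ := mix_mem_unitMeasures (hEm _ hν₁) (hFm _ hμ₂) hab
  have hPQ := realEnergy_sub_nonneg hK hP hQ c1 d1
  have hPQ0 := eq_of_realEnergy_sub hK hP hQ c1 d1
  have cd : realEnergy ((1 / 2 : ℝ≥0) • μ₁ + (1 / 2 : ℝ≥0) • ν₂)
      ((1 / 2 : ℝ≥0) • ν₁ + (1 / 2 : ℝ≥0) • μ₂) = 1 / 4 * (realEnergy μ₁ ν₁ + realEnergy μ₁ μ₂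
        + realEnergy ν₁ ν₂ + realEnergy μ₂ ν₂) := by
    rw [realEnergy_mix_left (mn11.mix_right m12 _ _) (n12.symm.mix_right mn22.symm _ _),
      realEnergy_mix_right mn11 m12, realEnergy_mix_right n12.symm mn22.symm,
      realEnergy_comm (μ := ν₂) (ν := ν₁), realEnergy_comm (μ := ν₂) (ν := μ₂)]
    push_cast
    ring
  have h22 := realEnergy_sub_nonneg hK (hFm _ hμ₂) (hFm _ hν₂) f₂ g₂
  have h220 := eq_of_realEnergy_sub hK (hFm _ hμ₂) (hFm _ hν₂) f₂ g₂
  simp only [realVectorEnergy, a2, b2, ab, iψ] at hle heq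
  rw [c2, d2, cd] at hPQ hPQ0
  push_cast at hle hPQ hPQ0
  -- Minimality at the midpoint makes the sum of two nonnegative energies nonpositive, so both
  -- vanish.
  have z22 : realEnergy μ₂ μ₂ + realEnergy ν₂ ν₂ - 2 * realEnergy μ₂ ν₂ = 0 := by linarith
  have e2 := h220 z22
  refine ⟨?_, e2⟩
  have ePQ := hPQ0 (by linarith)
  rw [e2] at ePQ
  exact eq_of_half_smul_add_eq ePQ

end

/-! ### The principle of domination -/

section
variable {μ : Measure ℂ} [IsFiniteMeasure μ] {K : Set ℂ}

theorem isSubmeanAt_truncPot (hK : IsCompact K) (h : μ Kᶜ = 0) (n : ℕ) (z : ℂ) :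
    IsSubmeanAt (truncPot n μ) z :=
  ⟨1, one_pos, fun _ h0 _ => truncPot_le_circleAverage hK h n z h0⟩

theorem circleAverage_neg (f : ℂ → ℝ) (z : ℂ) (r : ℝ) :
    Real.circleAverage (fun x => -f x) z r = -Real.circleAverage f z r := by
  simp [Real.circleAverage_def]

theorem isSubmeanAt_neg_logPot (hK : IsCompact K) (h : μ Kᶜ = 0) {z : ℂ} (hz : z ∉ K) :
    IsSubmeanAt (fun x => -logPot μ x) z := by
  obtain ⟨ε, hε, hsub⟩ := Metric.isOpen_iff.1 hK.isClosed.isOpen_compl z hz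
  refine ⟨ε, hε, fun r h0 hr => ?_⟩
  have hd : Disjoint (Metric.closedBall z r) K :=
    Set.disjoint_left.2 fun x hx => hsub (Metric.closedBall_subset_ball hr hx)
  rw [circleAverage_neg, circleAverage_logPot hK h h0 hd]

theorem measurable_logPot : Measurable (logPot μ) := by
  refine (StronglyMeasurable.integral_prod_right
    (f := fun (z ζ : ℂ) => Real.log ‖z - ζ‖) ?_).measurable
  exact Measurable.stronglyMeasurable (by unfold Function.uncurry; fun_prop)

/-- Off a compact carrier, the logarithm of the distance is bounded. -/
theorem exists_abs_log_le (hK : IsCompact K) {z : ℂ} (hz : z ∉ K) :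
    ∃ C, 0 ≤ C ∧ ∀ ζ ∈ K, |Real.log ‖z - ζ‖| ≤ C := by
  have hc : ContinuousOn (fun ζ => Real.log ‖z - ζ‖) K := by
    refine ContinuousOn.log (by fun_prop) fun ζ hζ => ?_
    rw [norm_ne_zero_iff, sub_ne_zero]
    exact fun h => hz (h ▸ hζ)
  obtain ⟨C, hC⟩ := hK.exists_bound_of_continuousOn hc
  exact ⟨max C 0, le_max_right _ _, fun ζ hζ => (hC ζ hζ).trans (le_max_left _ _)⟩

theorem integrable_log_of_notMem (hK : IsCompact K) (h : μ Kᶜ = 0) {z : ℂ} (hz : z ∉ K) :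
    Integrable (fun ζ => Real.log ‖z - ζ‖) μ := by
  obtain ⟨C, -, hC⟩ := exists_abs_log_le hK hz
  refine Integrable.mono' (integrable_const C) (Measurable.aestronglyMeasurable (by fun_prop)) ?_
  filter_upwards [ae_iff.2 h] with ζ hζ using hC ζ hζ

theorem exists_log_norm_sub_le (hK : IsCompact K) :
    ∃ C, 0 ≤ C ∧ ∀ z ∈ K, ∀ ζ ∈ K, Real.log ‖z - ζ‖ ≤ C := by
  obtain ⟨ρ, hρ⟩ := hK.isBounded.exists_norm_le
  refine ⟨max (2 * ρ) 0, le_max_right _ _, fun z hz ζ hζ => ?_⟩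
  refine (Real.log_le_self (norm_nonneg _)).trans ((norm_sub_le _ _).trans ?_)
  exact le_max_of_le_left (by linarith [hρ z hz, hρ ζ hζ])

theorem logPot_ge_of_large {ρ : ℝ} (hK : IsCompact K) (h : μ Kᶜ = 0) (hρ : ∀ ζ ∈ K, ‖ζ‖ ≤ ρ) {z : ℂ}
    (hz : 2 * ρ ≤ ‖z‖) (hz2 : 2 ≤ ‖z‖) :
    μ.real Set.univ * (Real.log ‖z‖ - Real.log 2) ≤ logPot μ z := by
  have hfar : ∀ ζ ∈ K, ‖z‖ / 2 ≤ ‖z - ζ‖ := fun ζ hζ => by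
    have := norm_sub_norm_le z ζ
    linarith [hρ ζ hζ]
  have hzK : z ∉ K := fun hzK => by
    have := hfar z hzK
    rw [sub_self, norm_zero] at this
    linarith
  have h1 : μ.real Set.univ * (Real.log ‖z‖ - Real.log 2)
      = ∫ _, (Real.log ‖z‖ - Real.log 2) ∂μ := by rw [integral_const, smul_eq_mul]
  rw [h1]
  refine integral_mono_ae (integrable_const _) (integrable_log_of_notMem hK h hzK) ?_
  filter_upwards [ae_iff.2 h] with ζ hζ
  rw [← Real.log_div (by linarith) two_ne_zero]
  exact Real.log_le_log (by linarith) (hfar ζ hζ)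

theorem truncPot_le_of_large {ρ : ℝ} (hK : IsCompact K) (h : μ Kᶜ = 0) (hρ : ∀ ζ ∈ K, ‖ζ‖ ≤ ρ)
    (n : ℕ) {z : ℂ} (hz : 2 * ρ ≤ ‖z‖) (hz2 : 2 ≤ ‖z‖) :
    truncPot n μ z ≤ μ.real Set.univ * (Real.log ‖z‖ + Real.log 2) := by
  have h1 : μ.real Set.univ * (Real.log ‖z‖ + Real.log 2)
      = ∫ _, (Real.log ‖z‖ + Real.log 2) ∂μ := by rw [integral_const, smul_eq_mul]
  rw [h1]
  refine integral_mono_ae (integrable_truncLog hK h n z) (integrable_const _) ?_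
  filter_upwards [ae_iff.2 h] with ζ hζ
  rw [← Real.log_mul (by linarith) two_ne_zero]
  refine Real.log_le_log (max_exp_pos n _) (max_le ?_ ?_)
  · have := norm_sub_le z ζ
    linarith [hρ ζ hζ]
  · have : Real.exp (-(n : ℝ)) ≤ 1 := Real.exp_le_one_iff.2 (by simp)
    linarith

end

/-! ### Compact sets with uniformly convergent potentials -/

/-- Compact sets on which the potentials of `lam` and `ν` are uniform limits of their truncations,
and `-c * logPot lam + logPot ν + ψ` is equal to `w`. -/
structure IsGoodCompact (lam ν : Measure ℂ) (ψ : ℂ → ℝ) (c w : ℝ) (G : Set ℂ) : Prop where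
  isCompact : IsCompact G
  subset : G ⊆ lam.support
  integrable : ∀ z ∈ G, Integrable (fun ζ => Real.log ‖z - ζ‖) lam
  eq : ∀ z ∈ G, -c * logPot lam z + logPot ν z + ψ z = w
  unif_left : TendstoUniformlyOn (fun n => truncPot n lam) (logPot lam) atTop G
  unif_right : TendstoUniformlyOn (fun n => truncPot n ν) (logPot ν) atTop G

section
variable {lam ν : Measure ℂ} {ψ : ℂ → ℝ} {c w : ℝ} {G G' : Set ℂ}

theorem TendstoUniformlyOn.union_set {f : ℕ → ℂ → ℝ} {g : ℂ → ℝ}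
    (h : TendstoUniformlyOn f g atTop G) (h' : TendstoUniformlyOn f g atTop G') :
    TendstoUniformlyOn f g atTop (G ∪ G') := by
  intro u hu
  filter_upwards [h u hu, h' u hu] with n h1 h2 x hx
  exact hx.elim (h1 x) (h2 x)

theorem IsGoodCompact.union (h : IsGoodCompact lam ν ψ c w G) (h' : IsGoodCompact lam ν ψ c w G') :
    IsGoodCompact lam ν ψ c w (G ∪ G') where
  isCompact := h.isCompact.union h'.isCompact
  subset := Set.union_subset h.subset h'.subset
  integrable z hz := hz.elim (h.integrable z) (h'.integrable z)
  eq z hz := hz.elim (h.eq z) (h'.eq z)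
  unif_left := h.unif_left.union_set h'.unif_left
  unif_right := h.unif_right.union_set h'.unif_right

variable [IsProbabilityMeasure lam] [IsProbabilityMeasure ν] {K L : Set ℂ}

/-- Egorov's theorem for the two truncated potentials, then inner regularity after the exceptional
null set is removed; each of these three losses is at most `δ / 3`. -/
theorem exists_isGoodCompact (hK : IsCompact K) (hlam : lam Kᶜ = 0) (hL : IsCompact L)
    (hν : ν Lᶜ = 0) (h11 : FiniteEnergy lam lam) (h12 : FiniteEnergy lam ν)
    (h22 : FiniteEnergy ν ν) (hw : ∀ᵐ z ∂lam, -c * logPot lam z + logPot ν z + ψ z = w) {δ : ℝ}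
    (hδ : 0 < δ) : ∃ G, IsGoodCompact lam ν ψ c w G ∧ lam.real Gᶜ ≤ δ := by
  have hc1 : ∀ n, StronglyMeasurable (truncPot n lam) := fun n =>
    (continuous_truncPot hK hlam n).stronglyMeasurable
  have hc2 : ∀ n, StronglyMeasurable (truncPot n ν) := fun n =>
    (continuous_truncPot hL hν n).stronglyMeasurable
  obtain ⟨t₁, ht₁, hm₁, hu₁⟩ := tendstoUniformlyOn_of_ae_tendsto' hc1
    measurable_logPot.stronglyMeasurable (μ := lam)
    (h11.ae_integrable.mono fun z hz => tendsto_truncPot hz (h11.measure_singleton z))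
    (by positivity : 0 < δ / 3)
  obtain ⟨t₂, ht₂, hm₂, hu₂⟩ := tendstoUniformlyOn_of_ae_tendsto' hc2
    measurable_logPot.stronglyMeasurable (μ := lam)
    (h12.ae_integrable.mono fun z hz => tendsto_truncPot hz (h22.measure_singleton z))
    (by positivity : 0 < δ / 3)
  have hae := (h11.ae_integrable.and hw).and (Measure.support_mem_ae (μ := lam))
  set B := toMeasurable lam {z | ¬ ((Integrable (fun ζ => Real.log ‖z - ζ‖) lam ∧
    -c * logPot lam z + logPot ν z + ψ z = w) ∧ z ∈ lam.support)} with hB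
  have hB0 : lam B = 0 := by
    rw [hB, measure_toMeasurable]
    exact hae
  have hmeas : MeasurableSet (t₁ ∪ t₂ ∪ B)ᶜ :=
    ((ht₁.union ht₂).union (measurableSet_toMeasurable _ _)).compl
  obtain ⟨G, hGsub, hG, hlt⟩ := hmeas.exists_isCompact_sdiff_lt (μ := lam) (measure_ne_top _ _)
    (ε := ENNReal.ofReal (δ / 3)) (by simpa using hδ)
  have hG1 : G ⊆ t₁ᶜ := fun z hz h => hGsub hz (Or.inl (Or.inl h))
  have hG2 : G ⊆ t₂ᶜ := fun z hz h => hGsub hz (Or.inl (Or.inr h))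
  have hG3 : ∀ z ∈ G, (Integrable (fun ζ => Real.log ‖z - ζ‖) lam ∧
    -c * logPot lam z + logPot ν z + ψ z = w) ∧ z ∈ lam.support := fun z hz => by
    by_contra h
    exact hGsub hz (Or.inr (subset_toMeasurable _ _ h))
  refine ⟨G, ⟨hG, fun z hz => (hG3 z hz).2, fun z hz => (hG3 z hz).1.1,
    fun z hz => (hG3 z hz).1.2, hu₁.mono hG1, hu₂.mono hG2⟩, ?_⟩
  have hcov : Gᶜ ⊆ (t₁ ∪ t₂ ∪ B) ∪ ((t₁ ∪ t₂ ∪ B)ᶜ \ G) := by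
    intro z hz
    by_cases h : z ∈ t₁ ∪ t₂ ∪ B
    · exact Or.inl h
    · exact Or.inr ⟨h, hz⟩
  have hle : lam Gᶜ ≤ ENNReal.ofReal δ := by
    calc lam Gᶜ ≤ (lam t₁ + lam t₂ + lam B) + lam ((t₁ ∪ t₂ ∪ B)ᶜ \ G) :=
          (measure_mono hcov).trans ((measure_union_le _ _).trans (add_le_add_left
            ((measure_union_le _ _).trans (add_le_add_left (measure_union_le _ _) _)) _))
      _ ≤ (ENNReal.ofReal (δ / 3) + ENNReal.ofReal (δ / 3) + 0) + ENNReal.ofReal (δ / 3) := by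
          gcongr
          exact hB0.le
      _ = ENNReal.ofReal δ := by
          rw [add_zero, ← ENNReal.ofReal_add (by positivity) (by positivity),
            ← ENNReal.ofReal_add (by positivity) (by positivity)]
          congr 1
          ring
  exact ENNReal.toReal_le_of_le_ofReal hδ.le hle

/-- Uniform smallness of the tails of the potential of the restriction to a good compact. -/
theorem IsGoodCompact.abs_truncPot_sub_le (hK : IsCompact K) (hlam : lam Kᶜ = 0)
    (h11 : FiniteEnergy lam lam) (hG : IsGoodCompact lam ν ψ c w G) {ε : ℝ} (hε : 0 < ε) :
    ∃ N : ℕ, ∀ n ≥ N, ∀ z, |truncPot n (lam.restrict G) z - logPot (lam.restrict G) z| ≤ ε := by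
  rcases G.eq_empty_or_nonempty with rfl | hne
  · exact ⟨0, fun n _ z => by simp [truncPot, logPot, hε.le]⟩
  obtain ⟨N, hN⟩ := eventually_atTop.1 (Metric.tendstoUniformlyOn_iff.1 hG.unif_left ε hε)
  refine ⟨N + 1, fun n hn z => ?_⟩
  obtain ⟨m, rfl⟩ : ∃ m, n = m + 1 := ⟨n - 1, by omega⟩
  -- Compare `z` with a nearest point `y` of `G`: for `ζ ∈ G` one has `‖y - ζ‖ ≤ 2 ‖z - ζ‖`. Since
  -- `log 2 ≤ 1`, the factor two costs one truncation level, which is why level `m + 1` at `z` is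
  -- controlled by level `m` at `y`.
  obtain ⟨y, hy, hdist⟩ := hG.isCompact.exists_infDist_eq_dist hne z
  have hi := hG.integrable y hy
  have hna : ∀ x : ℂ, ∀ᵐ ζ ∂lam, x ≠ ζ := fun x => by
    rw [ae_iff]
    refine measure_mono_null (fun ζ hζ => ?_) (h11.measure_singleton x)
    simpa [eq_comm] using hζ
  have htail : Integrable (fun ζ => truncLog m y ζ - Real.log ‖y - ζ‖) lam :=
    (integrable_truncLog hK hlam m y).sub hi
  have hpt : ∀ᵐ ζ ∂(lam.restrict G), 0 ≤ truncLog (m + 1) z ζ - Real.log ‖z - ζ‖ ∧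
      truncLog (m + 1) z ζ - Real.log ‖z - ζ‖ ≤ truncLog m y ζ - Real.log ‖y - ζ‖ := by
    filter_upwards [ae_restrict_mem hG.isCompact.measurableSet, ae_restrict_of_ae (hna z),
      ae_restrict_of_ae (hna y)] with ζ hζ h1 h2
    have h3 : ‖y - ζ‖ ≤ 2 * ‖z - ζ‖ := by
      have h4 : dist z y ≤ dist z ζ := hdist ▸ Metric.infDist_le_dist_of_mem hζ
      have h5 := dist_triangle_left y ζ z
      rw [dist_eq_norm y ζ, dist_eq_norm z ζ] at h5
      rw [dist_eq_norm z ζ] at h4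
      linarith
    have h4 : Real.log ‖y - ζ‖ ≤ Real.log ‖z - ζ‖ + 1 := by
      have h0 : 0 < ‖z - ζ‖ := norm_pos_iff.2 (sub_ne_zero.2 h1)
      have := Real.log_le_log (norm_pos_iff.2 (sub_ne_zero.2 h2)) h3
      rw [Real.log_mul two_ne_zero h0.ne'] at this
      linarith [Real.log_two_lt_d9]
    refine ⟨sub_nonneg.2 (log_le_truncLog _ h1), ?_⟩
    rw [truncLog_eq _ h1, truncLog_eq _ h2, ← max_sub_sub_right, ← max_sub_sub_right]
    push_cast
    refine max_le_max (by simp) (by linarith)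
  have hlamG : (lam.restrict G) Kᶜ = 0 := by
    rw [Measure.restrict_apply hK.measurableSet.compl]
    exact measure_mono_null Set.inter_subset_left hlam
  have htz : Integrable (fun ζ => truncLog (m + 1) z ζ - Real.log ‖z - ζ‖) (lam.restrict G) := by
    refine Integrable.mono' htail.restrict ?_ ?_
    · exact ((continuous_truncLog_right _ z).measurable.sub (by fun_prop)).aestronglyMeasurable
    · filter_upwards [hpt] with ζ hζ
      rw [Real.norm_of_nonneg hζ.1]
      exact hζ.2
  have hiz : Integrable (fun ζ => Real.log ‖z - ζ‖) (lam.restrict G) := by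
    refine ((integrable_truncLog hK hlamG (m + 1) z).sub htz).congr
      (Eventually.of_forall fun ζ => ?_)
    simp
  have heq : truncPot (m + 1) (lam.restrict G) z - logPot (lam.restrict G) z
      = ∫ ζ in G, (truncLog (m + 1) z ζ - Real.log ‖z - ζ‖) ∂lam :=
    (integral_sub (integrable_truncLog hK hlamG (m + 1) z) hiz).symm
  rw [heq, abs_of_nonneg (integral_nonneg_of_ae (hpt.mono fun ζ h => h.1))]
  have hnn : 0 ≤ᵐ[lam] fun ζ => truncLog m y ζ - Real.log ‖y - ζ‖ :=
    (hna y).mono fun ζ h => sub_nonneg.2 (log_le_truncLog _ h)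
  calc ∫ ζ in G, (truncLog (m + 1) z ζ - Real.log ‖z - ζ‖) ∂lam
      ≤ ∫ ζ in G, (truncLog m y ζ - Real.log ‖y - ζ‖) ∂lam :=
        integral_mono_ae htz htail.restrict (hpt.mono fun ζ h => h.2)
    _ ≤ ∫ ζ, (truncLog m y ζ - Real.log ‖y - ζ‖) ∂lam := setIntegral_le_integral htail hnn
    _ = truncPot m lam y - logPot lam y := integral_sub (integrable_truncLog hK hlam m y) hi
    _ ≤ ε := by
        have := hN m (by omega) y hy
        rw [Real.dist_eq, abs_sub_comm] at this
        exact (le_abs_self _).trans this.le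

theorem restrict_compl_eq_zero (hG : IsCompact G) : (lam.restrict G) Gᶜ = 0 := by
  rw [Measure.restrict_apply hG.measurableSet.compl, Set.compl_inter_self, measure_empty]

/-- The tails are small uniformly on the whole plane, so the potential is a uniform limit of
continuous functions. -/
theorem IsGoodCompact.continuous_logPot (hK : IsCompact K) (hlam : lam Kᶜ = 0)
    (h11 : FiniteEnergy lam lam) (hG : IsGoodCompact lam ν ψ c w G) :
    Continuous (logPot (lam.restrict G)) := by
  have hu : TendstoUniformly (fun n => truncPot n (lam.restrict G)) (logPot (lam.restrict G))
      atTop := by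
    rw [Metric.tendstoUniformly_iff]
    intro ε hε
    obtain ⟨N, hN⟩ := hG.abs_truncPot_sub_le hK hlam h11 (half_pos hε)
    filter_upwards [eventually_ge_atTop N] with n hn z
    rw [Real.dist_eq, abs_sub_comm]
    linarith [hN n hn z]
  exact hu.continuous (Frequently.of_forall fun n =>
    continuous_truncPot hG.isCompact (restrict_compl_eq_zero hG.isCompact) n)

theorem IsGoodCompact.exists_neg_le_logPot (hK : IsCompact K) (hlam : lam Kᶜ = 0)
    (h11 : FiniteEnergy lam lam) (hG : IsGoodCompact lam ν ψ c w G) :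
    ∃ B, 0 ≤ B ∧ ∀ z, -B ≤ logPot (lam.restrict G) z := by
  obtain ⟨N, hN⟩ := hG.abs_truncPot_sub_le hK hlam h11 one_pos
  refine ⟨N + 1, by positivity, fun z => ?_⟩
  have h1 := abs_le.1 (hN N le_rfl z)
  have h2 : -(N : ℝ) ≤ truncPot N (lam.restrict G) z := by
    have h3 : ∫ _, -(N : ℝ) ∂(lam.restrict G) ≤ truncPot N (lam.restrict G) z :=
      integral_mono (integrable_const _) (integrable_truncLog hG.isCompact
        (restrict_compl_eq_zero hG.isCompact) N z) fun ζ => neg_le_truncLog N z ζ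
    rw [integral_const, smul_eq_mul] at h3
    have h4 : (lam.restrict G).real Set.univ ≤ 1 := by
      rw [measureReal_restrict_apply_univ]
      exact measureReal_le_one
    have : (0 : ℝ) ≤ N := by positivity
    nlinarith
  linarith [h1.2]

end

section
variable {lam ν : Measure ℂ} {ψ : ℂ → ℝ} {c w : ℝ} {K L : Set ℂ}
  [IsProbabilityMeasure lam] [IsProbabilityMeasure ν]

/-- Splitting the potential over a good compact and its complement. -/
theorem logPot_eq_restrict_add {G : Set ℂ} (hG : MeasurableSet G) {z : ℂ}
    (hi : Integrable (fun ζ => Real.log ‖z - ζ‖) lam) :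
    logPot lam z = logPot (lam.restrict G) z + ∫ ζ in Gᶜ, Real.log ‖z - ζ‖ ∂lam :=
  (integral_add_compl hG hi).symm

theorem setIntegral_le_mul_measureReal {G : Set ℂ} {f : ℂ → ℝ} {C : ℝ}
    (hi : Integrable f lam) (h : ∀ᵐ ζ ∂lam, f ζ ≤ C) :
    ∫ ζ in G, f ζ ∂lam ≤ C * lam.real G := by
  have := integral_mono_ae hi.restrict (integrable_const C) (ae_restrict_of_ae (s := G) h)
  rwa [setIntegral_const, smul_eq_mul, mul_comm] at this

/-- Comparison of the potential of a restriction with the external field, from the maximum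
principle. -/
theorem IsGoodCompact.comparison (hK : IsCompact K) (hlam : lam Kᶜ = 0) (hL : IsCompact L)
    (hν : ν Lᶜ = 0) (h11 : FiniteEnergy lam lam)
    (hψ : Continuous ψ) (hsub : ∀ z, IsSubmeanAt ψ z) {C : ℝ}
    (hgrow : ∀ᶠ z in Bornology.cobounded ℂ, ψ z ≤ (c - 1) * Real.log ‖z‖ + C) (hc : 0 ≤ c)
    {G G₀ : Set ℂ} (hG : IsGoodCompact lam ν ψ c w G) (hG₀ : IsGoodCompact lam ν ψ c w G₀)
    (hsubset : G₀ ⊆ G) (hne : G.Nonempty) {θ : ℝ} (hθ : 0 ≤ θ)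
    (hmass : c < c * lam.real G + θ * lam.real G₀) {n : ℕ} {M : ℝ}
    (hM : ∀ z ∈ G, c * -logPot (lam.restrict G) z + θ * -logPot (lam.restrict G₀) z
      + truncPot n ν z + ψ z ≤ M) (z : ℂ) :
    c * -logPot (lam.restrict G) z + θ * -logPot (lam.restrict G₀) z
      + truncPot n ν z + ψ z ≤ M := by
  have c1 := hG.continuous_logPot hK hlam h11
  have c2 := hG₀.continuous_logPot hK hlam h11
  have c3 := continuous_truncPot hL hν n
  have r1 := restrict_compl_eq_zero (lam := lam) hG.isCompact
  have r2 := restrict_compl_eq_zero (lam := lam) hG₀.isCompact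
  refine le_of_isSubmeanAt_compl (H := fun z => c * -logPot (lam.restrict G) z
    + θ * -logPot (lam.restrict G₀) z + truncPot n ν z + ψ z) (by fun_prop) hG.isCompact hne hM
    (fun z hz => ?_) ?_ z
  · have s1 := (isSubmeanAt_neg_logPot hG.isCompact r1 hz).const_mul hc
    have s2 := (isSubmeanAt_neg_logPot hG₀.isCompact r2 fun h => hz (hsubset h)).const_mul hθ
    exact ((s1.add (by fun_prop) (by fun_prop) s2).add (by fun_prop) c3
      (isSubmeanAt_truncPot hL hν n z)).add (by fun_prop) hψ (hsub z)
  · obtain ⟨ρ₁, hρ₁⟩ := hG.isCompact.isBounded.exists_norm_le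
    obtain ⟨ρ₂, hρ₂⟩ := hL.isBounded.exists_norm_le
    -- The four terms grow like `-(κ + c) log ‖z‖`, `log ‖z‖` and at most `(c - 1) log ‖z‖` (the
    -- first two terms taken together), hence like `-κ log ‖z‖` at most. The extra mass `κ > 0`
    -- drives the function to `-∞`.
    set κ := c * lam.real G + θ * lam.real G₀ - c with hκ
    have hκ0 : 0 < κ := by linarith
    have hlog : Tendsto (fun z : ℂ => Real.log ‖z‖) (Bornology.cobounded ℂ) atTop :=
      Real.tendsto_log_atTop.comp tendsto_norm_cobounded_atTop
    have h1 : Tendsto (fun z : ℂ => ((κ + c + 1) * Real.log 2 + C) + -(κ * Real.log ‖z‖))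
        (Bornology.cobounded ℂ) atBot :=
      tendsto_const_nhds.add_atBot (tendsto_neg_atTop_atBot.comp (hlog.const_mul_atTop hκ0))
    refine tendsto_atBot_mono' _ ?_ h1
    filter_upwards [hgrow, tendsto_norm_cobounded_atTop.eventually_ge_atTop (2 * ρ₁),
      tendsto_norm_cobounded_atTop.eventually_ge_atTop (2 * ρ₂),
      tendsto_norm_cobounded_atTop.eventually_ge_atTop 2] with z g1 g2 g3 g4
    have e1 := logPot_ge_of_large hG.isCompact r1 hρ₁ g2 g4
    have e2 := logPot_ge_of_large hG₀.isCompact r2 (fun ζ hζ => hρ₁ ζ (hsubset hζ)) g2 g4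
    have e3 := truncPot_le_of_large hL hν hρ₂ n g3 g4
    rw [measureReal_restrict_apply_univ] at e1 e2
    rw [probReal_univ, one_mul] at e3
    have e4 := mul_le_mul_of_nonneg_left e1 hc
    have e5 := mul_le_mul_of_nonneg_left e2 hθ
    rw [← mul_assoc] at e4 e5
    have e6 : (c * lam.real G) * (Real.log ‖z‖ - Real.log 2)
        + (θ * lam.real G₀) * (Real.log ‖z‖ - Real.log 2)
        = (κ + c) * (Real.log ‖z‖ - Real.log 2) := by rw [hκ]; ring
    linarith

/-- The principle of domination: an equality which holds almost everywhere for `lam` gives an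
inequality off the support of `lam`. -/
theorem exists_truncPot_le (hK : IsCompact K) (hlam : lam Kᶜ = 0) (hL : IsCompact L)
    (hν : ν Lᶜ = 0) (h11 : FiniteEnergy lam lam) (h12 : FiniteEnergy lam ν)
    (h22 : FiniteEnergy ν ν) (hψ : Continuous ψ) (hsub : ∀ z, IsSubmeanAt ψ z) {C : ℝ}
    (hgrow : ∀ᶠ z in Bornology.cobounded ℂ, ψ z ≤ (c - 1) * Real.log ‖z‖ + C) (hc : 0 < c)
    (hw : ∀ᵐ z ∂lam, -c * logPot lam z + logPot ν z + ψ z = w) {z : ℂ} (hz : z ∉ lam.support)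
    {δ : ℝ} (hδ : 0 < δ) : ∃ n, -c * logPot lam z + truncPot n ν z + ψ z ≤ w + δ := by
  have hsupp : IsCompact lam.support := by
    refine hK.of_isClosed_subset Measure.isClosed_support
      (Measure.support_subset_of_isClosed hK.isClosed ?_)
    exact ae_iff.2 hlam
  have hsupp0 : lam lam.supportᶜ = 0 := Measure.measure_compl_support
  -- `G₀` is fixed before `η`: the lower bound `-B` of its potential must not depend on `η`. It will
  -- supply the mass lost outside `G`.
  obtain ⟨G₀, hG₀, hδ₀⟩ := exists_isGoodCompact (ψ := ψ) (c := c) (w := w) hK hlam hL hν h11 h12 h22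
    hw (by norm_num : (0 : ℝ) < 1 / 2)
  obtain ⟨B, hB0, hB⟩ := hG₀.exists_neg_le_logPot hK hlam h11
  obtain ⟨D, hD0, hD⟩ := exists_log_norm_sub_le hsupp
  obtain ⟨A, hA0, hA⟩ := exists_abs_log_le hsupp hz
  -- The denominator collects all errors: `c D + 4 c B + 1` from the estimate on `G` and `c A + 4 c
  -- A` from the return to the full potential at `z`.
  set η := δ / (c * D + 4 * c * B + 1 + c * A + 4 * c * A) with hη
  have hden : 0 < c * D + 4 * c * B + 1 + c * A + 4 * c * A := by positivity
  have hη0 : 0 < η := div_pos hδ hden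
  obtain ⟨G₁, hG₁, hδ₁⟩ := exists_isGoodCompact (ψ := ψ) (c := c) (w := w) hK hlam hL hν h11 h12 h22
    hw hη0
  have hG := hG₀.union hG₁
  set G := G₀ ∪ G₁ with hGdef
  have hGm : MeasurableSet G := hG.isCompact.measurableSet
  have hGc : lam.real Gᶜ ≤ η := (measureReal_mono (Set.compl_subset_compl.2
    Set.subset_union_right)).trans hδ₁
  have hmG : lam.real G = 1 - lam.real Gᶜ := by
    rw [probReal_compl_eq_one_sub hGm]; ring
  have hmG₀ : 1 / 2 ≤ lam.real G₀ := by
    rw [probReal_compl_eq_one_sub hG₀.isCompact.measurableSet] at hδ₀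
    linarith
  have hne : G.Nonempty := by
    by_contra h
    have h0 : G₀ = ∅ := Set.subset_eq_empty Set.subset_union_left (Set.not_nonempty_iff_eq_empty.1 h)
    rw [h0, measureReal_empty] at hmG₀
    linarith
  have hcη : 0 < c * η := mul_pos hc hη0
  -- At most `c η` is lost outside `G`, while `4 c η` times the mass of `G₀` restores at least `2 c
  -- η`.
  have hmass : c < c * lam.real G + (4 * c * η) * lam.real G₀ := by
    rw [hmG]
    have h1 := mul_le_mul_of_nonneg_left hGc hc.le
    have h2 := mul_le_mul_of_nonneg_left hmG₀ (by positivity : 0 ≤ 4 * c * η)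
    linarith
  obtain ⟨n, hn⟩ := (Metric.tendstoUniformlyOn_iff.1 hG.unif_right η hη0).exists
  have hM : ∀ x ∈ G, c * -logPot (lam.restrict G) x + (4 * c * η) * -logPot (lam.restrict G₀) x
      + truncPot n ν x + ψ x ≤ w + c * (D * η) + (4 * c * η) * B + η := by
    intro x hx
    have hi := hG.integrable x hx
    have e1 := logPot_eq_restrict_add hGm hi
    have e2 : ∫ ζ in Gᶜ, Real.log ‖x - ζ‖ ∂lam ≤ D * lam.real Gᶜ :=
      setIntegral_le_mul_measureReal hi ((ae_iff.2 hsupp0 : ∀ᵐ ζ ∂lam, ζ ∈ lam.support).mono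
        fun ζ hζ => hD x (hG.subset hx) ζ hζ)
    have e3 : D * lam.real Gᶜ ≤ D * η := mul_le_mul_of_nonneg_left hGc hD0
    have e4 := hG.eq x hx
    have e5 := hn x hx
    rw [Real.dist_eq, abs_sub_comm] at e5
    have e6 := (abs_lt.1 e5).2
    have e7 := mul_le_mul_of_nonneg_left (hB x) (by positivity : 0 ≤ 4 * c * η)
    have e8 := mul_le_mul_of_nonneg_left (e2.trans e3) hc.le
    rw [e1] at e4
    linarith
  have hfin := hG.comparison hK hlam hL hν h11 hψ hsub hgrow hc.le hG₀ Set.subset_union_left hne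
    (by positivity : 0 ≤ 4 * c * η) hmass hM z
  refine ⟨n, ?_⟩
  have hiz : Integrable (fun ζ => Real.log ‖z - ζ‖) lam := integrable_log_of_notMem hsupp hsupp0 hz
  have hAae : ∀ᵐ ζ ∂lam, |Real.log ‖z - ζ‖| ≤ A :=
    (ae_iff.2 hsupp0 : ∀ᵐ ζ ∂lam, ζ ∈ lam.support).mono fun ζ hζ => hA ζ hζ
  have e1 := logPot_eq_restrict_add hGm hiz
  have e2 : ∫ ζ in Gᶜ, -Real.log ‖z - ζ‖ ∂lam ≤ A * lam.real Gᶜ :=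
    setIntegral_le_mul_measureReal hiz.neg (hAae.mono fun ζ hζ => (neg_le_abs _).trans hζ)
  rw [integral_neg] at e2
  have e3 : A * lam.real Gᶜ ≤ A * η := mul_le_mul_of_nonneg_left hGc hA0
  have e4 : logPot (lam.restrict G₀) z ≤ A * lam.real G₀ :=
    setIntegral_le_mul_measureReal hiz (hAae.mono fun ζ hζ => (le_abs_self _).trans hζ)
  have e5 : A * lam.real G₀ ≤ A * 1 := mul_le_mul_of_nonneg_left measureReal_le_one hA0
  have e6 := mul_le_mul_of_nonneg_left (e4.trans e5) (by positivity : 0 ≤ 4 * c * η)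
  have e7 := mul_le_mul_of_nonneg_left (e2.trans e3) hc.le
  have e8 : η * (c * D + 4 * c * B + 1 + c * A + 4 * c * A) = δ := by
    rw [hη, div_mul_cancel₀ _ hden.ne']
  rw [e1]
  linarith

/-! ### The contact set -/

/-- The set, off the support of `lam`, where the field `-c * logPot lam + logPot ν + ψ` is at
least `w`. -/
def contactSet (lam ν : Measure ℂ) (ψ : ℂ → ℝ) (c w : ℝ) : Set ℂ :=
  {z | z ∉ lam.support ∧ ∀ n, w ≤ -c * logPot lam z + truncPot n ν z + ψ z}

/-- Failure of contact is witnessed by a single truncated field, which is continuous off the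
support; so the contact set is closed relative to the complement of the support. -/
theorem isOpen_compl_support_sdiff_contactSet (hK : IsCompact K) (hlam : lam Kᶜ = 0)
    (hL : IsCompact L) (hν : ν Lᶜ = 0) (hψ : Continuous ψ) :
    IsOpen (lam.supportᶜ \ contactSet lam ν ψ c w) := by
  have hsupp : IsCompact lam.support := by
    refine hK.of_isClosed_subset Measure.isClosed_support
      (Measure.support_subset_of_isClosed hK.isClosed ?_)
    exact ae_iff.2 hlam
  rw [isOpen_iff_mem_nhds]
  rintro z ⟨hz, hzE⟩
  obtain ⟨n, hn⟩ : ∃ n, -c * logPot lam z + truncPot n ν z + ψ z < w := by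
    by_contra! h
    exact hzE ⟨hz, h⟩
  have hcont : ContinuousAt (fun x => -c * logPot lam x + truncPot n ν x + ψ x) z :=
    ((continuousAt_const.mul (continuousAt_logPot hsupp Measure.measure_compl_support hz)).add
      (continuous_truncPot hL hν n).continuousAt).add hψ.continuousAt
  filter_upwards [hcont.eventually_lt continuousAt_const hn,
    Measure.isOpen_compl_support.mem_nhds hz] with x hx hx2
  exact ⟨hx2, fun hE => (hE.2 n).not_gt hx⟩

/-- On a circle around a contact point, all points are contact points; moreover `ν` has no mass
near a contact point. -/
theorem contactSet_propagation (hK : IsCompact K) (hlam : lam Kᶜ = 0)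
    (hL : IsCompact L) (hν : ν Lᶜ = 0) (hψ : Continuous ψ)
    (hdom : ∀ z ∉ lam.support, ∀ δ > 0, ∃ n, -c * logPot lam z + truncPot n ν z + ψ z ≤ w + δ)
    {z : ℂ} (hz : z ∈ contactSet lam ν ψ c w) {r : ℝ} (hr : 0 < r)
    (hψr : ψ z ≤ Real.circleAverage ψ z r)
    (hball : Disjoint (Metric.closedBall z r) lam.support) :
    (∀ y ∈ Metric.sphere z r, y ∈ contactSet lam ν ψ c w)
      ∧ ν.real (Metric.ball z (r / 2)) = 0 := by
  have hsupp : IsCompact lam.support := by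
    refine hK.of_isClosed_subset Measure.isClosed_support
      (Measure.support_subset_of_isClosed hK.isClosed ?_)
    exact ae_iff.2 hlam
  have hsupp0 : lam lam.supportᶜ = 0 := Measure.measure_compl_support
  have hout : ∀ y ∈ Metric.sphere z r, y ∉ lam.support := fun y hy =>
    Set.disjoint_left.1 hball (Metric.sphere_subset_closedBall hy)
  set f : ℕ → ℂ → ℝ := fun n x => -c * logPot lam x + truncPot n ν x + ψ x with hf
  have hat : ∀ n, ∀ y ∈ Metric.sphere z r, ContinuousAt (f n) y := fun n y hy =>
    ((continuousAt_const.mul (continuousAt_logPot hsupp hsupp0 (hout y hy))).add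
      (continuous_truncPot hL hν n).continuousAt).add hψ.continuousAt
  have hon : ∀ n, ContinuousOn (f n) (Metric.sphere z r) := fun n y hy =>
    (hat n y hy).continuousWithinAt
  have hci : ∀ n, CircleIntegrable (f n) z r := fun n =>
    ContinuousOn.circleIntegrable' (by rw [abs_of_pos hr]; exact hon n)
  have hanti : ∀ {n m : ℕ}, n ≤ m → ∀ x, f m x ≤ f n x := fun h x => by
    have := truncPot_anti hL hν h x
    simp only [hf]
    linarith
  -- Dini's argument on the circle: the continuous functions `f n` decrease with `n`, so the
  -- pointwise bounds from domination become uniform.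
  have hdini : ∀ δ > 0, ∃ N, ∀ y ∈ Metric.sphere z r, f N y ≤ w + δ := by
    intro δ hδ
    refine (isCompact_sphere z r).induction_on (p := fun s => ∃ N, ∀ y ∈ s, f N y ≤ w + δ)
      ⟨0, by simp⟩ ?_ ?_ ?_
    · rintro s t hst ⟨N, hN⟩
      exact ⟨N, fun y hy => hN y (hst hy)⟩
    · rintro s t ⟨N, hN⟩ ⟨N', hN'⟩
      refine ⟨max N N', fun y hy => hy.elim (fun h => ?_) fun h => ?_⟩
      · exact (hanti (le_max_left _ _) y).trans (hN y h)
      · exact (hanti (le_max_right _ _) y).trans (hN' y h)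
    · intro y hy
      obtain ⟨n, hn⟩ := hdom y (hout y hy) (δ / 2) (half_pos hδ)
      refine ⟨{x | f n x < w + δ}, mem_nhdsWithin_of_mem_nhds
        ((hat n y hy).eventually_lt continuousAt_const ?_), n, fun x hx => le_of_lt hx⟩
      exact hn.trans_lt (by linarith)
  obtain ⟨N₀, hN₀⟩ := exists_exp_neg_lt (half_pos hr)
  -- The `logPot lam` term is harmonic on the disc, `ψ` is submean, and mass of `ν` in the half disc
  -- adds a gain independent of `n`.
  have havg : ∀ n ≥ N₀, w + Real.log 2 * ν.real (Metric.ball z (r / 2))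
      ≤ Real.circleAverage (f n) z r := by
    intro n hn
    have h1 := truncPot_add_le_circleAverage hL hν z hr (hN₀ n hn)
    have h2 := circleAverage_logPot hsupp hsupp0 hr hball
    have i1 : CircleIntegrable (logPot lam) z r := ContinuousOn.circleIntegrable' (by
      rw [abs_of_pos hr]
      exact fun y hy => (continuousAt_logPot hsupp hsupp0 (hout y hy)).continuousWithinAt)
    have i2 : CircleIntegrable (truncPot n ν) z r :=
      (continuous_truncPot hL hν n).continuousOn.circleIntegrable'
    have i3 : CircleIntegrable ψ z r := hψ.continuousOn.circleIntegrable'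
    have i4 : CircleIntegrable ((-c) • logPot lam) z r := i1.const_smul
    have e : f n = ((-c) • logPot lam + truncPot n ν) + ψ := by
      ext x
      simp [hf]
    rw [e, Real.circleAverage_add (i4.add i2) i3, Real.circleAverage_add i4 i2,
      Real.circleAverage_smul, h2, smul_eq_mul]
    have h3 := hz.2 n
    linarith
  have hm : 0 ≤ ν.real (Metric.ball z (r / 2)) := measureReal_nonneg
  have hlog2 : 0 < Real.log 2 := Real.log_pos one_lt_two
  constructor
  · intro y hy
    refine ⟨hout y hy, fun n₀ => ?_⟩
    by_contra! hlt
    -- A dip below `w` lowers the average of `min (f n₀) w` to some `A < w`. For large `n`, `f n`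
    -- exceeds this minimum by at most `(w - A) / 2`, so its average stays below `w`, against
    -- `havg`.
    have hh : ContinuousOn (fun x => min (f n₀ x) w) (Metric.sphere z r) :=
      ContinuousOn.inf (hon n₀) continuousOn_const
    have hhi : CircleIntegrable (fun x => min (f n₀ x) w) z r :=
      ContinuousOn.circleIntegrable' (by rw [abs_of_pos hr]; exact hh)
    have hA := circleAverage_lt_of_exists_lt hh (fun x _ => min_le_right _ _) hy
      (min_lt_of_left_lt hlt)
    set A := Real.circleAverage (fun x => min (f n₀ x) w) z r with hAdef
    obtain ⟨N, hN⟩ := hdini ((w - A) / 2) (by linarith)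
    set n := max N (max n₀ N₀) with hn
    have hle : Real.circleAverage (f n) z r ≤ A + (w - A) / 2 := by
      have h1 := Real.circleAverage_add (c := z) (R := r) hhi
        (circleIntegrable_const ((w - A) / 2) z r)
      rw [Real.circleAverage_const] at h1
      rw [hAdef] at h1 ⊢
      rw [← h1]
      refine Real.circleAverage_mono (hci n) (hhi.add (circleIntegrable_const _ _ _)) fun x hx => ?_
      rw [abs_of_pos hr] at hx
      simp only [Pi.add_apply]
      rw [← min_add_add_right]
      refine le_min ?_ ?_
      · have := hanti ((le_max_left n₀ N₀).trans (le_max_right N _)) x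
        linarith
      · exact (hanti (le_max_left _ _) x).trans (hN x hx)
    have := havg n ((le_max_right n₀ N₀).trans (le_max_right N _))
    have := mul_nonneg hlog2.le hm
    linarith
  · by_contra hne
    have hpos : 0 < Real.log 2 * ν.real (Metric.ball z (r / 2)) :=
      mul_pos hlog2 (lt_of_le_of_ne hm (Ne.symm hne))
    obtain ⟨N, hN⟩ := hdini _ (half_pos hpos)
    have h1 := havg (max N N₀) (le_max_right _ _)
    have h2 := Real.circleAverage_mono_on_of_le_circle (hci (max N N₀)) fun x hx => by
      rw [abs_of_pos hr] at hx
      exact (hanti (le_max_left N N₀) x).trans (hN x hx)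
    linarith

/-- Contact spreads to all small circles around a contact point, which together with the centre fill
a disc. -/
theorem contactSet_isOpen_and_notMem_support (hK : IsCompact K) (hlam : lam Kᶜ = 0)
    (hL : IsCompact L) (hν : ν Lᶜ = 0) (hψ : Continuous ψ) (hsub : ∀ z, IsSubmeanAt ψ z)
    (hdom : ∀ z ∉ lam.support, ∀ δ > 0, ∃ n, -c * logPot lam z + truncPot n ν z + ψ z ≤ w + δ) :
    IsOpen (contactSet lam ν ψ c w) ∧ Disjoint (contactSet lam ν ψ c w) ν.support := by
  have key : ∀ z ∈ contactSet lam ν ψ c w, ∃ r₀ > 0, ∀ r, 0 < r → r < r₀ →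
      (∀ y ∈ Metric.sphere z r, y ∈ contactSet lam ν ψ c w)
      ∧ ν.real (Metric.ball z (r / 2)) = 0 := by
    intro z hz
    obtain ⟨ε, hε, hball⟩ := Metric.isOpen_iff.1 Measure.isOpen_compl_support z hz.1
    obtain ⟨r₁, hr₁, hψr⟩ := hsub z
    refine ⟨min ε r₁, lt_min hε hr₁, fun r h0 hr => ?_⟩
    refine contactSet_propagation hK hlam hL hν hψ hdom hz h0
      (hψr r h0 (hr.trans_le (min_le_right _ _))) ?_
    exact Set.disjoint_left.2 fun x hx =>
      hball (Metric.closedBall_subset_ball (hr.trans_le (min_le_left _ _)) hx)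
  constructor
  · rw [Metric.isOpen_iff]
    intro z hz
    obtain ⟨r₀, hr₀, H⟩ := key z hz
    refine ⟨r₀, hr₀, fun y hy => ?_⟩
    rcases eq_or_ne y z with rfl | hne
    · exact hz
    · exact (H (dist y z) (dist_pos.2 hne) hy).1 y rfl
  · refine Set.disjoint_left.2 fun z hz hzν => ?_
    obtain ⟨r₀, hr₀, H⟩ := key z hz
    have h1 := (H (r₀ / 2) (half_pos hr₀) (half_lt_self hr₀)).2
    have h2 := (Measure.mem_support_iff_forall z).1 hzν _
      (Metric.ball_mem_nhds z (by positivity : 0 < r₀ / 2 / 2))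
    rw [measureReal_eq_zero_iff] at h1
    exact h2.ne' h1

end

/-! ### Variational inequalities -/

theorem nonneg_of_forall_quadratic_nonneg {p q : ℝ}
    (h : ∀ t : ℝ, 0 < t → t ≤ 1 → 0 ≤ t * p + t ^ 2 * q) : 0 ≤ p := by
  by_contra! hp
  have hq : 0 < |q| + 1 := by positivity
  set t := min 1 (-p / (2 * (|q| + 1))) with ht
  have ht0 : 0 < t := lt_min one_pos (div_pos (by linarith) (by positivity))
  have h1 := h t ht0 (min_le_left _ _)
  have h2 : t * (2 * (|q| + 1)) ≤ -p := (le_div_iff₀ (by positivity)).1 (min_le_right _ _)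
  have h3 : 0 ≤ p + t * q := by
    have : 0 ≤ t * (p + t * q) := by linarith
    exact nonneg_of_mul_nonneg_right this ht0
  have h4 : t * q ≤ t * |q| := mul_le_mul_of_nonneg_left (le_abs_self q) ht0.le
  nlinarith

section
variable {E F : Set ℂ} {ψ : ℂ → ℝ} {lam₁ lam₂ τ : Measure ℂ}

/-- The energy at `(1 - t) lam₁ + t τ` is quadratic in `t` and minimal at `t = 0`, so its derivative
there is nonnegative. -/
theorem realVectorEnergy_variation_fst (hE : IsCompact E) (hF : IsCompact F)
    (h₁ : lam₁ ∈ unitMeasures E) (h₂ : lam₂ ∈ unitMeasures F) (f₁ : FiniteEnergy lam₁ lam₁)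
    (f₂ : FiniteEnergy lam₂ lam₂)
    (hmin : ∀ μ ∈ unitMeasures E, ∀ ν ∈ unitMeasures F, FiniteEnergy μ μ → FiniteEnergy ν ν →
      realVectorEnergy ψ lam₁ lam₂ ≤ realVectorEnergy ψ μ ν)
    (hτ : τ ∈ unitMeasures E) (fτ : FiniteEnergy τ τ) :
    realEnergy lam₁ lam₁ - realEnergy lam₁ lam₂ ≤ realEnergy τ lam₁ - realEnergy τ lam₂ := by
  have := h₁.1
  have := h₂.1
  have := hτ.1
  have hl := unitMeasures_mono (Set.subset_union_left (s := E) (t := F))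
  have hr := unitMeasures_mono (Set.subset_union_right (s := E) (t := F))
  have f1τ : FiniteEnergy lam₁ τ := finiteEnergy_mutual hE h₁ hτ f₁ fτ
  have f12 := finiteEnergy_mutual (hE.union hF) (hl h₁) (hr h₂) f₁ f₂
  have fτ2 := finiteEnergy_mutual (hE.union hF) (hl hτ) (hr h₂) fτ f₂
  suffices 0 ≤ 2 * (realEnergy τ lam₁ - realEnergy τ lam₂
      - (realEnergy lam₁ lam₁ - realEnergy lam₁ lam₂)) by linarith
  refine nonneg_of_forall_quadratic_nonneg
    (q := realEnergy lam₁ lam₁ - 2 * realEnergy lam₁ τ + realEnergy τ τ) fun t ht0 ht1 => ?_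
  set b : ℝ≥0 := ⟨t, ht0.le⟩ with hb
  set a : ℝ≥0 := ⟨1 - t, by linarith⟩ with ha
  have hab : a + b = 1 := NNReal.eq (show 1 - t + t = 1 by ring)
  obtain ⟨g1, g2⟩ := realEnergy_mix_self f₁ fτ f1τ a b
  have g3 := realEnergy_mix_left f12 fτ2 a b
  have := hmin _ (mix_mem_unitMeasures h₁ hτ hab) _ h₂ g1 f₂
  rw [realVectorEnergy, realVectorEnergy, g2, g3] at this
  have ea : (a : ℝ) = 1 - t := rfl
  have eb : (b : ℝ) = t := rfl
  rw [ea, eb] at this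
  rw [realEnergy_comm (μ := τ) (ν := lam₁)]
  linarith

theorem realVectorEnergy_variation_snd (hE : IsCompact E) (hF : IsCompact F) (hψ : Continuous ψ)
    (h₁ : lam₁ ∈ unitMeasures E) (h₂ : lam₂ ∈ unitMeasures F) (f₁ : FiniteEnergy lam₁ lam₁)
    (f₂ : FiniteEnergy lam₂ lam₂)
    (hmin : ∀ μ ∈ unitMeasures E, ∀ ν ∈ unitMeasures F, FiniteEnergy μ μ → FiniteEnergy ν ν →
      realVectorEnergy ψ lam₁ lam₂ ≤ realVectorEnergy ψ μ ν)
    (hτ : τ ∈ unitMeasures F) (fτ : FiniteEnergy τ τ) :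
    4 * realEnergy lam₂ lam₂ - realEnergy lam₂ lam₁ + ∫ z, ψ z ∂lam₂
      ≤ 4 * realEnergy τ lam₂ - realEnergy τ lam₁ + ∫ z, ψ z ∂τ := by
  have := h₁.1
  have := h₂.1
  have := hτ.1
  have hl := unitMeasures_mono (Set.subset_union_left (s := E) (t := F))
  have hr := unitMeasures_mono (Set.subset_union_right (s := E) (t := F))
  have f2τ : FiniteEnergy lam₂ τ := finiteEnergy_mutual hF h₂ hτ f₂ fτ
  have f12 := finiteEnergy_mutual (hE.union hF) (hl h₁) (hr h₂) f₁ f₂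
  have f1τ := finiteEnergy_mutual (hE.union hF) (hl h₁) (hr hτ) f₁ fτ
  suffices 0 ≤ 2 * (4 * realEnergy τ lam₂ - realEnergy τ lam₁ + ∫ z, ψ z ∂τ
      - (4 * realEnergy lam₂ lam₂ - realEnergy lam₂ lam₁ + ∫ z, ψ z ∂lam₂)) by linarith
  refine nonneg_of_forall_quadratic_nonneg
    (q := 4 * (realEnergy lam₂ lam₂ - 2 * realEnergy lam₂ τ + realEnergy τ τ))
    fun t ht0 ht1 => ?_
  set b : ℝ≥0 := ⟨t, ht0.le⟩ with hb
  set a : ℝ≥0 := ⟨1 - t, by linarith⟩ with ha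
  have hab : a + b = 1 := NNReal.eq (show 1 - t + t = 1 by ring)
  obtain ⟨g1, g2⟩ := realEnergy_mix_self f₂ fτ f2τ a b
  have g3 := realEnergy_mix_right f12 f1τ a b
  have hmem := mix_mem_unitMeasures h₂ hτ hab
  have := hmin _ h₁ _ hmem f₁ g1
  have i2 : Integrable ψ lam₂ := integrable_of_continuous_of_isCompact hF h₂.2 hψ
  have iτ : Integrable ψ τ := integrable_of_continuous_of_isCompact hF hτ.2 hψ
  rw [realVectorEnergy, realVectorEnergy, g2, g3,
    integral_add_measure i2.smul_measure_nnreal iτ.smul_measure_nnreal,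
    integral_smul_nnreal_measure, integral_smul_nnreal_measure, NNReal.smul_def, NNReal.smul_def,
    smul_eq_mul, smul_eq_mul] at this
  have ea : (a : ℝ) = 1 - t := rfl
  have eb : (b : ℝ) = t := rfl
  rw [ea, eb] at this
  rw [realEnergy_comm (μ := τ) (ν := lam₁), realEnergy_comm (μ := τ) (ν := lam₂),
    realEnergy_comm (μ := lam₂) (ν := lam₁)]
  linarith

end

section
variable {K L : Set ℂ} {ψ : ℂ → ℝ} {lam ν τ : Measure ℂ} {c : ℝ}

theorem FiniteEnergy.integral_field [IsProbabilityMeasure lam] [IsProbabilityMeasure ν]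
    [IsProbabilityMeasure τ] (h₁ : FiniteEnergy τ lam) (h₂ : FiniteEnergy τ ν)
    (hψ : Integrable ψ τ) : Integrable (fun z => -c * logPot lam z + logPot ν z + ψ z) τ ∧
      ∫ z, (-c * logPot lam z + logPot ν z + ψ z) ∂τ
        = c * realEnergy τ lam - realEnergy τ ν + ∫ z, ψ z ∂τ := by
  have i1 := h₁.integrable_logPot.const_mul (-c)
  have i2 := h₂.integrable_logPot
  have i12 : Integrable (fun z => -c * logPot lam z + logPot ν z) τ := i1.add i2
  refine ⟨i12.add hψ, ?_⟩
  rw [integral_add i12 hψ, integral_add i1 i2, integral_const_mul, h₁.integral_logPot,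
    h₂.integral_logPot]
  ring

/-- The field of a minimizer is constant almost everywhere. -/
theorem ae_field_eq (hK : IsCompact K) (hL : IsCompact L) (hlam : lam ∈ unitMeasures K)
    (hν : ν ∈ unitMeasures L) (f₁ : FiniteEnergy lam lam) (f₂ : FiniteEnergy ν ν)
    (hψ : Continuous ψ)
    (hvar : ∀ τ ∈ unitMeasures K, FiniteEnergy τ τ →
      c * realEnergy lam lam - realEnergy lam ν + ∫ z, ψ z ∂lam
        ≤ c * realEnergy τ lam - realEnergy τ ν + ∫ z, ψ z ∂τ) :
    ∀ᵐ z ∂lam, -c * logPot lam z + logPot ν z + ψ z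
      = c * realEnergy lam lam - realEnergy lam ν + ∫ z, ψ z ∂lam := by
  have := hlam.1
  have := hν.1
  have f12 : FiniteEnergy lam ν := finiteEnergy_mutual (hK.union hL)
    (unitMeasures_mono Set.subset_union_left hlam) (unitMeasures_mono Set.subset_union_right hν)
    f₁ f₂
  set w := c * realEnergy lam lam - realEnergy lam ν + ∫ z, ψ z ∂lam with hw
  set u : ℂ → ℝ := fun z => -c * logPot lam z + logPot ν z + ψ z with hu
  have hum : Measurable u := ((measurable_logPot.const_mul _).add measurable_logPot).add
    hψ.measurable
  obtain ⟨iu, eu⟩ := f₁.integral_field (c := c) f12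
    (integrable_of_continuous_of_isCompact hK hlam.2 hψ)
  have hle : ∀ᵐ z ∂lam, w ≤ u z := by
    set A := {z | u z < w} with hA
    have hAm : MeasurableSet A := measurableSet_lt hum measurable_const
    rw [ae_iff]
    have hA' : {z | ¬w ≤ u z} = A := by ext; simp [hA]
    rw [hA']
    by_contra hA0
    set b : ℝ≥0 := (lam A).toNNReal with hb
    have hb' : (b : ℝ≥0∞) = lam A := ENNReal.coe_toNNReal (measure_ne_top _ _)
    have hb0 : b ≠ 0 := fun h => hA0 (by rw [← hb', h]; simp)
    -- If the field were below `w` on a set of positive mass, the normalized restriction to this set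
    -- would violate the variational inequality. Hence `w ≤ u` almost everywhere, and `∫ u = w`
    -- forces equality.
    set τ : Measure ℂ := b⁻¹ • lam.restrict A with hτ
    have hτm : τ ∈ unitMeasures K := by
      refine ⟨⟨?_⟩, ?_⟩
      · rw [hτ, Measure.coe_nnreal_smul_apply, Measure.restrict_apply_univ, ← hb']
        rw [← ENNReal.coe_mul, inv_mul_cancel₀ hb0, ENNReal.coe_one]
      · rw [hτ, Measure.coe_nnreal_smul_apply,
          Measure.absolutelyContinuous_of_le Measure.restrict_le_self hlam.2, mul_zero]
    have := hτm.1
    have g1 : FiniteEnergy τ lam :=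
      (f₁.mono Measure.restrict_le_self le_rfl).smul_left _
    have g2 : FiniteEnergy τ ν :=
      (f12.mono Measure.restrict_le_self le_rfl).smul_left _
    have g3 : FiniteEnergy τ τ :=
      ((((f₁.mono (Measure.restrict_le_self (s := A)) (Measure.restrict_le_self (s := A))).smul_left
        b⁻¹).symm).smul_left b⁻¹)
    have e := (g1.integral_field (c := c) g2
      (integrable_of_continuous_of_isCompact hK hτm.2 hψ)).2
    have hv := hvar τ hτm g3
    rw [← e, hτ, integral_smul_nnreal_measure, NNReal.smul_def, smul_eq_mul] at hv
    have hbr : (0 : ℝ) < b := NNReal.coe_pos.2 (pos_iff_ne_zero.2 hb0)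
    have hv2 : w * b ≤ ∫ z in A, u z ∂lam := by
      have := mul_le_mul_of_nonneg_right hv hbr.le
      rwa [NNReal.coe_inv, mul_comm ((b : ℝ)⁻¹), mul_assoc, inv_mul_cancel₀ hbr.ne', mul_one]
        at this
    have hreal : lam.real A = b := by rw [hb]; rfl
    have h0 : ∫ z in A, (w - u z) ∂lam = 0 := by
      refine le_antisymm ?_ (setIntegral_nonneg hAm fun z hz => sub_nonneg.2 (le_of_lt hz))
      rw [integral_sub (integrable_const _) iu.restrict, setIntegral_const, hreal, smul_eq_mul]
      linarith
    rw [setIntegral_eq_zero_iff_of_nonneg_ae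
      (ae_restrict_of_forall_mem hAm fun z hz => sub_nonneg.2 (le_of_lt hz))
      ((integrable_const _).sub iu).integrableOn] at h0
    have h1 : ∀ᵐ z ∂(lam.restrict A), False := by
      filter_upwards [h0, ae_restrict_mem hAm] with z hz hzA
      have : u z < w := hzA
      simp only [Pi.zero_apply] at hz
      linarith
    rw [ae_iff] at h1
    simp at h1
    exact hA0 h1
  have h0 : ∫ z, (u z - w) ∂lam = 0 := by
    rw [integral_sub iu (integrable_const _), integral_const, probReal_univ, one_smul, eu]
    ring
  rw [integral_eq_zero_iff_of_nonneg_ae (hle.mono fun z hz => sub_nonneg.2 hz)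
    (iu.sub (integrable_const _))] at h0
  filter_upwards [h0] with z hz
  simp only [Pi.zero_apply] at hz
  linarith

/-- Without contact the field would be below `w` almost everywhere for `τ`, against the lower bound
for its integral. -/
theorem contactSet_nonempty (hK : IsCompact K) (hL : IsCompact L) (hlam : lam ∈ unitMeasures K)
    (hν : ν ∈ unitMeasures L) (f₁ : FiniteEnergy lam lam) (f₂ : FiniteEnergy ν ν)
    (hψ : Continuous ψ) {w : ℝ} (hτ : τ ∈ unitMeasures K) (fτ : FiniteEnergy τ τ)
    (hτ0 : τ lam.support = 0)
    (hvar : w ≤ c * realEnergy τ lam - realEnergy τ ν + ∫ z, ψ z ∂τ) :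
    (contactSet lam ν ψ c w).Nonempty := by
  have := hlam.1
  have := hν.1
  have := hτ.1
  by_contra hne
  rw [Set.not_nonempty_iff_eq_empty] at hne
  have g1 : FiniteEnergy τ lam := finiteEnergy_mutual hK hτ hlam fτ f₁
  have g2 : FiniteEnergy τ ν := finiteEnergy_mutual (hK.union hL)
    (unitMeasures_mono Set.subset_union_left hτ) (unitMeasures_mono Set.subset_union_right hν)
    fτ f₂
  obtain ⟨iu, eu⟩ := g1.integral_field (c := c) g2
    (integrable_of_continuous_of_isCompact hK hτ.2 hψ)
  have hlt : ∀ᵐ z ∂τ, -c * logPot lam z + logPot ν z + ψ z < w := by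
    filter_upwards [g2.ae_integrable, measure_eq_zero_iff_ae_notMem.1 hτ0] with z hz hzs
    have hzE : z ∉ contactSet lam ν ψ c w := by simp [hne]
    obtain ⟨n, hn⟩ : ∃ n, -c * logPot lam z + truncPot n ν z + ψ z < w := by
      by_contra! h
      exact hzE ⟨hzs, h⟩
    have : logPot ν z ≤ truncPot n ν z :=
      le_of_tendsto (tendsto_truncPot hz (f₂.measure_singleton z))
        ((eventually_ge_atTop n).mono fun m hm => truncPot_anti hL hν.2 hm z)
    linarith
  rw [← eu] at hvar
  have h0 : ∫ z, (w - (-c * logPot lam z + logPot ν z + ψ z)) ∂τ = 0 := by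
    refine le_antisymm ?_ (integral_nonneg_of_ae (hlt.mono fun z hz => sub_nonneg.2 hz.le))
    rw [integral_sub (integrable_const _) iu, integral_const, probReal_univ, one_smul]
    linarith
  rw [integral_eq_zero_iff_of_nonneg_ae (hlt.mono fun z hz => sub_nonneg.2 hz.le)
    ((integrable_const _).sub iu)] at h0
  have : ∀ᵐ z ∂τ, False := by
    filter_upwards [h0, hlt] with z h1 h2
    simp only [Pi.zero_apply] at h1
    linarith
  rw [ae_iff] at this
  simp at this

/-- If the compact carries a measure of finite energy off the support of the minimizer, there is a
nonempty open set off both supports that swallows the connected sets in the complement of the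
support which it meets. -/
theorem exists_isOpen_contact (hK : IsCompact K) (hL : IsCompact L) (hlam : lam ∈ unitMeasures K)
    (hν : ν ∈ unitMeasures L) (f₁ : FiniteEnergy lam lam) (f₂ : FiniteEnergy ν ν)
    (hψ : Continuous ψ) (hsub : ∀ z, IsSubmeanAt ψ z) {C : ℝ}
    (hgrow : ∀ᶠ z in Bornology.cobounded ℂ, ψ z ≤ (c - 1) * Real.log ‖z‖ + C) (hc : 0 < c)
    (hvar : ∀ τ ∈ unitMeasures K, FiniteEnergy τ τ →
      c * realEnergy lam lam - realEnergy lam ν + ∫ z, ψ z ∂lam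
        ≤ c * realEnergy τ lam - realEnergy τ ν + ∫ z, ψ z ∂τ)
    (hτ : τ ∈ unitMeasures K) (fτ : FiniteEnergy τ τ) (hτ0 : τ lam.support = 0) :
    ∃ U : Set ℂ, IsOpen U ∧ U.Nonempty ∧ Disjoint U ν.support ∧
      ∀ D : Set ℂ, IsPreconnected D → Disjoint D lam.support → (D ∩ U).Nonempty → D ⊆ U := by
  have := hlam.1
  have := hν.1
  have f12 : FiniteEnergy lam ν := finiteEnergy_mutual (hK.union hL)
    (unitMeasures_mono Set.subset_union_left hlam) (unitMeasures_mono Set.subset_union_right hν)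
    f₁ f₂
  set w := c * realEnergy lam lam - realEnergy lam ν + ∫ z, ψ z ∂lam with hw
  have hae := ae_field_eq hK hL hlam hν f₁ f₂ hψ hvar
  obtain ⟨h1, h2⟩ := contactSet_isOpen_and_notMem_support (lam := lam) (ν := ν) (c := c) (w := w)
    hK hlam.2 hL hν.2 hψ hsub fun z hz δ hδ =>
      exists_truncPot_le hK hlam.2 hL hν.2 f₁ f12 f₂ hψ hsub hgrow hc hae hz hδ
  refine ⟨_, h1, contactSet_nonempty hK hL hlam hν f₁ f₂ hψ hτ fτ hτ0 (hvar τ hτ fτ), h2,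
    fun D hD hdis hne => ?_⟩
  -- The contact set and its relative complement are disjoint open sets covering `D`, so the
  -- connected set `D` lies in the one it meets.
  refine hD.subset_left_of_subset_union h1
    (isOpen_compl_support_sdiff_contactSet (w := w) (c := c) hK hlam.2 hL hν.2 hψ)
    Set.disjoint_sdiff_right (fun z hz => ?_) hne
  by_cases hzU : z ∈ contactSet lam ν ψ c w
  · exact Or.inl hzU
  · exact Or.inr ⟨Set.disjoint_left.1 hdis hz, hzU⟩

end

/-! ### Jordan arcs -/

theorem isPreconnected_ball_sdiff_singleton (p : ℂ) (r : ℝ) :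
    IsPreconnected (Metric.ball p r \ {p}) := by
  have h : Metric.ball p r \ {p}
      = (fun x : ℝ × ℝ => circleMap p x.1 x.2) '' (Set.Ioo 0 r ×ˢ Set.univ) := by
    ext z
    simp only [Set.mem_sdiff, Metric.mem_ball, Set.mem_singleton_iff, Set.mem_image, Set.mem_prod,
      Set.mem_Ioo, Set.mem_univ, and_true, Prod.exists]
    constructor
    · rintro ⟨h1, h2⟩
      refine ⟨‖z - p‖, (z - p).arg, ⟨norm_pos_iff.2 (sub_ne_zero.2 h2), ?_⟩, ?_⟩
      · rwa [← dist_eq_norm]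
      · rw [circleMap, Complex.norm_mul_exp_arg_mul_I, add_sub_cancel]
    · rintro ⟨ρ, θ, ⟨h1, h2⟩, rfl⟩
      refine ⟨?_, circleMap_ne_center h1.ne'⟩
      rwa [Metric.mem_sphere.1 (circleMap_mem_sphere' p ρ θ), abs_of_pos h1]
  rw [h]
  refine (isPreconnected_Ioo.prod isPreconnected_univ).image _ (Continuous.continuousOn ?_)
  unfold circleMap
  fun_prop

section
variable {A : Set ℂ} {x y : ℂ}

theorem IsArc.isCompact (hA : IsArc A x y) : IsCompact A := by
  obtain ⟨γ, -, rfl⟩ := hA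
  exact isCompact_range γ.continuous

theorem IsArc.left_mem (hA : IsArc A x y) : x ∈ A := by
  obtain ⟨γ, -, rfl⟩ := hA
  exact ⟨0, γ.source⟩

theorem IsArc.exists_mem_ne (hA : IsArc A x y) : ∃ z ∈ A, z ≠ x ∧ z ≠ y := by
  obtain ⟨γ, hγ, rfl⟩ := hA
  set t : I := ⟨1 / 2, by norm_num, by norm_num⟩ with ht
  refine ⟨γ t, ⟨t, rfl⟩, fun h => ?_, fun h => ?_⟩
  · have := congrArg Subtype.val (hγ (h.trans γ.source.symm))
    norm_num [ht] at this
  · have := congrArg Subtype.val (hγ (h.trans γ.target.symm))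
    norm_num [ht] at this

/-- An interior parameter separates the interval, whereas the centre does not separate a disc: if
the arc contained a disc around `γ t`, the preimage of the punctured disc would be connected,
contain parameters on both sides of `t`, and miss `t`. -/
theorem IsArc.interior_eq_empty (hA : IsArc A x y) : interior A = ∅ := by
  obtain ⟨γ, hγ, rfl⟩ := hA
  by_contra hne
  obtain ⟨q, hq⟩ := Set.nonempty_iff_ne_empty.2 hne
  have hinf : (interior (Set.range γ)).Infinite := infinite_of_mem_nhds q (isOpen_interior.mem_nhds hq)
  obtain ⟨p, hp, hp2⟩ := hinf.exists_notMem_finite (Set.toFinite {x, y})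
  obtain ⟨r, hr, hball⟩ := Metric.mem_nhds_iff.1 (mem_interior_iff_mem_nhds.1 hp)
  obtain ⟨t, rfl⟩ := interior_subset hp
  have ht0 : 0 < t := lt_of_le_of_ne bot_le fun h => hp2 (by rw [← h, γ.source]; simp)
  have ht1 : t < 1 := lt_of_le_of_ne le_top fun h => hp2 (by rw [h, γ.target]; simp)
  have hind : IsInducing γ := (γ.continuous.isClosedEmbedding hγ).isInducing
  have hU : γ ⁻¹' Metric.ball (γ t) r ∈ 𝓝 t :=
    γ.continuous.continuousAt (Metric.ball_mem_nhds _ hr)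
  obtain ⟨l, u, htlu, hlu⟩ := (mem_nhds_iff_exists_Ioo_subset' ⟨0, ht0⟩ ⟨1, ht1⟩).1 hU
  obtain ⟨s, hls, hst⟩ := exists_between htlu.1
  obtain ⟨s', hts, hsu⟩ := exists_between htlu.2
  have hpre : IsPreconnected (γ ⁻¹' (Metric.ball (γ t) r \ {γ t})) := by
    rw [← hind.isPreconnected_image, Set.image_preimage_eq_of_subset (Set.sdiff_subset.trans hball)]
    exact isPreconnected_ball_sdiff_singleton _ _
  have h1 : s ∈ γ ⁻¹' (Metric.ball (γ t) r \ {γ t}) :=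
    ⟨hlu ⟨hls, hst.trans htlu.2⟩, fun h => hst.ne (hγ h)⟩
  have h2 : s' ∈ γ ⁻¹' (Metric.ball (γ t) r \ {γ t}) :=
    ⟨hlu ⟨htlu.1.trans hts, hsu⟩, fun h => hts.ne' (hγ h)⟩
  exact (hpre.Icc_subset h1 h2 ⟨hst.le, hts.le⟩).2 rfl

end

theorem interior_iUnion_eq_empty {X : Type*} [TopologicalSpace X] {n : ℕ} {A : Fin n → Set X}
    (hc : ∀ i, IsClosed (A i)) (hi : ∀ i, interior (A i) = ∅) : interior (⋃ i, A i) = ∅ := by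
  induction n with
  | zero => simp
  | succ n ih =>
    have h : ⋃ i, A i = A 0 ∪ ⋃ i : Fin n, A i.succ := by
      ext z
      simp only [Set.mem_iUnion, Set.mem_union, Fin.exists_fin_succ]
    rw [h, interior_union_isClosed_of_interior_empty (hc 0)]
    · exact hi 0
    · exact ih (fun i => hc _) fun i => hi _

/-! ### Measures of finite energy on arcs -/

/-- On the unit square the function agrees with the convolution integrand of two integrable
functions on the line, the indicator of `[0, 1]` and the logarithm cut off to `[-1, 1]`. -/
theorem integrable_log_abs_sub : Integrable (fun p : ℝ × ℝ => Real.log |p.1 - p.2|)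
    ((volume.restrict (Set.Icc (0 : ℝ) 1)).prod (volume.restrict (Set.Icc (0 : ℝ) 1))) := by
  have h1 : Integrable ((Set.Icc (0 : ℝ) 1).indicator fun _ => (1 : ℝ)) :=
    (integrable_indicator_iff measurableSet_Icc).2 (integrable_const _)
  have h2 : Integrable ((Set.Icc (-1 : ℝ) 1).indicator Real.log) := by
    rw [integrable_indicator_iff measurableSet_Icc,
      ← intervalIntegrable_iff_integrableOn_Icc_of_le (by norm_num)]
    exact intervalIntegral.intervalIntegrable_log'
  have h3 := (h1.convolution_integrand (ContinuousLinearMap.mul ℝ ℝ) h2).integrableOn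
    (s := Set.Icc (0 : ℝ) 1 ×ˢ Set.Icc (0 : ℝ) 1)
  rw [Measure.prod_restrict]
  refine (integrableOn_congr_fun (fun p hp => ?_) (measurableSet_Icc.prod measurableSet_Icc)).1 h3
  obtain ⟨⟨a1, a2⟩, b1, b2⟩ := hp
  rw [Set.indicator_of_mem (by exact ⟨b1, b2⟩), Set.indicator_of_mem (by constructor <;> linarith)]
  simp [Real.log_abs]

theorem ae_prod_ne : ∀ᵐ p : ℝ × ℝ
    ∂((volume.restrict (Set.Icc (0 : ℝ) 1)).prod (volume.restrict (Set.Icc (0 : ℝ) 1))),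
    p.1 ≠ p.2 := by
  have hm : MeasurableSet {p : ℝ × ℝ | p.1 = p.2} := measurableSet_eq_fun measurable_fst measurable_snd
  rw [ae_iff]
  simp only [ne_eq, not_not]
  rw [Measure.measure_prod_null hm]
  refine Eventually.of_forall fun x => ?_
  have : Prod.mk x ⁻¹' {p : ℝ × ℝ | p.1 = p.2} = {x} := by ext; simp [eq_comm]
  beta_reduce
  rw [this]
  simp

/-- An expanding measurable map carries Lebesgue measure to a measure of finite energy. -/
theorem finiteEnergy_map {φ : ℝ → ℂ} (hφ : Measurable φ) {d R : ℝ} (hd : 0 < d)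
    (h : ∀ y ∈ Set.Icc (0 : ℝ) 1, ∀ y' ∈ Set.Icc (0 : ℝ) 1,
      d * |y - y'| ≤ ‖φ y - φ y'‖ ∧ ‖φ y - φ y'‖ ≤ R) :
    FiniteEnergy ((volume.restrict (Set.Icc (0 : ℝ) 1)).map φ)
      ((volume.restrict (Set.Icc (0 : ℝ) 1)).map φ) := by
  set m := volume.restrict (Set.Icc (0 : ℝ) 1) with hm
  have hmem : ∀ᵐ p ∂(m.prod m), p.1 ∈ Set.Icc (0 : ℝ) 1 ∧ p.2 ∈ Set.Icc (0 : ℝ) 1 := by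
    have := ae_restrict_mem (μ := volume) (measurableSet_Icc.prod measurableSet_Icc :
      MeasurableSet (Set.Icc (0 : ℝ) 1 ×ˢ Set.Icc (0 : ℝ) 1))
    rwa [Measure.volume_eq_prod, ← Measure.prod_restrict] at this
  have hmap := Measure.map_prod_map m m hφ hφ
  have hset : MeasurableSet {p : ℂ × ℂ | p.1 ≠ p.2} :=
    (measurableSet_eq_fun measurable_fst measurable_snd).compl
  have hpos : ∀ᵐ p ∂(m.prod m), 0 < d * |p.1 - p.2| ∧
      d * |p.1 - p.2| ≤ ‖φ p.1 - φ p.2‖ ∧ ‖φ p.1 - φ p.2‖ ≤ R := by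
    filter_upwards [hmem, ae_prod_ne] with p hp hne
    exact ⟨mul_pos hd (abs_pos.2 (sub_ne_zero.2 hne)), h _ hp.1 _ hp.2⟩
  constructor
  · rw [hmap, ae_map_iff (hφ.prodMap hφ).aemeasurable hset]
    filter_upwards [hpos] with p hp
    have := hp.1.trans_le hp.2.1
    exact fun h => by
      simp only [Prod.map] at h
      rw [h, sub_self, norm_zero] at this
      exact this.false
  · rw [hmap, integrable_map_measure (Measurable.aestronglyMeasurable (by fun_prop))
      (hφ.prodMap hφ).aemeasurable]
    have hb : Integrable (fun p : ℝ × ℝ => |Real.log d| + abs (Real.log |p.1 - p.2|) + |Real.log R|)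
        (m.prod m) := ((integrable_const _).add integrable_log_abs_sub.abs).add (integrable_const _)
    refine hb.mono' (Measurable.aestronglyMeasurable (by fun_prop)) ?_
    filter_upwards [hpos] with p ⟨h1, h2, h3⟩
    have h4 : |p.1 - p.2| ≠ 0 := (pos_of_mul_pos_right h1 hd.le).ne'
    have e1 := Real.log_le_log h1 h2
    have e2 := Real.log_le_log (h1.trans_le h2) h3
    rw [Real.log_mul hd.ne' h4] at e1
    simp only [Function.comp_apply, Prod.map, Real.norm_eq_abs]
    have a1 := neg_abs_le (Real.log d)
    have a2 := neg_abs_le (Real.log |p.1 - p.2|)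
    have a3 := le_abs_self (Real.log R)
    have b1 := abs_nonneg (Real.log d)
    have b2 := abs_nonneg (Real.log |p.1 - p.2|)
    have b3 := abs_nonneg (Real.log R)
    rw [abs_le]
    constructor <;> linarith

/-- Project the curve onto its chord and let `φ y` be the point where level `y` is first reached.
Projection does not increase distances, so `φ` is expanding, and the image of Lebesgue measure has
finite energy; no rectifiability is needed. -/
theorem exists_finiteEnergy_of_continuous {γ : ℝ → ℂ} (hγ : Continuous γ) {s t : ℝ} (hst : s ≤ t)
    (hne : γ s ≠ γ t) : ∃ τ ∈ unitMeasures (γ '' Set.Icc s t), FiniteEnergy τ τ := by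
  set e : ℂ := γ t - γ s with he
  have he0 : 0 < ‖e‖ := norm_pos_iff.2 (sub_ne_zero.2 hne.symm)
  set h : ℝ → ℝ := fun x => inner ℝ e (γ x - γ s) with hh
  have hcont : Continuous h := by fun_prop
  have hs : h s = 0 := by simp [hh]
  have ht : h t = ‖e‖ ^ 2 := by simp only [hh, ← he, real_inner_self_eq_norm_sq]
  set N : ℝ → Set ℝ := fun y => Set.Icc s t ∩ h ⁻¹' {y * ‖e‖ ^ 2} with hN
  have hNc : ∀ y, IsCompact (N y) := fun y =>
    isCompact_Icc.inter_right (isClosed_singleton.preimage hcont)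
  have hNne : ∀ y ∈ Set.Icc (0 : ℝ) 1, (N y).Nonempty := by
    intro y hy
    obtain ⟨x, hx, hxy⟩ := intermediate_value_Icc hst hcont.continuousOn
      (show y * ‖e‖ ^ 2 ∈ Set.Icc (h s) (h t) by
        rw [hs, ht]
        exact ⟨mul_nonneg hy.1 (by positivity), by nlinarith [hy.2, sq_nonneg ‖e‖]⟩)
    exact ⟨x, hx, hxy⟩
  have hmem : ∀ y ∈ Set.Icc (0 : ℝ) 1, sInf (N y) ∈ N y := fun y hy =>
    (hNc y).sInf_mem (hNne y hy)
  have hmono : ∀ y ∈ Set.Icc (0 : ℝ) 1, ∀ y' ∈ Set.Icc (0 : ℝ) 1, y ≤ y' →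
      sInf (N y) ≤ sInf (N y') := by
    intro y hy y' hy' hle
    obtain ⟨g1, g2⟩ := hmem y' hy'
    have g2' : h (sInf (N y')) = y' * ‖e‖ ^ 2 := g2
    obtain ⟨x, hx, hxy⟩ := intermediate_value_Icc g1.1 hcont.continuousOn
      (show y * ‖e‖ ^ 2 ∈ Set.Icc (h s) (h (sInf (N y'))) by
        rw [hs, g2']
        exact ⟨mul_nonneg hy.1 (by positivity), by gcongr⟩)
    exact (csInf_le (hNc y).bddBelow ⟨⟨hx.1, hx.2.trans g1.2⟩, hxy⟩).trans hx.2
  set k : ℝ → ℝ := fun y => max 0 (min 1 y) with hk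
  have hkm : ∀ y, k y ∈ Set.Icc (0 : ℝ) 1 := fun y =>
    ⟨le_max_left _ _, max_le zero_le_one (min_le_left _ _)⟩
  have hk_eq : ∀ y ∈ Set.Icc (0 : ℝ) 1, k y = y := fun y hy => by
    simp [hk, hy.1, hy.2]
  -- By the intermediate value theorem the first hitting time increases with the level; this is
  -- where the measurability of `φ` comes from. The clamp `k` only extends it to the whole line.
  have hT : Monotone fun y => sInf (N (k y)) := fun y y' hle =>
    hmono _ (hkm _) _ (hkm _) (max_le_max le_rfl (min_le_min le_rfl hle))
  set φ : ℝ → ℂ := fun y => γ (sInf (N (k y))) with hφ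
  have hφm : Measurable φ := hγ.measurable.comp hT.measurable
  have hφmem : ∀ y, φ y ∈ γ '' Set.Icc s t := fun y => ⟨_, (hmem _ (hkm y)).1, rfl⟩
  have hKc : IsCompact (γ '' Set.Icc s t) := isCompact_Icc.image hγ
  obtain ⟨R, hR⟩ := hKc.isBounded.exists_norm_le
  refine ⟨(volume.restrict (Set.Icc (0 : ℝ) 1)).map φ, ⟨?_, ?_⟩,
    finiteEnergy_map hφm he0 (R := R + R) fun y hy y' hy' => ⟨?_, ?_⟩⟩
  · have : IsProbabilityMeasure (volume.restrict (Set.Icc (0 : ℝ) 1)) := ⟨by simp⟩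
    exact Measure.isProbabilityMeasure_map hφm.aemeasurable
  · rw [Measure.map_apply hφm hKc.measurableSet.compl]
    have : φ ⁻¹' (γ '' Set.Icc s t)ᶜ = ∅ := by
      ext y
      simp only [Set.mem_preimage, Set.mem_compl_iff, Set.mem_empty_iff_false, iff_false, not_not]
      exact hφmem y
    rw [this, measure_empty]
  · have e1 : h (sInf (N (k y))) = y * ‖e‖ ^ 2 := by
      have := (hmem _ (hkm y)).2
      rwa [hk_eq y hy] at this ⊢
    have e2 : h (sInf (N (k y'))) = y' * ‖e‖ ^ 2 := by
      have := (hmem _ (hkm y')).2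
      rwa [hk_eq y' hy'] at this ⊢
    have e3 : inner ℝ e (φ y - φ y') = (y - y') * ‖e‖ ^ 2 := by
      rw [sub_mul, ← e1, ← e2, hh, ← inner_sub_right]
      simp [hφ]
    have e4 := abs_real_inner_le_norm e (φ y - φ y')
    rw [e3, abs_mul, abs_of_nonneg (sq_nonneg ‖e‖)] at e4
    have e5 : ‖e‖ * (‖e‖ * |y - y'|) ≤ ‖e‖ * ‖φ y - φ y'‖ := by linarith
    exact le_of_mul_le_mul_left e5 he0
  · exact (norm_sub_le _ _).trans (add_le_add (hR _ (hφmem y)) (hR _ (hφmem y')))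

/-- A point of the arc off `C` lies on a nondegenerate subarc off `C`; injectivity makes its end
points distinct. -/
theorem IsArc.exists_finiteEnergy {A C : Set ℂ} {x y : ℂ} (hA : IsArc A x y) (hC : IsClosed C)
    (hne : (A \ C).Nonempty) : ∃ τ ∈ unitMeasures A, FiniteEnergy τ τ ∧ τ C = 0 := by
  obtain ⟨γ, hγ, rfl⟩ := hA
  obtain ⟨_, ⟨t, rfl⟩, htC⟩ := hne
  have hU : γ ⁻¹' Cᶜ ∈ 𝓝 t := γ.continuous.continuousAt (hC.isOpen_compl.mem_nhds htC)
  obtain ⟨b, c, ⟨hb, hc⟩, hnhds, hsub⟩ := exists_Icc_mem_subset_of_mem_nhds hU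
  have hbc : b < c := by
    refine lt_of_le_of_ne (hb.trans hc) fun h => ?_
    subst h
    rw [Set.Icc_self, le_antisymm hb hc] at hnhds
    have : (𝓝[≠] t).NeBot := inferInstance
    exact (infinite_of_mem_nhds t hnhds) (Set.finite_singleton t)
  have e1 : ∀ z : I, γ.extend z = γ z := fun z => γ.extend_apply z.2
  obtain ⟨τ, hτ, fτ⟩ := exists_finiteEnergy_of_continuous γ.continuous_extend
    (show (b : ℝ) ≤ c from hbc.le) (by rw [e1, e1]; exact fun h => hbc.ne (hγ h))
  have himg : γ.extend '' Set.Icc (b : ℝ) c ⊆ Set.range γ \ C := by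
    rintro _ ⟨z, hz, rfl⟩
    have hzI : z ∈ I := ⟨b.2.1.trans hz.1, hz.2.trans c.2.2⟩
    have h2 : γ.extend z = γ ⟨z, hzI⟩ := γ.extend_apply hzI
    rw [h2]
    exact ⟨⟨_, rfl⟩, hsub ⟨hz.1, hz.2⟩⟩
  refine ⟨τ, unitMeasures_mono (himg.trans Set.sdiff_subset) hτ, fτ,
    measure_mono_null (fun z hz hz2 => (himg hz2).2 hz) hτ.2⟩

/-! ### The extremal pair of a compact and its dual -/

section
variable {a : Fin 3 → ℂ} {v : ℂ} {K S F : Set ℂ} {L SArc ΓArc : Fin 3 → Set ℂ}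

theorem IsStar.isCompact (h : IsStar a v K L) : IsCompact K := by
  rw [h.eq_iUnion]
  exact isCompact_iUnion fun j => (h.isArc j).isCompact

theorem IsStar.nonempty (h : IsStar a v K L) : K.Nonempty := by
  rw [h.eq_iUnion]
  exact ⟨a 0, Set.mem_iUnion.2 ⟨0, (h.isArc 0).left_mem⟩⟩

theorem IsStar.interior_eq_empty (h : IsStar a v K L) : interior K = ∅ := by
  rw [h.eq_iUnion]
  exact interior_iUnion_eq_empty (fun j => (h.isArc j).isCompact.isClosed)
    fun j => (h.isArc j).interior_eq_empty

theorem IsStar.exists_finiteEnergy (h : IsStar a v K L) {C : Set ℂ} (hC : IsClosed C)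
    (hne : (K \ C).Nonempty) : ∃ τ ∈ unitMeasures K, FiniteEnergy τ τ ∧ τ C = 0 := by
  obtain ⟨p, hp, hpC⟩ := hne
  rw [h.eq_iUnion] at hp ⊢
  obtain ⟨j, hj⟩ := Set.mem_iUnion.1 hp
  obtain ⟨τ, h1, h2⟩ := (h.isArc j).exists_finiteEnergy hC ⟨p, hj, hpC⟩
  exact ⟨τ, unitMeasures_mono (Set.subset_iUnion L j) h1, h2⟩

theorem IsDualCompact.isCompact (h : IsDualCompact a v S SArc ΓArc F) : IsCompact F := by
  obtain ⟨c, toV, toA, D, -, h1, h2, -, -, -, rfl, -⟩ := h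
  exact (isCompact_iUnion fun j => (h1 j).isCompact).union
    (isCompact_iUnion fun j => (h2 j).isCompact)

theorem IsDualCompact.nonempty (h : IsDualCompact a v S SArc ΓArc F) : F.Nonempty := by
  obtain ⟨c, toV, toA, D, -, h1, -, -, -, -, rfl, -⟩ := h
  exact ⟨c, Or.inl (Set.mem_iUnion.2 ⟨0, (h1 0).left_mem⟩)⟩

theorem IsDualCompact.interior_eq_empty (h : IsDualCompact a v S SArc ΓArc F) :
    interior F = ∅ := by
  obtain ⟨c, toV, toA, D, -, h1, h2, -, -, -, rfl, -⟩ := h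
  rw [interior_union_isClosed_of_interior_empty
    (isCompact_iUnion fun j => (h1 j).isCompact).isClosed]
  · exact interior_iUnion_eq_empty (fun j => (h1 j).isCompact.isClosed)
      fun j => (h1 j).interior_eq_empty
  · exact interior_iUnion_eq_empty (fun j => (h2 j).isCompact.isClosed)
      fun j => (h2 j).interior_eq_empty

theorem IsDualCompact.exists_finiteEnergy (h : IsDualCompact a v S SArc ΓArc F) {C : Set ℂ}
    (hC : IsClosed C) (hne : (F \ C).Nonempty) :
    ∃ τ ∈ unitMeasures F, FiniteEnergy τ τ ∧ τ C = 0 := by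
  obtain ⟨c, toV, toA, D, -, h1, h2, -, -, -, rfl, -⟩ := h
  obtain ⟨p, hp | hp, hpC⟩ := hne <;> obtain ⟨j, hj⟩ := Set.mem_iUnion.1 hp
  · obtain ⟨τ, g1, g2⟩ := (h1 j).exists_finiteEnergy hC ⟨p, hj, hpC⟩
    exact ⟨τ, unitMeasures_mono ((Set.subset_iUnion toV j).trans Set.subset_union_left) g1, g2⟩
  · obtain ⟨τ, g1, g2⟩ := (h2 j).exists_finiteEnergy hC ⟨p, hj, hpC⟩
    exact ⟨τ, unitMeasures_mono ((Set.subset_iUnion toA j).trans Set.subset_union_right) g1, g2⟩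

/-- A point of an arc `Γ_j` other than its end points lies in `D_j`, hence off the dual compact. -/
theorem IsDualCompact.finite_inter (h : IsDualCompact a v S SArc ΓArc F) :
    ((⋃ j, ΓArc j) ∩ F).Finite := by
  obtain ⟨c, toV, toA, D, -, -, -, -, -, -, -, -, -, -, hF, -, hD⟩ := h
  refine ((Set.finite_range a).insert v).subset fun z ⟨hz, hzF⟩ => ?_
  obtain ⟨j, hj⟩ := Set.mem_iUnion.1 hz
  by_contra hne
  have h1 : z ∈ D j ∩ ⋃ i, ΓArc i := by
    rw [hD j]
    refine ⟨hj, fun h => hne ?_⟩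
    rcases h with rfl | rfl
    · exact Or.inr ⟨j, rfl⟩
    · exact Or.inl rfl
  have h2 : z ∈ Fᶜ := hF ▸ Set.mem_iUnion.2 ⟨j, h1.1⟩
  exact h2 hzF

/-- A nonempty open set meets a connected component of the complement of the dual compact, and
this component meets the union of the arcs. -/
theorem IsDualCompact.exists_component (h : IsDualCompact a v S SArc ΓArc F)
    (hΓ : ∀ j, IsArc (ΓArc j) (a j) v) {U : Set ℂ} (hU : IsOpen U) (hne : U.Nonempty) :
    ∃ D : Set ℂ, IsPreconnected D ∧ Disjoint D F ∧ (D ∩ U).Nonempty ∧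
      (D ∩ ⋃ j, ΓArc j).Nonempty := by
  have hint := h.interior_eq_empty
  obtain ⟨c, toV, toA, D, -, -, -, -, -, -, -, -, hconn, -, hF, -, hD⟩ := h
  obtain ⟨z, hzU, hzF⟩ : ∃ z ∈ U, z ∉ F := by
    by_contra! hsub
    have := interior_maximal hsub hU
    rw [hint] at this
    exact hne.ne_empty (Set.subset_empty_iff.1 this)
  have hzF' : z ∈ Fᶜ := hzF
  rw [hF] at hzF'
  obtain ⟨j, hj⟩ := Set.mem_iUnion.1 hzF'
  refine ⟨D j, (hconn j).isPreconnected, ?_, ⟨z, hj, hzU⟩, ?_⟩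
  · refine Set.disjoint_left.2 fun x hx hxF => ?_
    have : x ∈ Fᶜ := hF ▸ Set.mem_iUnion.2 ⟨j, hx⟩
    exact this hxF
  · rw [hD j]
    obtain ⟨x, hx, hx1, hx2⟩ := (hΓ j).exists_mem_ne
    exact ⟨x, hx, fun h => h.elim hx1 hx2⟩

end

section
variable {a : Fin 3 → ℂ} {v : ℂ} {S Γ F : Set ℂ} {SArc ΓArc : Fin 3 → Set ℂ} {ψ : ℂ → ℝ}
  {lam₁ lam₂ : Measure ℂ}

theorem support_subset_of_mem_unitMeasures {K : Set ℂ} (hK : IsClosed K) {μ : Measure ℂ}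
    (hμ : μ ∈ unitMeasures K) : μ.support ⊆ K :=
  Measure.support_subset_of_isClosed hK (ae_iff.2 hμ.2)

/-- If the support were smaller than `Γ`, the contact set would contain the whole complement of the
support, in particular that of `Γ`. The support of `lam₂` would then lie in `Γ`, so `lam₂` would be
carried by the finite set `Γ ∩ F`, although it has no atoms. -/
theorem support_fst_eq (hΓ : IsStar a v Γ ΓArc) (hconn : IsConnected Γᶜ)
    (hF : IsDualCompact a v S SArc ΓArc F) (h₁ : lam₁ ∈ unitMeasures Γ)
    (h₂ : lam₂ ∈ unitMeasures F) (f₁ : FiniteEnergy lam₁ lam₁) (f₂ : FiniteEnergy lam₂ lam₂)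
    (hmin : ∀ μ ∈ unitMeasures Γ, ∀ ν ∈ unitMeasures F, FiniteEnergy μ μ → FiniteEnergy ν ν →
      realVectorEnergy ψ lam₁ lam₂ ≤ realVectorEnergy ψ μ ν) : lam₁.support = Γ := by
  have := h₁.1
  have := h₂.1
  refine (support_subset_of_mem_unitMeasures hΓ.isCompact.isClosed h₁).antisymm ?_
  by_contra hsub
  obtain ⟨τ, hτ, fτ, hτ0⟩ := hΓ.exists_finiteEnergy Measure.isClosed_support
    (Set.sdiff_nonempty.2 hsub)
  obtain ⟨U, hU, hne, hdis, hD⟩ := exists_isOpen_contact (c := 1) (C := 0) (ψ := fun _ => 0)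
    hΓ.isCompact hF.isCompact h₁ h₂ f₁ f₂ continuous_const
    (fun z => ⟨1, one_pos, fun r _ _ => by rw [Real.circleAverage_const]⟩) (by simp) one_pos
    (fun τ hτ fτ => by
      have := realVectorEnergy_variation_fst hΓ.isCompact hF.isCompact h₁ h₂ f₁ f₂ hmin hτ fτ
      simpa using this) hτ fτ hτ0
  have hsupp := support_subset_of_mem_unitMeasures hΓ.isCompact.isClosed h₁
  have hdense : Dense Γᶜ := interior_eq_empty_iff_dense_compl.1 hΓ.interior_eq_empty
  -- The complement of the support lies between the connected set `Γᶜ` and its closure, which is the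
  -- whole plane because `Γ` has empty interior.
  have hpre : IsPreconnected lam₁.supportᶜ :=
    hconn.isPreconnected.subset_closure (Set.compl_subset_compl.2 hsupp)
      (by rw [hdense.closure_eq]; exact Set.subset_univ _)
  obtain ⟨z, hzU, hzΓ⟩ := hdense.inter_open_nonempty U hU hne
  have hsubU := hD _ hpre disjoint_compl_left ⟨z, fun h => hzΓ (hsupp h), hzU⟩
  have h3 : lam₂.support ⊆ Γ := fun x hx => by
    by_contra hxΓ
    exact Set.disjoint_left.1 hdis (hsubU fun h => hxΓ (hsupp h)) hx
  have h4 : lam₂ ((⋃ j, ΓArc j) ∩ F)ᶜ = 0 := by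
    rw [Set.compl_inter]
    refine measure_union_null (measure_mono_null (Set.compl_subset_compl.2 ?_)
      (Measure.measure_compl_support (μ := lam₂))) h₂.2
    rwa [← hΓ.eq_iUnion]
  have h5 : lam₂ ((⋃ j, ΓArc j) ∩ F) = 0 := by
    have := f₂.measure_singleton
    rw [← Set.biUnion_of_singleton ((⋃ j, ΓArc j) ∩ F)]
    exact (measure_biUnion_null_iff hF.finite_inter.countable).2 fun x _ => this x
  have h6 := measure_union_null h5 h4
  rw [Set.union_compl_self, measure_univ] at h6
  exact one_ne_zero h6

/-- Here `c = 4`, so the growth of `ψ` must be at most `3 log ‖z‖`. Otherwise the contact set would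
swallow a component of the complement of `F`, and this component meets `Γ`, the support of `lam₁`:
there the contact set may not go. -/
theorem support_snd_eq (hΓ : IsStar a v Γ ΓArc) (hF : IsDualCompact a v S SArc ΓArc F)
    (hψ : Continuous ψ) (hsub : ∀ z, IsSubmeanAt ψ z) {C : ℝ}
    (hgrow : ∀ᶠ z in Bornology.cobounded ℂ, ψ z ≤ (4 - 1) * Real.log ‖z‖ + C)
    (h₁ : lam₁ ∈ unitMeasures Γ) (h₂ : lam₂ ∈ unitMeasures F) (f₁ : FiniteEnergy lam₁ lam₁)
    (f₂ : FiniteEnergy lam₂ lam₂)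
    (hmin : ∀ μ ∈ unitMeasures Γ, ∀ ν ∈ unitMeasures F, FiniteEnergy μ μ → FiniteEnergy ν ν →
      realVectorEnergy ψ lam₁ lam₂ ≤ realVectorEnergy ψ μ ν) (hs₁ : lam₁.support = Γ) :
    lam₂.support = F := by
  have hsupp := support_subset_of_mem_unitMeasures hF.isCompact.isClosed h₂
  refine hsupp.antisymm ?_
  by_contra hsub'
  obtain ⟨τ, hτ, fτ, hτ0⟩ := hF.exists_finiteEnergy Measure.isClosed_support
    (Set.sdiff_nonempty.2 hsub')
  obtain ⟨U, hU, hne, hdis, hD⟩ := exists_isOpen_contact hF.isCompact hΓ.isCompact h₂ h₁ f₂ f₁ hψ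
    hsub hgrow four_pos (fun τ hτ fτ =>
      realVectorEnergy_variation_snd hΓ.isCompact hF.isCompact hψ h₁ h₂ f₁ f₂ hmin hτ fτ) hτ fτ hτ0
  obtain ⟨D, hDc, hDF, hDU, x, hxD, hxΓ⟩ := hF.exists_component hΓ.isArc hU hne
  refine Set.disjoint_left.1 hdis (hD D hDc (hDF.mono_right hsupp) hDU hxD) ?_
  rwa [hs₁, hΓ.eq_iUnion]

end

/-! ### The extremal pair: existence, uniqueness and supports -/

theorem mainTheorem3 (a α : Fin 3 → ℂ) (ha : Function.Injective a)
    (hα : ∀ j, ∀ n : ℤ, α j ≠ n) (hsum : ∑ j, α j = 0)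
    (v : ℂ) (S : Set ℂ) (SArc : Fin 3 → Set ℂ) (hS : IsStahlStar a α v S SArc)
    (g : ℂ → ℝ) (hg : IsGreenAtInfty S g)
    (Γ : Set ℂ) (ΓArc : Fin 3 → Set ℂ) (hΓ : IsInFamilyG a α v SArc Γ ΓArc)
    (Γperp : Set ℂ) (hperp : IsDualCompact a v S SArc ΓArc Γperp) :
    ∃ lam₁ ∈ unitMeasures Γ, ∃ lam₂ ∈ unitMeasures Γperp,
      lam₁.support = Γ ∧ lam₂.support = Γperp ∧
      vectorEnergy interactionMatrix (fun z => 3 * g z) Γperp ![lam₁, lam₂]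
        = infVectorEnergy interactionMatrix (fun z => 3 * g z) Γ Γperp ∧
      ∀ μ₁ ∈ unitMeasures Γ, ∀ μ₂ ∈ unitMeasures Γperp,
        vectorEnergy interactionMatrix (fun z => 3 * g z) Γperp ![μ₁, μ₂]
          = infVectorEnergy interactionMatrix (fun z => 3 * g z) Γ Γperp →
        μ₁ = lam₁ ∧ μ₂ = lam₂ := by
  have hSc := hS.isStar.isCompact
  have hSne := hS.isStar.nonempty
  have hE := hΓ.isStar.isCompact
  have hF := hperp.isCompact
  set ψ : ℂ → ℝ := fun z => 3 * g z with hψdef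
  have hψ : Continuous ψ := continuous_const.mul hg.continuous
  have hψ0 : ∀ z, 0 ≤ ψ z := fun z => mul_nonneg (by norm_num) (IsGreenAtInfty.nonneg hSc hSne hg z)
  have hsub : ∀ z, IsSubmeanAt ψ z := fun z =>
    (IsGreenAtInfty.isSubmeanAt hSc hSne hg z).const_mul (by norm_num)
  obtain ⟨C, hC⟩ := hg.log_pole
  -- The factor `3` in the external field matches `4 - 1`: it makes the field of the second measure
  -- bounded above at infinity.
  have hgrow : ∀ᶠ z in Bornology.cobounded ℂ, ψ z ≤ (4 - 1) * Real.log ‖z‖ + 3 * C := by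
    filter_upwards [hC] with z hz
    have := (abs_le.1 hz).2
    simp only [hψdef]
    linarith
  obtain ⟨τ₁, hτ₁, fτ₁, -⟩ := hΓ.isStar.exists_finiteEnergy isClosed_empty
    (by rw [Set.sdiff_empty]; exact hΓ.isStar.nonempty)
  obtain ⟨τ₂, hτ₂, fτ₂, -⟩ := hperp.exists_finiteEnergy isClosed_empty
    (by rw [Set.sdiff_empty]; exact hperp.nonempty)
  obtain ⟨lam₁, h₁, lam₂, h₂, f₁, f₂, hmin⟩ :=
    exists_realVectorEnergy_minimizer hE hF hψ hψ0 hτ₁ hτ₂ fτ₁ fτ₂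
  have hval := vectorEnergy_eq_of_finiteEnergy (ψ := ψ) hE hF h₁ h₂ f₁ f₂
  have hinf : infVectorEnergy interactionMatrix ψ Γ Γperp
      = (realVectorEnergy ψ lam₁ lam₂ : EReal) := by
    -- Pairs outside the finite-energy class have value `⊤`, so the infimum is decided among the
    -- pairs for which `hmin` was proved.
    refine le_antisymm ?_ (le_iInf₂ fun μ hμ => le_iInf₂ fun ν hν => ?_)
    · rw [← hval]
      exact (iInf₂_le lam₁ h₁).trans (iInf₂_le lam₂ h₂)
    · by_cases htop : vectorEnergy interactionMatrix ψ Γperp ![μ, ν] = ⊤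
      · rw [htop]
        exact le_top
      · obtain ⟨g₁, g₂⟩ := finiteEnergy_of_vectorEnergy hE hF hμ hν htop
        rw [vectorEnergy_eq_of_finiteEnergy hE hF hμ hν g₁ g₂, EReal.coe_le_coe_iff]
        exact hmin μ hμ ν hν g₁ g₂
  have hs₁ := support_fst_eq hΓ.isStar hΓ.admissible.isConnected_compl hperp h₁ h₂ f₁ f₂ hmin
  refine ⟨lam₁, h₁, lam₂, h₂, hs₁,
    support_snd_eq hΓ.isStar hperp hψ hsub hgrow h₁ h₂ f₁ f₂ hmin hs₁, hval.trans hinf.symm,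
    fun μ₁ hμ₁ μ₂ hμ₂ heq => ?_⟩
  rw [hinf] at heq
  obtain ⟨g₁, g₂⟩ := finiteEnergy_of_vectorEnergy hE hF hμ₁ hμ₂
    (by rw [heq]; exact EReal.coe_ne_top _)
  rw [vectorEnergy_eq_of_finiteEnergy hE hF hμ₁ hμ₂ g₁ g₂, EReal.coe_eq_coe_iff] at heq
  exact realVectorEnergy_minimizer_unique hE hF hψ hμ₁ hμ₂ h₁ h₂ g₁ g₂ f₁ f₂ heq hmin

end
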